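/- Let $N\ge 1$, let $\Omega\subset\mathbb{R}^N$ be a bounded open set with Lipschitz boundary, let $\alpha\ge 0$ and let $\mu$ be a finite Borel measure on $(0,1)$ (possibly $\mu=0$). For $s\in(0,1)$ put $$c_{N,s}=-\frac{2^{2s-1}\Gamma\left(\frac{N+2s}{2}\right)}{\pi^{N/2}\,\Gamma(-s)},\qquad (-\Delta)^s v(x)=c_{N,s}\int_{\mathbb{R}^N}\frac{2v(x)-v(x+y)-v(x-y)}{|y|^{N+2s}}\,dy,$$ $$\mathscr{N}_s v(x)=c_{N,s}\int_\Omega\frac{v(x)-v(y)}{|x-y|^{N+2s}}\,dy,\qquad L_{\alpha,\mu}v=-\alpha\Delta v+\int_{(0,1)}(-\Delta)^s v\,d\mu(s).$$ A function $v$ satisfies the homogeneous $(\alpha,\mu)$-Neumann conditions if $\partial_\nu v=0$ at every point of $\partial\Omega$ having an outer unit normal $\nu$, in case $\alpha\ne 0$, and $\int_{(0,1)}\mathscr{N}_s v(x)\,d\mu(s)=0$ for every $x\in\mathbb{R}^N\setminus\overline\Omega$, in case $\mu\ne 0$. Let $u$ be a classical solution of $$\partial_t u+L_{\alpha,\mu}u=0\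 \text{ in }\Omega\times(0,\infty),\qquad u(\cdot,0)=u_0\ \text{ in }\Omega,$$ with homogeneous $(\alpha,\mu)$-Neumann conditions for every $t>0$; that is, $u(\cdot,t)\in L^\infty(\mathbb{R}^N)\cap C(\overline\Omega)\cap C^2(\Omega)$ for every $t\ge 0$, $u(x,\cdot)\in C^1((0,\infty))\cap C([0,\infty))$ for every $x\in\Omega$, and the equation, the initial condition and the Neumann conditions hold pointwise. Assume that 1. $\partial_t u\in L^\infty_{loc}((0,\infty),L^1(\Omega))$, and for some $\delta>0$ the functions $u(\cdot,t)$, $0<t<\delta$, are dominated in absolute value, a.e. in $\Omega$, by one function in $L^1(\Omega)$; 2. for every $t>0$, $\alpha\Delta u(\cdot,t)\in L^1(\Omega)$, and $(x,s)\mapsto(-\Delta)^s u(x,t)$ belongs to $L^1(\Omega\times(0,1),\,dx\,d\mu(s))$; 3. if $\alpha\neq 0$, then $u(\cdot,t)\in C^1(\overline\Omega)$ for every $t>0$; 4. if $\mu\ne 0$, then, for every $t>0$, the function $(x,y,s)\mapsto\dfrac{u(x,t)-u(y,t)}{|x-y|^{N+2s}}$ belongs to $L^1(\Omega\times(\mathbb{R}^N\setminus\Omega)\times(0,1),\,dx\,dy\,d\mu(s))$.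 Then $$\int_\Omega u(x,t)\,dx=\int_\Omega u_0(x)\,dx\qquad\text{for every } t>0 .$$ -/

import Mathlib

open MeasureTheory Set Filter Topology

noncomputable section

namespace FracNeumann

/-- The Euclidean space `ℝ^N`. -/
abbrev Space (N : ℕ) : Type := EuclideanSpace ℝ (Fin N)

/-- The open interval `(0,1)` of fractional exponents, as a measurable space. -/
abbrev Exponent : Type := Ioo (0 : ℝ) 1

variable {N : ℕ}

/-- The normalizing constant `c_{N,s} = - 2^{2s-1} Γ((N+2s)/2) / (π^{N/2} Γ(-s))`. -/
def fracConst (N : ℕ) (s : ℝ) : ℝ :=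
  -((2 : ℝ) ^ (2 * s - 1) * Real.Gamma (((N : ℝ) + 2 * s) / 2)) /
    (Real.pi ^ ((N : ℝ) / 2) * Real.Gamma (-s))

/-- The fractional Laplacian `(-Δ)^s v (x)`, as an integral of second differences. -/
def fracLaplacian (s : ℝ) (v : Space N → ℝ) (x : Space N) : ℝ :=
  fracConst N s * ∫ y, (2 * v x - v (x + y) - v (x - y)) / ‖y‖ ^ ((N : ℝ) + 2 * s)

/-- The nonlocal normal derivative `𝒩_s v (x) = c_{N,s} ∫_Ω (v(x) - v(y)) / |x-y|^{N+2s} dy`. -/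
def nonlocalNormalDeriv (Ω : Set (Space N)) (s : ℝ) (v : Space N → ℝ) (x : Space N) : ℝ :=
  fracConst N s * ∫ y in Ω, (v x - v y) / ‖x - y‖ ^ ((N : ℝ) + 2 * s)

/-- The operator `L_{α,μ} v = - α Δ v + ∫_{(0,1)} (-Δ)^s v dμ(s)`. -/
def mixedOperator (α : ℝ) (μ : Measure Exponent) (v : Space N → ℝ) (x : Space N) : ℝ :=
  -(α * Laplacian.laplacian v x) + ∫ s : Exponent, fracLaplacian (s : ℝ) v x ∂μ

/-- `Ω` has Lipschitz boundary: near each boundary point, `Ω` is the strict epigraph, in some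
direction `e`, of a Lipschitz function `γ` of the variables orthogonal to `e`. Such a `γ` is
written as a Lipschitz function on `ℝ^N` that is invariant in the direction `e`. -/
def HasLipschitzBoundary (Ω : Set (Space N)) : Prop :=
  ∀ x₀ ∈ frontier Ω, ∃ (e : Space N) (γ : Space N → ℝ) (K : NNReal) (r : ℝ),
    ‖e‖ = 1 ∧ LipschitzWith K γ ∧ (∀ (y : Space N) (c : ℝ), γ (y + c • e) = γ y) ∧ 0 < r ∧
      ∀ y ∈ Metric.ball x₀ r, (y ∈ Ω ↔ γ y < inner ℝ y e)

/-- `ν` is the outer unit normal to `Ω` at `x`: at first order at `x`, the set `Ω` is the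
half-space `{y | ⟪y - x, ν⟫ < 0}`. For a boundary that is locally a graph, this happens exactly
at the points over which the graph function is differentiable. -/
def IsOuterUnitNormal (Ω : Set (Space N)) (x ν : Space N) : Prop :=
  ‖ν‖ = 1 ∧ ∀ ε > (0 : ℝ), ∃ r > (0 : ℝ), ∀ y ∈ Metric.ball x r,
    (inner ℝ (y - x) ν < -(ε * ‖y - x‖) → y ∈ Ω) ∧ (ε * ‖y - x‖ < inner ℝ (y - x) ν → y ∉ Ω)

/-- `∂_ν v (x) = d`, the derivative at `x` in the direction `ν` being taken from the side
`{x + h ν | h ≤ 0}`, which is the inside of the set if `ν` is its outer normal. -/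
def HasNormalDeriv (v : Space N → ℝ) (x ν : Space N) (d : ℝ) : Prop :=
  HasDerivWithinAt (fun h : ℝ => v (x + h • ν)) d (Iic 0) 0

/-- The `(α,μ)`-Neumann conditions with data `g` outside `closure Ω` and `h` on `∂Ω`: the
nonlocal condition if `α = 0`, the local one if `μ = 0`, and both otherwise. -/
def NeumannConditions (α : ℝ) (μ : Measure Exponent) (Ω : Set (Space N)) (g h : Space N → ℝ)
    (v : Space N → ℝ) : Prop :=
  (α ≠ 0 → ∀ x ∈ frontier Ω, ∀ ν, IsOuterUnitNormal Ω x ν → HasNormalDeriv v x ν (h x)) ∧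
  (μ ≠ 0 → ∀ x ∈ (closure Ω)ᶜ,
    ∫ s : Exponent, nonlocalNormalDeriv Ω (s : ℝ) v x ∂μ = g x)

/-- The homogeneous `(α,μ)`-Neumann conditions. -/
def HomogeneousNeumannConditions (α : ℝ) (μ : Measure Exponent) (Ω : Set (Space N))
    (v : Space N → ℝ) : Prop :=
  NeumannConditions α μ Ω 0 0 v

/-- `v ∈ C¹(closure Ω)`: `v` is continuous on `closure Ω` and continuously differentiable in
`Ω`, with a gradient that extends continuously to `closure Ω`. -/
def IsC1UpToBoundary (Ω : Set (Space N)) (v : Space N → ℝ) : Prop :=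
  ContinuousOn v (closure Ω) ∧
    ∃ G : Space N → Space N, ContinuousOn G (closure Ω) ∧ ∀ x ∈ Ω, HasGradientAt v (G x) x

/-- `u` is a classical solution of `∂_t u + L_{α,μ} u = 0` in `Ω × (0,∞)` with `u(·,0) = u₀` in
`Ω` and homogeneous `(α,μ)`-Neumann conditions. -/
structure IsClassicalSolution (α : ℝ) (μ : Measure Exponent) (Ω : Set (Space N))
    (u₀ : Space N → ℝ) (u : Space N → ℝ → ℝ) : Prop where
  memLp_top : ∀ t ≥ 0, MemLp (fun x => u x t) ⊤ volume
  continuousOn_closure : ∀ t ≥ 0, ContinuousOn (fun x => u x t) (closure Ω)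
  contDiffOn_space : ∀ t ≥ 0, ContDiffOn ℝ 2 (fun x => u x t) Ω
  contDiffOn_time : ∀ x ∈ Ω, ContDiffOn ℝ 1 (u x) (Ioi 0)
  continuousOn_time : ∀ x ∈ Ω, ContinuousOn (u x) (Ici 0)
  equation : ∀ x ∈ Ω, ∀ t > 0, deriv (u x) t + mixedOperator α μ (fun z => u z t) x = 0
  initial : ∀ x ∈ Ω, u x 0 = u₀ x
  neumann : ∀ t > 0, HomogeneousNeumannConditions α μ Ω (fun x => u x t)

/-- `w ∈ L^∞_loc((0,∞), L¹(Ω))`: on each compact subset of `(0,∞)`, the `L¹(Ω)` norm of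
`w(·,t)` is essentially bounded in `t`. -/
def IsLocBoundedL1 (Ω : Set (Space N)) (w : Space N → ℝ → ℝ) : Prop :=
  ∀ K : Set ℝ, IsCompact K → K ⊆ Ioi 0 → ∃ C : ℝ, ∀ᵐ t ∂(volume.restrict K),
    IntegrableOn (fun x => w x t) Ω ∧ ∫ x in Ω, |w x t| ≤ C

end FracNeumann

end

/-!
Integrating the equation over `Ω` and over a time interval reduces the claim to `∫_Ω L u(·,t) = 0`
for each `t > 0`; the interchange of the integrals is Fubini's theorem, and the initial time is
reached by dominated convergence. The local and the nonlocal part of the operator are integrable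
separately, and each has zero integral.

*Local part* (`integral_laplacian_eq_zero`). With a smooth partition of unity it suffices to prove
Green's formula against a test function `χ` supported near one boundary point, where `Ω` is the set
of positive `height` above a Lipschitz graph. The formula is elementary against `χ` times a ramp in
the height (`integral_mul_laplacian_of_tsupport_subset`). The error is the integral of `χ` times the
derivative of the ramp along the gradient of `v`, over a layer of thickness `ε`. By Rademacher's
theorem almost every point lies over a point of differentiability of the graph, where a normal
exists, so that the Neumann condition makes the gradient tangential at the boundary point below.
The error is therefore at most the oscillation of the gradient over distances of order `ε`, times
`1/ε`, times the volume of the layer, which is of order `ε` (`GraphChart.volume_layer_le`).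

*Nonlocal part* (`integral_integral_fracLaplacian_eq_zero`). For almost every `s`, the integral of
the fractional Laplacian over `Ω` is twice the flux
`c_{N,s} ∫_Ω ∫_{Ωᶜ} (v(x) - v(y)) / |x-y|^p`, `p = N + 2s`; integrated in `s`, the flux vanishes by
the Neumann condition. To prove the flux formula (`integral_secondDiff_eq_of_measurable`), test the
second differences against a cutoff `η` at distance of order `r` from the boundary: by translation
invariance the result is the integral in `y` of `|y|^{-p}` times the pairing
`∫ (v(x) - v(x+y)) (η(x) - η(x+y)) dx`. Nothing is assumed on the derivatives of `v` near the
boundary, and the limit `r → 0` rests on the integrability of the interaction across the boundary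
alone. A Lipschitz domain has a fixed proportion of exterior in each ball around a point whose
distance to the exterior is at most comparable to the radius (`exists_volume_exterior_ge`), so
differences of `v` inside `Ω` can be compared with differences across the boundary.

* For `|y| ≥ r` this yields an integrable majorant (`lintegral_interaction_far_ne_top`), and the
  pairing converges to the flux, counted once from each side.
* For `|y| < r`, `η` is chosen as a double average. One average is moved to `v`
  (`pairing_cutoff`), which makes the pairing of second order in `y`, and the mean oscillation of `v`
  in the boundary layer is bounded by the interaction across the boundary at distances of order `r`
  (`exists_enorm_pairing_cutoff_le`). This tends to zero.
-/

noncomputable section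

namespace FracNeumann

variable {N : ℕ}

/-! ### Graph charts of a Lipschitz boundary -/

/-- The data of `HasLipschitzBoundary` at one point `x₀`: a direction, a Lipschitz function which is
constant in that direction, and a ball on which `Ω` is the strict epigraph of the function. -/
structure GraphChart (Ω : Set (Space N)) (x₀ : Space N) where
  dir : Space N
  graph : Space N → ℝ
  lip : NNReal
  radius : ℝ
  norm_dir : ‖dir‖ = 1
  lipschitz : LipschitzWith lip graph
  graph_add : ∀ (y : Space N) (c : ℝ), graph (y + c • dir) = graph y
  radius_pos : 0 < radius
  mem_iff' : ∀ y ∈ Metric.ball x₀ radius, (y ∈ Ω ↔ graph y < inner ℝ y dir)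

theorem HasLipschitzBoundary.nonempty_chart {Ω : Set (Space N)} (h : HasLipschitzBoundary Ω)
    {x₀ : Space N} (hx₀ : x₀ ∈ frontier Ω) : Nonempty (GraphChart Ω x₀) := by
  obtain ⟨e, γ, K, r, h1, h2, h3, h4, h5⟩ := h x₀ hx₀
  exact ⟨⟨e, γ, K, r, h1, h2, h3, h4, h5⟩⟩

namespace GraphChart

variable {Ω : Set (Space N)} {x₀ : Space N} (c : GraphChart Ω x₀)

/-- The height of a point above the graph, measured along the direction of the chart. -/
def height (x : Space N) : ℝ := inner ℝ x c.dir - c.graph x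

theorem mem_iff {y : Space N} (hy : y ∈ Metric.ball x₀ c.radius) : y ∈ Ω ↔ 0 < c.height y := by
  rw [c.mem_iff' y hy, height, sub_pos]

theorem height_add (y : Space N) (a : ℝ) : c.height (y + a • c.dir) = c.height y + a := by
  simp [height, c.graph_add, inner_add_left, inner_smul_left, c.norm_dir]
  ring

theorem lipschitz_height : LipschitzWith (1 + c.lip) c.height := by
  have h1 : LipschitzWith 1 (fun x : Space N => (inner ℝ x c.dir : ℝ)) := by
    refine LipschitzWith.of_dist_le_mul fun x y => ?_
    rw [Real.dist_eq, ← inner_sub_left, dist_eq_norm]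
    simpa [c.norm_dir] using abs_real_inner_le_norm (x - y) c.dir
  exact h1.sub c.lipschitz

theorem continuous_height : Continuous c.height := c.lipschitz_height.continuous

theorem height_eq_zero {b : Space N} (hΩ : IsOpen Ω) (hb : b ∈ frontier Ω)
    (hbr : b ∈ Metric.ball x₀ c.radius) : c.height b = 0 := by
  rw [hΩ.frontier_eq] at hb
  refine le_antisymm (not_lt.1 fun h => hb.2 ((c.mem_iff hbr).2 h)) (not_lt.1 fun h => ?_)
  have h1 : ∀ᶠ y in 𝓝 b, c.height y < 0 ∧ y ∈ Metric.ball x₀ c.radius :=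
    (c.continuous_height.continuousAt.eventually (gt_mem_nhds h)).and
      (Metric.isOpen_ball.mem_nhds hbr)
  obtain ⟨y, ⟨h2, h3⟩, h4⟩ := mem_closure_iff_nhds.1 hb.1 _ h1
  exact absurd ((c.mem_iff h3).1 h4) h2.le.not_gt

/-- Disjoint translates of a thin layer over the graph fit into one ball, so that the volume of
the layer is at most proportional to its thickness. -/
theorem volume_layer_le {ε : ℝ} (hε : 0 < ε) (hε1 : ε ≤ 1) :
    volume {x ∈ Metric.ball x₀ c.radius | 0 ≤ c.height x ∧ c.height x < ε} ≤
      ENNReal.ofReal (2 * ε) * volume (Metric.ball x₀ (c.radius + 1)) := by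
  set S := {x ∈ Metric.ball x₀ c.radius | 0 ≤ c.height x ∧ c.height x < ε} with hS
  have hSm : MeasurableSet S := by
    apply Metric.isOpen_ball.measurableSet.inter
    exact (measurableSet_le measurable_const c.continuous_height.measurable).inter
      (measurableSet_lt c.continuous_height.measurable measurable_const)
  set m := ⌊1 / ε⌋₊ with hm
  have hm1 : 1 ≤ m := by
    rw [hm, Nat.one_le_floor_iff, le_div_iff₀ hε]; simpa using hε1
  have hmle : (m : ℝ) * ε ≤ 1 := by
    rw [← le_div_iff₀ hε]; exact Nat.floor_le (by positivity)
  have hmge : 1 ≤ (m : ℝ) * (2 * ε) := by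
    have h1 : 1 / ε < m + 1 := Nat.lt_floor_add_one _
    have h2 : (1 : ℝ) ≤ m := by exact_mod_cast hm1
    rw [div_lt_iff₀ hε] at h1
    nlinarith
  set T : ℕ → Set (Space N) := fun j => (fun x => x + (-((j : ℝ) * ε)) • c.dir) ⁻¹' S with hT
  have hTm : ∀ j, MeasurableSet (T j) := fun j => (measurable_id.add_const _) hSm
  have hTv : ∀ j, volume (T j) = volume S := fun j => measure_preimage_add_right _ _ _
  have hdisj : Pairwise (Function.onFun Disjoint T) := by
    intro i j hij
    rw [Function.onFun, Set.disjoint_left]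
    intro x hi hj
    simp only [hT, hS, mem_preimage, mem_ofPred_eq, height_add] at hi hj
    have h1 : |((i : ℝ) - j)| * ε < ε := by
      rw [← abs_of_pos hε, ← abs_mul, abs_lt, abs_of_pos hε]
      constructor <;> nlinarith
    have h2 : (1 : ℝ) ≤ |((i : ℝ) - j)| := by
      have : (1 : ℤ) ≤ |(i : ℤ) - j| := Int.one_le_abs (by omega)
      exact_mod_cast this
    nlinarith
  have hsub : (⋃ j ∈ Finset.range m, T j) ⊆ Metric.ball x₀ (c.radius + 1) := by
    intro x hx
    simp only [mem_iUnion, Finset.mem_range] at hx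
    obtain ⟨j, hj, hx⟩ := hx
    have h1 : dist (x + (-((j : ℝ) * ε)) • c.dir) x₀ < c.radius := hx.1
    have h2 : dist x (x + (-((j : ℝ) * ε)) • c.dir) ≤ 1 := by
      rw [dist_eq_norm, sub_add_cancel_left, norm_neg, norm_smul, c.norm_dir, mul_one, norm_neg,
        Real.norm_of_nonneg (by positivity)]
      exact (mul_le_mul_of_nonneg_right (by exact_mod_cast hj.le) hε.le).trans hmle
    rw [Metric.mem_ball]
    linarith [dist_triangle x (x + (-((j : ℝ) * ε)) • c.dir) x₀]
  have key : (m : ENNReal) * volume S ≤ volume (Metric.ball x₀ (c.radius + 1)) := by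
    refine le_trans (le_of_eq ?_) (measure_mono hsub)
    rw [measure_biUnion_finset (fun i _ j _ h => hdisj h) (fun j _ => hTm j)]
    simp [hTv]
  calc volume S = 1 * volume S := (one_mul _).symm
    _ ≤ ((m : ENNReal) * ENNReal.ofReal (2 * ε)) * volume S := by
        gcongr
        rw [← ENNReal.ofReal_natCast, ← ENNReal.ofReal_mul (by positivity)]
        exact ENNReal.one_le_ofReal.2 hmge
    _ = ENNReal.ofReal (2 * ε) * (m * volume S) := by ring
    _ ≤ _ := by gcongr

theorem volume_height_eq_zero :
    volume {x ∈ Metric.ball x₀ c.radius | c.height x = 0} = 0 := by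
  have hfin : volume (Metric.ball x₀ (c.radius + 1)) ≠ ⊤ := measure_ball_lt_top.ne
  have hlim : Tendsto (fun ε : ℝ => ENNReal.ofReal (2 * ε) *
      volume (Metric.ball x₀ (c.radius + 1))) (𝓝[>] 0) (𝓝 0) := by
    have h1 : Tendsto (fun ε : ℝ => ENNReal.ofReal (2 * ε)) (𝓝[>] 0) (𝓝 0) := by
      have : Tendsto (fun ε : ℝ => ENNReal.ofReal (2 * ε)) (𝓝 0) (𝓝 (ENNReal.ofReal (2 * 0))) :=
        (ENNReal.continuous_ofReal.comp (continuous_const.mul continuous_id)).tendsto _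
      simpa using this.mono_left nhdsWithin_le_nhds
    simpa using ENNReal.Tendsto.mul_const h1 (Or.inr hfin)
  refine le_antisymm (ge_of_tendsto hlim ?_) zero_le
  filter_upwards [Ioo_mem_nhdsGT (zero_lt_one' ℝ)] with ε hε
  refine (measure_mono fun x hx => ?_).trans (c.volume_layer_le hε.1 hε.2.le)
  exact ⟨hx.1, hx.2.ge, hx.2.trans_lt hε.1⟩

/-- Below a boundary point there is, at each small scale, a ball of comparable size outside `Ω`. -/
theorem ball_subset_compl {b : Space N} (hb : b ∈ Metric.ball x₀ (c.radius / 2))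
    (hb0 : c.height b = 0) {ρ : ℝ} (hρ : 0 < ρ) (hρr : ρ ≤ c.radius / 2) :
    Metric.ball (b + (-(ρ / 2)) • c.dir) ((2 * (1 + c.lip : ℝ))⁻¹ * ρ) ⊆
      Metric.ball b ρ ∩ Ωᶜ := by
  intro y hy
  have hK : (0 : ℝ) ≤ c.lip := c.lip.2
  have h1 : dist y (b + (-(ρ / 2)) • c.dir) < (2 * (1 + c.lip : ℝ))⁻¹ * ρ := hy
  have h2 : (1 + c.lip : ℝ) * ((2 * (1 + c.lip : ℝ))⁻¹ * ρ) = ρ / 2 := by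
    field_simp
  have h3 : (2 * (1 + c.lip : ℝ))⁻¹ * ρ ≤ ρ / 2 := by
    rw [← h2]
    exact le_mul_of_one_le_left (by positivity) (by linarith)
  have h4 : dist (b + (-(ρ / 2)) • c.dir) b = ρ / 2 := by
    rw [dist_eq_norm, add_sub_cancel_left, norm_smul, c.norm_dir, mul_one, norm_neg,
      Real.norm_of_nonneg (by positivity)]
  have h5 : dist y b < ρ := by
    linarith [dist_triangle y (b + (-(ρ / 2)) • c.dir) b]
  refine ⟨h5, fun hyΩ => ?_⟩
  have h6 : y ∈ Metric.ball x₀ c.radius := by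
    rw [Metric.mem_ball] at hb ⊢
    linarith [dist_triangle y b x₀]
  have h7 := (c.mem_iff h6).1 hyΩ
  have h8 : c.height y - c.height (b + (-(ρ / 2)) • c.dir) ≤ (1 + c.lip : ℝ) *
      dist y (b + (-(ρ / 2)) • c.dir) := by
    have := c.lipschitz_height.dist_le_mul y (b + (-(ρ / 2)) • c.dir)
    rw [Real.dist_eq] at this
    exact (le_abs_self _).trans (by simpa using this)
  have h9 : (1 + c.lip : ℝ) * dist y (b + (-(ρ / 2)) • c.dir) < ρ / 2 := by
    have := mul_lt_mul_of_pos_left h1 (show (0 : ℝ) < 1 + c.lip by positivity)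
    rwa [h2] at this
  rw [c.height_add, hb0] at h8
  linarith

end GraphChart

/-! ### The exterior of a Lipschitz domain -/

theorem volume_frontier_eq_zero {Ω : Set (Space N)} (hΩo : IsOpen Ω)
    (hΩb : Bornology.IsBounded Ω) (hΩL : HasLipschitzBoundary Ω) : volume (frontier Ω) = 0 := by
  have hK : IsCompact (frontier Ω) :=
    hΩb.isCompact_closure.of_isClosed_subset isClosed_frontier frontier_subset_closure
  refine hK.measure_zero_of_nhdsWithin fun x₀ hx₀ => ?_
  obtain ⟨c⟩ := hΩL.nonempty_chart hx₀
  refine ⟨frontier Ω ∩ Metric.ball x₀ c.radius,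
    inter_mem_nhdsWithin _ (Metric.ball_mem_nhds _ c.radius_pos), ?_⟩
  refine measure_mono_null (fun x hx => ?_) c.volume_height_eq_zero
  exact ⟨hx.2, c.height_eq_zero hΩo hx.1 hx.2⟩

/-- The exterior ball property of charts, with constants that are uniform on the boundary. -/
theorem exists_exterior_ball {Ω : Set (Space N)} (hΩo : IsOpen Ω)
    (hΩb : Bornology.IsBounded Ω) (hΩL : HasLipschitzBoundary Ω) :
    ∃ r > (0 : ℝ), ∃ σ > (0 : ℝ), ∀ b ∈ frontier Ω, ∀ ρ > 0, ρ ≤ r →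
      ∃ q, Metric.ball q (σ * ρ) ⊆ Metric.ball b ρ ∩ Ωᶜ := by
  have hK : IsCompact (frontier Ω) :=
    hΩb.isCompact_closure.of_isClosed_subset isClosed_frontier frontier_subset_closure
  suffices H : ∃ r > (0 : ℝ), ∃ σ > (0 : ℝ), ∀ b ∈ frontier Ω, b ∈ frontier Ω → ∀ ρ > 0, ρ ≤ r →
      ∃ q, Metric.ball q (σ * ρ) ⊆ Metric.ball b ρ ∩ Ωᶜ by
    obtain ⟨r, hr, σ, hσ, H⟩ := H
    exact ⟨r, hr, σ, hσ, fun b hb => H b hb hb⟩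
  refine hK.induction_on (p := fun s => ∃ r > (0 : ℝ), ∃ σ > (0 : ℝ), ∀ b ∈ s, b ∈ frontier Ω →
    ∀ ρ > 0, ρ ≤ r → ∃ q, Metric.ball q (σ * ρ) ⊆ Metric.ball b ρ ∩ Ωᶜ) ?_ ?_ ?_ ?_
  · exact ⟨1, one_pos, 1, one_pos, by simp⟩
  · rintro s t hst ⟨r, hr, σ, hσ, H⟩
    exact ⟨r, hr, σ, hσ, fun b hb => H b (hst hb)⟩
  · rintro s t ⟨r, hr, σ, hσ, H⟩ ⟨r', hr', σ', hσ', H'⟩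
    refine ⟨min r r', lt_min hr hr', min σ σ', lt_min hσ hσ', ?_⟩
    rintro b (hb | hb) hbf ρ hρ hρr
    · obtain ⟨q, hq⟩ := H b hb hbf ρ hρ (hρr.trans (min_le_left _ _))
      exact ⟨q, (Metric.ball_subset_ball
        (mul_le_mul_of_nonneg_right (min_le_left _ _) hρ.le)).trans hq⟩
    · obtain ⟨q, hq⟩ := H' b hb hbf ρ hρ (hρr.trans (min_le_right _ _))
      exact ⟨q, (Metric.ball_subset_ball
        (mul_le_mul_of_nonneg_right (min_le_right _ _) hρ.le)).trans hq⟩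
  · intro x₀ hx₀
    obtain ⟨c⟩ := hΩL.nonempty_chart hx₀
    refine ⟨Metric.ball x₀ (c.radius / 2),
      mem_nhdsWithin_of_mem_nhds (Metric.ball_mem_nhds _ (half_pos c.radius_pos)),
      c.radius / 2, half_pos c.radius_pos, (2 * (1 + c.lip : ℝ))⁻¹, by positivity, ?_⟩
    intro b hb hbf ρ hρ hρr
    exact ⟨_, c.ball_subset_compl hb (c.height_eq_zero hΩo hbf
      (Metric.ball_subset_ball (half_le_self c.radius_pos.le) hb)) hρ hρr⟩

/-- The exterior of a bounded Lipschitz domain fills a fixed proportion of each ball whose radius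
is comparable to, or larger than, the distance from its centre to the exterior. -/
theorem exists_volume_exterior_ge {Ω : Set (Space N)} (hΩo : IsOpen Ω)
    (hΩb : Bornology.IsBounded Ω) (hΩL : HasLipschitzBoundary Ω) (hΩc : Ωᶜ.Nonempty)
    {D : ℝ} (hD : 0 < D) :
    ∃ κ > (0 : ℝ), ∀ x ∈ Ω, ∀ ρ > 0, ρ ≤ D → Metric.infDist x Ωᶜ ≤ 7 * ρ →
      ENNReal.ofReal (κ * ρ ^ (N : ℝ)) ≤ volume (Metric.ball x (8 * ρ) ∩ Ωᶜ) := by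
  obtain ⟨r, hr, σ, hσ, H⟩ := exists_exterior_ball hΩo hΩb hΩL
  have hv : 0 < volume.real (Metric.ball (0 : Space N) 1) :=
    ENNReal.toReal_pos (Metric.measure_ball_pos _ _ one_pos).ne' measure_ball_lt_top.ne
  set θ := min 1 (r / D) with hθ
  have hθ0 : 0 < θ := lt_min one_pos (by positivity)
  refine ⟨(σ * θ) ^ N * volume.real (Metric.ball (0 : Space N) 1), by positivity, ?_⟩
  intro x hx ρ hρ hρD hd
  obtain ⟨b, hb, hbd⟩ := exists_mem_frontier_infDist_compl_eq_dist hx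
    (Set.nonempty_compl.1 hΩc)
  have h1 : θ * ρ ≤ r := by
    calc θ * ρ ≤ r / D * D := by gcongr; exact min_le_right _ _
      _ = r := by field_simp
  have h2 : θ * ρ ≤ ρ := mul_le_of_le_one_left hρ.le (min_le_left _ _)
  obtain ⟨q, hq⟩ := H b hb (θ * ρ) (by positivity) h1
  have h3 : Metric.ball q (σ * (θ * ρ)) ⊆ Metric.ball x (8 * ρ) ∩ Ωᶜ := by
    refine hq.trans (inter_subset_inter_left _ (Metric.ball_subset_ball' ?_))
    rw [dist_comm b x, ← hbd]; linarith
  refine le_trans (le_of_eq ?_) (measure_mono h3)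
  rw [Measure.addHaar_ball_of_pos _ _ (by positivity), finrank_euclideanSpace_fin, Real.rpow_natCast,
    show (σ * θ) ^ N * volume.real (Metric.ball (0 : Space N) 1) * ρ ^ N =
      (σ * (θ * ρ)) ^ N * volume.real (Metric.ball (0 : Space N) 1) by ring,
    ENNReal.ofReal_mul (by positivity), Measure.real, ENNReal.ofReal_toReal measure_ball_lt_top.ne]

/-! ### Powers of the norm -/

theorem lintegral_comp_smul_space (f : Space N → ENNReal) {a : ℝ} (ha : 0 < a) :
    ∫⁻ y, f y = ENNReal.ofReal (a ^ (N : ℝ)) * ∫⁻ y, f (a • y) := by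
  have h2 : MeasurableEmbedding (fun y : Space N => a • y) :=
    (Homeomorph.smulOfNeZero a ha.ne').measurableEmbedding
  rw [← h2.lintegral_map, Measure.map_addHaar_smul _ ha.ne', lintegral_smul_measure,
    finrank_euclideanSpace_fin, smul_eq_mul, ← mul_assoc, Real.rpow_natCast,
    abs_of_pos (by positivity), ← ENNReal.ofReal_mul (by positivity),
    mul_inv_cancel₀ (by positivity), ENNReal.ofReal_one, one_mul]

theorem integrableOn_norm_rpow_neg (hN : 1 ≤ N) {q a : ℝ} (hq : N < q) (ha : 0 < a) :
    IntegrableOn (fun y : Space N => ‖y‖ ^ (-q)) {y | a ≤ ‖y‖} := by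
  have : Nonempty (Fin N) := ⟨⟨0, hN⟩⟩
  have hm : MeasurableSet {y : Space N | a ≤ ‖y‖} := measurableSet_le measurable_const measurable_norm
  have h := (integrable_fun_norm_addHaar (volume : Measure (Space N))
    (f := (Ici a).indicator fun t => t ^ (-q))).2 ?_
  · rw [← integrable_indicator_iff hm]
    refine h.congr (Eventually.of_forall fun y => ?_)
    by_cases hy : a ≤ ‖y‖ <;> simp [indicator, hy]
  · rw [finrank_euclideanSpace_fin]
    have h1 : IntegrableOn (fun t : ℝ => t ^ ((N : ℝ) - 1 - q)) (Ici a) := by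
      rw [integrableOn_Ici_iff_integrableOn_Ioi]
      exact integrableOn_Ioi_rpow_of_lt (by linarith) ha
    have h2 : IntegrableOn (fun t : ℝ => t ^ (N - 1) • (Ici a).indicator (fun t => t ^ (-q)) t)
        univ := by
      rw [integrableOn_univ]
      refine ((integrable_indicator_iff measurableSet_Ici).2 h1).congr
        (Eventually.of_forall fun t => ?_)
      by_cases ht : a ≤ t
      · have ht0 : 0 < t := ha.trans_le ht
        simp only [indicator, mem_Ici, ht, if_true, smul_eq_mul]
        rw [← Real.rpow_natCast, ← Real.rpow_add ht0, Nat.cast_sub hN]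
        congr 1; push_cast; ring
      · simp [indicator, ht]
    exact h2.mono_set (subset_univ _)

theorem integrableOn_norm_rpow_ball (hN : 1 ≤ N) {q : ℝ} (hq : -(N : ℝ) < q) (a : ℝ) :
    IntegrableOn (fun y : Space N => ‖y‖ ^ q) (Metric.ball 0 a) := by
  have : Nonempty (Fin N) := ⟨⟨0, hN⟩⟩
  refine (integrableOn_fun_norm_addHaar (volume : Measure (Space N)) (f := fun t => t ^ q)).2 ?_
  rw [finrank_euclideanSpace_fin]
  have h1 : IntegrableOn (fun t : ℝ => t ^ ((N : ℝ) - 1 + q)) (Ioo 0 a) := by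
    rcases le_or_gt a 0 with ha | ha
    · simp [ha]
    · exact (intervalIntegral.integrableOn_Ioo_rpow_iff ha).2 (by linarith)
  refine h1.congr_fun (fun t ht => ?_) measurableSet_Ioo
  simp only [smul_eq_mul]
  rw [← Real.rpow_natCast, ← Real.rpow_add ht.1, Nat.cast_sub hN]
  push_cast; rfl

theorem exists_lintegral_norm_rpow_neg_eq (hN : 1 ≤ N) {q : ℝ} (hq : N < q) :
    ∃ C : ENNReal, C ≠ ⊤ ∧ ∀ a > (0 : ℝ),
      ∫⁻ y : Space N in {y | a ≤ ‖y‖}, ENNReal.ofReal (‖y‖ ^ (-q)) =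
        ENNReal.ofReal (a ^ (N - q)) * C := by
  have hm : ∀ a : ℝ, MeasurableSet {y : Space N | a ≤ ‖y‖} := fun a =>
    measurableSet_le measurable_const measurable_norm
  refine ⟨∫⁻ y : Space N in {y | 1 ≤ ‖y‖}, ENNReal.ofReal (‖y‖ ^ (-q)),
    ?_, fun a ha => ?_⟩
  · have := (integrableOn_norm_rpow_neg hN hq one_pos).lintegral_lt_top
    exact this.ne
  · rw [← lintegral_indicator (hm a), ← lintegral_indicator (hm 1), lintegral_comp_smul_space _ ha,
      show (N : ℝ) - q = N + -q by ring, Real.rpow_add ha, ENNReal.ofReal_mul (by positivity),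
      mul_assoc]
    congr 1
    rw [← lintegral_const_mul' _ _ ENNReal.ofReal_ne_top]
    refine lintegral_congr fun y => ?_
    by_cases hy : 1 ≤ ‖y‖
    · have h : a ≤ ‖a • y‖ := by
        rw [norm_smul, Real.norm_of_nonneg ha.le]; exact le_mul_of_one_le_right ha.le hy
      rw [indicator_of_mem (by exact h), indicator_of_mem (by exact hy), norm_smul,
        Real.norm_of_nonneg ha.le, Real.mul_rpow ha.le (norm_nonneg _),
        ENNReal.ofReal_mul (by positivity)]
    · have h : ¬ a ≤ ‖a • y‖ := by
        rw [norm_smul, Real.norm_of_nonneg ha.le, le_mul_iff_one_le_right ha]; exact hy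
      rw [indicator_of_notMem (by exact h), indicator_of_notMem (by exact hy), mul_zero]

theorem exists_lintegral_norm_rpow_ball_eq (hN : 1 ≤ N) {q : ℝ} (hq : -(N : ℝ) < q) :
    ∃ C : ENNReal, C ≠ ⊤ ∧ ∀ a > (0 : ℝ),
      ∫⁻ y : Space N in Metric.ball 0 a, ENNReal.ofReal (‖y‖ ^ q) =
        ENNReal.ofReal (a ^ (N + q)) * C := by
  refine ⟨∫⁻ y : Space N in Metric.ball 0 1, ENNReal.ofReal (‖y‖ ^ q),
    (integrableOn_norm_rpow_ball hN hq 1).lintegral_lt_top.ne, fun a ha => ?_⟩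
  rw [← lintegral_indicator measurableSet_ball, ← lintegral_indicator measurableSet_ball,
    lintegral_comp_smul_space _ ha, Real.rpow_add ha, ENNReal.ofReal_mul (by positivity),
    mul_assoc]
  congr 1
  rw [← lintegral_const_mul' _ _ ENNReal.ofReal_ne_top]
  refine lintegral_congr fun y => ?_
  have h : a • y ∈ Metric.ball (0 : Space N) a ↔ y ∈ Metric.ball (0 : Space N) 1 := by
    rw [mem_ball_zero_iff, mem_ball_zero_iff, norm_smul, Real.norm_of_nonneg ha.le,
      mul_lt_iff_lt_one_right ha]
  by_cases hy : y ∈ Metric.ball (0 : Space N) 1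
  · rw [indicator_of_mem (h.2 hy), indicator_of_mem hy, norm_smul,
      Real.norm_of_nonneg ha.le, Real.mul_rpow ha.le (norm_nonneg _),
      ENNReal.ofReal_mul (by positivity)]
  · rw [indicator_of_notMem (mt h.1 hy), indicator_of_notMem hy, mul_zero]

/-! ### Interactions inside the domain controlled by those across its boundary -/

/-- The density of the interaction of `v` between `x` and `y` with kernel `|x-y|^{-p}`. -/
def interaction (p : ℝ) (v : Space N → ℝ) (x y : Space N) : ENNReal :=
  ‖v x - v y‖ₑ * ENNReal.ofReal (‖x - y‖ ^ (-p))

theorem interaction_comm (p : ℝ) (v : Space N → ℝ) (x y : Space N) :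
    interaction p v x y = interaction p v y x := by
  rw [interaction, interaction, enorm_sub_rev, norm_sub_rev]

theorem measurable_interaction (p : ℝ) {v : Space N → ℝ} (hv : Measurable v) :
    Measurable fun z : Space N × Space N => interaction p v z.1 z.2 := by
  unfold interaction
  fun_prop

/-- The interior interaction between points whose distance is at least comparable to the distance
to the boundary is controlled by the interaction across the boundary: compare both values with
those of `v` on the part of the exterior that is near the two points. -/
theorem lintegral_interaction_far_ne_top (hN : 1 ≤ N) {Ω : Set (Space N)} (hΩo : IsOpen Ω)
    (hΩb : Bornology.IsBounded Ω) (hΩL : HasLipschitzBoundary Ω) (hΩc : Ωᶜ.Nonempty)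
    {p : ℝ} (hp : N < p) {v : Space N → ℝ} (hv : Measurable v)
    (hX : ∫⁻ x in Ω, ∫⁻ y in Ωᶜ, interaction p v x y ≠ ⊤) :
    ∫⁻ x in Ω, ∫⁻ y in Ω, {z : Space N × Space N | Metric.infDist z.1 Ωᶜ ≤ 7 * ‖z.1 - z.2‖}.indicator
      (fun z => interaction p v z.1 z.2) (x, y) ≠ ⊤ := by
  obtain ⟨D, hD, hΩD⟩ : ∃ D > (0 : ℝ), ∀ x ∈ Ω, ∀ y ∈ Ω, ‖x - y‖ ≤ D := by
    obtain ⟨D, hD⟩ := Metric.isBounded_iff.1 hΩb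
    exact ⟨max D 1, by positivity, fun x hx y hy =>
      (dist_eq_norm x y ▸ hD hx hy).trans (le_max_left _ _)⟩
  obtain ⟨κ, hκ, H⟩ := exists_volume_exterior_ge hΩo hΩb hΩL hΩc hD
  obtain ⟨C, hC, HC⟩ := exists_lintegral_norm_rpow_neg_eq hN
    (show (N : ℝ) < p + N by have : (0:ℝ) ≤ N := N.cast_nonneg; linarith)
  -- The comparison with the exterior value at `w`, weighted as required after averaging over `w`.
  obtain ⟨Φ, hΦ⟩ : ∃ Φ : Space N → Space N → Space N → ENNReal, Φ = fun x y w =>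
    {z : Space N × Space N × Space N | ‖z.1 - z.2.2‖ ≤ 9 * ‖z.1 - z.2.1‖}.indicator
      (fun z => ‖v z.1 - v z.2.2‖ₑ * ENNReal.ofReal (‖z.1 - z.2.1‖ ^ (-(p + N)))) (x, y, w) := ⟨_, rfl⟩
  have hΦm : Measurable fun z : Space N × Space N × Space N => Φ z.1 z.2.1 z.2.2 := by
    rw [hΦ]
    refine Measurable.indicator ?_ (measurableSet_le (by fun_prop) (by fun_prop))
    fun_prop
  have hpt : ∀ x ∈ Ω, ∀ y ∈ Ω,
      {z : Space N × Space N | Metric.infDist z.1 Ωᶜ ≤ 7 * ‖z.1 - z.2‖}.indicator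
        (fun z => interaction p v z.1 z.2) (x, y) ≤
      ENNReal.ofReal κ⁻¹ * ∫⁻ w in Ωᶜ, (Φ x y w + Φ y x w) := by
    intro x hx y hy
    by_cases hd : Metric.infDist x Ωᶜ ≤ 7 * ‖x - y‖
    swap
    · rw [indicator_of_notMem (by exact hd)]; exact zero_le
    rw [indicator_of_mem (by exact hd)]
    rcases eq_or_ne x y with rfl | hxy
    · simp [interaction]
    have hρ : 0 < ‖x - y‖ := norm_pos_iff.2 (sub_ne_zero.2 hxy)
    have hvol := H x hx _ hρ (hΩD x hx y hy) hd
    have hmS : MeasurableSet (Metric.ball x (8 * ‖x - y‖) ∩ Ωᶜ) :=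
      measurableSet_ball.inter hΩo.measurableSet.compl
    have e1 : interaction p v x y = ENNReal.ofReal κ⁻¹ * (ENNReal.ofReal (κ * ‖x - y‖ ^ (N : ℝ)) *
        (‖v x - v y‖ₑ * ENNReal.ofReal (‖x - y‖ ^ (-(p + N))))) := by
      rw [interaction, mul_left_comm _ (‖v x - v y‖ₑ), mul_left_comm _ (‖v x - v y‖ₑ)]
      congr 1
      rw [← ENNReal.ofReal_mul (by positivity), ← ENNReal.ofReal_mul (by positivity)]
      congr 1
      rw [mul_assoc, ← Real.rpow_add hρ, ← mul_assoc, inv_mul_cancel₀ hκ.ne', one_mul]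
      congr 1; ring
    rw [e1]
    gcongr
    calc ENNReal.ofReal (κ * ‖x - y‖ ^ (N : ℝ)) *
          (‖v x - v y‖ₑ * ENNReal.ofReal (‖x - y‖ ^ (-(p + N))))
        ≤ volume (Metric.ball x (8 * ‖x - y‖) ∩ Ωᶜ) *
          (‖v x - v y‖ₑ * ENNReal.ofReal (‖x - y‖ ^ (-(p + N)))) := by gcongr
      _ = ∫⁻ _ in Metric.ball x (8 * ‖x - y‖) ∩ Ωᶜ,
          ‖v x - v y‖ₑ * ENNReal.ofReal (‖x - y‖ ^ (-(p + N))) := by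
          rw [lintegral_const, Measure.restrict_apply_univ, mul_comm]
      _ ≤ ∫⁻ w in Metric.ball x (8 * ‖x - y‖) ∩ Ωᶜ, (Φ x y w + Φ y x w) := by
          refine setLIntegral_mono' hmS fun w hw => ?_
          have h1 : ‖x - w‖ < 8 * ‖x - y‖ := by
            have := hw.1; rwa [Metric.mem_ball', dist_eq_norm] at this
          have h2 : ‖y - w‖ ≤ 9 * ‖y - x‖ := by
            have : ‖y - w‖ ≤ ‖y - x‖ + ‖x - w‖ := norm_sub_le_norm_sub_add_norm_sub y x w
            rw [norm_sub_rev x y] at h1; linarith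
          simp only [hΦ]
          rw [indicator_of_mem (by simp only [mem_ofPred_eq]; linarith), indicator_of_mem (by exact h2)]
          simp only [norm_sub_rev y x]
          rw [← add_mul]
          gcongr
          calc ‖v x - v y‖ₑ = ‖(v x - v w) + (v w - v y)‖ₑ := by congr 1; ring
            _ ≤ ‖v x - v w‖ₑ + ‖v w - v y‖ₑ := enorm_add_le _ _
            _ = _ := by rw [enorm_sub_rev (v w)]
      _ ≤ ∫⁻ w in Ωᶜ, (Φ x y w + Φ y x w) := lintegral_mono_set inter_subset_right
  have hint : ∫⁻ x in Ω, ∫⁻ y in Ω, ∫⁻ w in Ωᶜ, Φ x y w ≤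
      ENNReal.ofReal ((9 : ℝ)⁻¹ ^ (-p)) * C * ∫⁻ x in Ω, ∫⁻ w in Ωᶜ, interaction p v x w := by
    rw [← lintegral_const_mul' _ _ (ENNReal.mul_ne_top ENNReal.ofReal_ne_top hC)]
    refine setLIntegral_mono' hΩo.measurableSet fun x hx => ?_
    have hsec : Measurable fun z : Space N × Space N => Φ x z.1 z.2 :=
      hΦm.comp (by fun_prop : Measurable fun z : Space N × Space N => (x, z.1, z.2))
    rw [lintegral_lintegral_swap hsec.aemeasurable,
      ← lintegral_const_mul' _ _ (ENNReal.mul_ne_top ENNReal.ofReal_ne_top hC)]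
    refine setLIntegral_mono' hΩo.measurableSet.compl fun w hw => ?_
    have hxw : 0 < ‖x - w‖ := norm_pos_iff.2 (sub_ne_zero.2 fun h => hw (h ▸ hx))
    have hm : MeasurableSet {y : Space N | 9⁻¹ * ‖x - w‖ ≤ ‖y‖} :=
      measurableSet_le measurable_const measurable_norm
    calc ∫⁻ y in Ω, Φ x y w ≤ ∫⁻ y, Φ x y w := setLIntegral_le_lintegral _ _
      _ = ∫⁻ y, Φ x (x - y) w := (lintegral_sub_left_eq_self _ x).symm
      _ = ∫⁻ y, {y : Space N | 9⁻¹ * ‖x - w‖ ≤ ‖y‖}.indicator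
          (fun y => ‖v x - v w‖ₑ * ENNReal.ofReal (‖y‖ ^ (-(p + N)))) y := by
          refine lintegral_congr fun y => ?_
          simp only [hΦ, indicator, mem_ofPred_eq, sub_sub_cancel]
          congr 1
          rw [inv_mul_le_iff₀ (by norm_num)]
      _ = ‖v x - v w‖ₑ * (ENNReal.ofReal ((9⁻¹ * ‖x - w‖) ^ (-p)) * C) := by
          rw [lintegral_indicator hm, lintegral_const_mul' _ _ enorm_ne_top, HC _ (by positivity)]
          congr 4; ring
      _ = _ := by
          rw [Real.mul_rpow (by norm_num) (norm_nonneg _), ENNReal.ofReal_mul (by positivity),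
            interaction]
          ring
  refine ne_top_of_le_ne_top (ENNReal.mul_ne_top ENNReal.ofReal_ne_top (ENNReal.add_ne_top.2
    ⟨ne_top_of_le_ne_top (ENNReal.mul_ne_top (ENNReal.mul_ne_top ENNReal.ofReal_ne_top hC) hX) hint,
     ne_top_of_le_ne_top (ENNReal.mul_ne_top (ENNReal.mul_ne_top ENNReal.ofReal_ne_top hC) hX)
      hint⟩) : ENNReal.ofReal κ⁻¹ * ((∫⁻ x in Ω, ∫⁻ y in Ω, ∫⁻ w in Ωᶜ, Φ x y w) +
        ∫⁻ x in Ω, ∫⁻ y in Ω, ∫⁻ w in Ωᶜ, Φ x y w) ≠ ⊤) ?_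
  have hm2 : Measurable (Function.uncurry fun x y => ∫⁻ w in Ωᶜ, Φ x y w) := by
    have : Measurable fun z : (Space N × Space N) × Space N => Φ z.1.1 z.1.2 z.2 :=
      hΦm.comp (by fun_prop : Measurable fun z : (Space N × Space N) × Space N =>
        (z.1.1, z.1.2, z.2))
    exact this.lintegral_prod_right'
  have hswap : ∫⁻ x in Ω, ∫⁻ y in Ω, ∫⁻ w in Ωᶜ, Φ y x w =
      ∫⁻ x in Ω, ∫⁻ y in Ω, ∫⁻ w in Ωᶜ, Φ x y w :=
    lintegral_lintegral_swap (hm2.comp measurable_swap).aemeasurable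
  calc _ ≤ ∫⁻ x in Ω, ∫⁻ y in Ω, ENNReal.ofReal κ⁻¹ * ∫⁻ w in Ωᶜ, (Φ x y w + Φ y x w) :=
        setLIntegral_mono' hΩo.measurableSet fun x hx =>
          setLIntegral_mono' hΩo.measurableSet fun y hy => hpt x hx y hy
    _ = ENNReal.ofReal κ⁻¹ * ∫⁻ x in Ω, ∫⁻ y in Ω,
        ((∫⁻ w in Ωᶜ, Φ x y w) + ∫⁻ w in Ωᶜ, Φ y x w) := by
        rw [← lintegral_const_mul' _ _ ENNReal.ofReal_ne_top]
        refine lintegral_congr fun x => ?_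
        rw [← lintegral_const_mul' _ _ ENNReal.ofReal_ne_top]
        refine lintegral_congr fun y => ?_
        rw [lintegral_add_left]
        exact hΦm.comp (by fun_prop : Measurable fun w : Space N => (x, y, w))
    _ = ENNReal.ofReal κ⁻¹ * ((∫⁻ x in Ω, ∫⁻ y in Ω, ∫⁻ w in Ωᶜ, Φ x y w) +
        ∫⁻ x in Ω, ∫⁻ y in Ω, ∫⁻ w in Ωᶜ, Φ y x w) := by
        congr 1
        have hm3 : Measurable fun x => ∫⁻ y in Ω, ∫⁻ w in Ωᶜ, Φ x y w := hm2.lintegral_prod_right'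
        rw [← lintegral_add_left hm3]
        refine lintegral_congr fun x => ?_
        rw [lintegral_add_left]
        exact hm2.comp (by fun_prop : Measurable fun y : Space N => (x, y))
    _ ≤ _ := by rw [hswap]

/-! ### Averaging against a tent function -/

/-- The integral of the unscaled tent function, used to normalize `tent`. -/
def tentMass (N : ℕ) : ℝ := ∫ z : Space N, max 0 (1 - ‖z‖)

/-- The tent function supported in the ball of radius `r`, with integral one. -/
def tent (r : ℝ) (z : Space N) : ℝ :=
  (tentMass N)⁻¹ * r ^ (-(N : ℝ)) * max 0 (1 - ‖z‖ / r)

/-- The average of `g` about each point, with the tent function of radius `r` as weight. -/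
def average (r : ℝ) (g : Space N → ℝ) (x : Space N) : ℝ := ∫ z, tent r z * g (x - z)

theorem tentMass_pos : 0 < tentMass N := by
  refine Continuous.integral_pos_of_hasCompactSupport_nonneg_nonzero (x := 0) (by fun_prop)
    ?_ (fun z => le_max_left _ _) (by simp)
  refine HasCompactSupport.intro (isCompact_closedBall (0 : Space N) 1) fun z hz => ?_
  rw [mem_closedBall_zero_iff, not_le] at hz
  exact max_eq_left (by linarith)

theorem continuous_tent (r : ℝ) : Continuous (tent r : Space N → ℝ) := by
  unfold tent; fun_prop

theorem tent_neg (r : ℝ) (z : Space N) : tent r (-z) = tent r z := by simp [tent]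

theorem tent_nonneg {r : ℝ} (hr : 0 < r) (z : Space N) : 0 ≤ tent r z := by
  have := tentMass_pos (N := N)
  unfold tent; positivity

theorem tent_eq_zero {r : ℝ} (hr : 0 < r) {z : Space N} (hz : r ≤ ‖z‖) : tent r z = 0 := by
  have : 1 ≤ ‖z‖ / r := (one_le_div hr).2 hz
  rw [tent, max_eq_left (by linarith), mul_zero]

theorem integrable_tent {r : ℝ} (hr : 0 < r) : Integrable (tent r : Space N → ℝ) := by
  refine (continuous_tent r).integrable_of_hasCompactSupport ?_
  refine HasCompactSupport.intro (isCompact_closedBall (0 : Space N) r) fun z hz => ?_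
  rw [mem_closedBall_zero_iff, not_le] at hz
  exact tent_eq_zero hr hz.le

theorem integral_tent {r : ℝ} (hr : 0 < r) : ∫ z : Space N, tent r z = 1 := by
  have h := Measure.integral_comp_inv_smul_of_nonneg (volume : Measure (Space N))
    (fun z => max 0 (1 - ‖z‖)) hr.le
  have h2 : ∀ z : Space N, max 0 (1 - ‖r⁻¹ • z‖) = max 0 (1 - ‖z‖ / r) := fun z => by
    rw [norm_smul, norm_inv, Real.norm_of_nonneg hr.le, div_eq_inv_mul]
  simp only [h2, finrank_euclideanSpace_fin] at h
  simp only [tent]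
  rw [integral_const_mul, h, ← tentMass, smul_eq_mul, Real.rpow_neg hr.le, Real.rpow_natCast]
  have := (tentMass_pos (N := N)).ne'
  field_simp

theorem abs_tent_sub_le {r : ℝ} (hr : 0 < r) (a b : Space N) :
    |tent r a - tent r b| ≤ (tentMass N)⁻¹ * r ^ (-(N + 1 : ℝ)) * ‖a - b‖ := by
  have hm := tentMass_pos (N := N)
  have h1 : |max 0 (1 - ‖a‖ / r) - max 0 (1 - ‖b‖ / r)| ≤ r⁻¹ * ‖a - b‖ := by
    calc |max 0 (1 - ‖a‖ / r) - max 0 (1 - ‖b‖ / r)|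
        ≤ max |0 - 0| |(1 - ‖a‖ / r) - (1 - ‖b‖ / r)| := abs_max_sub_max_le_max _ _ _ _
      _ = r⁻¹ * |‖b‖ - ‖a‖| := by
          rw [sub_zero, abs_zero, max_eq_right (abs_nonneg _)]
          conv_rhs => rw [← abs_of_pos (inv_pos.2 hr), ← abs_mul]
          congr 1; ring
      _ ≤ r⁻¹ * ‖a - b‖ := by
          gcongr
          rw [norm_sub_rev]
          exact abs_norm_sub_norm_le _ _
  rw [tent, tent, ← mul_sub, abs_mul, abs_of_nonneg (by positivity)]
  calc _ ≤ (tentMass N)⁻¹ * r ^ (-(N : ℝ)) * (r⁻¹ * ‖a - b‖) := by gcongr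
    _ = _ := by
      rw [show -(N + 1 : ℝ) = -(N : ℝ) + -1 by ring, Real.rpow_add hr, Real.rpow_neg_one]; ring

theorem average_eq (r : ℝ) (g : Space N → ℝ) (x : Space N) :
    average r g x = ∫ z, tent r (x - z) * g z := by
  rw [average, ← integral_sub_left_eq_self (fun z => tent r (x - z) * g z) volume x]
  simp

theorem integrable_tent_mul {r : ℝ} (hr : 0 < r) {g : Space N → ℝ} (hg : Measurable g) {M : ℝ}
    (hM : ∀ x, |g x| ≤ M) (x : Space N) : Integrable fun z => tent r (x - z) * g z :=
  ((integrable_tent hr).comp_sub_left x).mul_bdd (c := M) hg.aestronglyMeasurable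
    (Eventually.of_forall hM)

theorem integral_tent_sub {r : ℝ} (hr : 0 < r) (x : Space N) : ∫ z, tent r (x - z) = 1 := by
  rw [integral_sub_left_eq_self (fun z => tent r z) volume x, integral_tent hr]

theorem measurable_average (r : ℝ) {g : Space N → ℝ} (hg : Measurable g) :
    Measurable (average r g) := by
  have h : StronglyMeasurable fun z : Space N × Space N => tent r z.2 * g (z.1 - z.2) := by
    refine Measurable.stronglyMeasurable ?_
    exact ((continuous_tent r).measurable.comp measurable_snd).mul
      (hg.comp (measurable_fst.sub measurable_snd))
  exact h.integral_prod_right'.measurable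

theorem average_mem_Icc {r : ℝ} (hr : 0 < r) {g : Space N → ℝ} (hg : Measurable g)
    (h01 : ∀ x, g x ∈ Icc (0 : ℝ) 1) (x : Space N) : average r g x ∈ Icc (0 : ℝ) 1 := by
  rw [average_eq]
  refine ⟨integral_nonneg fun z => mul_nonneg (tent_nonneg hr _) (h01 z).1, ?_⟩
  rw [← integral_tent_sub hr x]
  refine integral_mono (integrable_tent_mul hr hg (M := 1)
    (fun z => abs_le.2 ⟨by linarith [(h01 z).1], (h01 z).2⟩) x)
    ((integrable_tent hr).comp_sub_left x) fun z => ?_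
  exact mul_le_of_le_one_right (tent_nonneg hr _) (h01 z).2

theorem average_eq_of_forall_ball {r : ℝ} (hr : 0 < r) {g : Space N → ℝ} {x : Space N} {a : ℝ}
    (h : ∀ z, ‖x - z‖ < r → g z = a) : average r g x = a := by
  rw [average_eq]
  calc ∫ z, tent r (x - z) * g z = ∫ z, tent r (x - z) * a := by
        refine integral_congr_ae (Eventually.of_forall fun z => ?_)
        rcases lt_or_ge ‖x - z‖ r with hz | hz
        · simp only [h z hz]
        · simp only [tent_eq_zero hr hz, zero_mul]
    _ = a := by rw [integral_mul_const, integral_tent_sub hr, one_mul]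

theorem average_sub_translate {r : ℝ} (hr : 0 < r) {g : Space N → ℝ} (hg : Measurable g) {M : ℝ}
    (hM : ∀ x, |g x| ≤ M) (y x : Space N) :
    average r (fun x => g x - g (x + y)) x = average r g x - average r g (x + y) := by
  have h2 : average r g (x + y) = ∫ z, tent r (x - z) * g (z + y) := by
    rw [average_eq, ← integral_add_right_eq_self (fun z => tent r (x + y - z) * g z) y]
    simp
  rw [average_eq, average_eq, h2, ← integral_sub (integrable_tent_mul hr hg hM x)]
  · simp only [mul_sub]
  · exact integrable_tent_mul (g := fun z => g (z + y)) hr (hg.comp (measurable_add_const y))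
      (fun z => hM _) x

/-- The variation of an average is controlled by the oscillation of the function about an arbitrary
constant. -/
theorem enorm_average_sub_le {r : ℝ} (hr : 0 < r) {g : Space N → ℝ} (hg : Measurable g) {M : ℝ}
    (hM : ∀ x, |g x| ≤ M) (m : ℝ) (x : Space N) {y : Space N} (hy : ‖y‖ ≤ r) :
    ‖average r g x - average r g (x + y)‖ₑ ≤
      ENNReal.ofReal ((tentMass N)⁻¹ * r ^ (-(N + 1 : ℝ)) * ‖y‖) *
        ∫⁻ z in Metric.ball x (2 * r), ‖g z - m‖ₑ := by
  have hm : ∀ x : Space N, average r g x - m = ∫ z, tent r (x - z) * (g z - m) := by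
    intro x
    simp only [mul_sub]
    rw [average_eq, integral_sub (integrable_tent_mul hr hg hM x)
      (((integrable_tent hr).comp_sub_left x).mul_const m), integral_mul_const,
      integral_tent_sub hr, one_mul]
  have hi : ∀ x : Space N, Integrable fun z => tent r (x - z) * (g z - m) := fun x =>
    integrable_tent_mul hr (hg.sub_const m) (M := M + |m|)
      (fun z => (abs_sub _ _).trans (by gcongr; exact hM z)) x
  have e : average r g x - average r g (x + y) =
      ∫ z, (tent r (x - z) - tent r (x + y - z)) * (g z - m) := by
    simp only [sub_mul _ _ (g _ - m)]
    rw [integral_sub (hi x) (hi (x + y)), ← hm, ← hm]; ring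
  rw [e, ← lintegral_const_mul' _ _ ENNReal.ofReal_ne_top,
    ← lintegral_indicator measurableSet_ball]
  refine (enorm_integral_le_lintegral_enorm _).trans (lintegral_mono fun z => ?_)
  by_cases hz : z ∈ Metric.ball x (2 * r)
  · rw [indicator_of_mem hz, enorm_mul]
    gcongr
    rw [Real.enorm_eq_ofReal_abs]
    refine ENNReal.ofReal_le_ofReal ((abs_tent_sub_le hr _ _).trans (le_of_eq ?_))
    congr 1
    rw [show x - z - (x + y - z) = -y by abel, norm_neg]
  · rw [indicator_of_notMem hz]
    rw [Metric.mem_ball', dist_eq_norm, not_lt] at hz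
    have h1 : tent r (x - z) = 0 := tent_eq_zero hr (by linarith)
    have h2 : tent r (x + y - z) = 0 := by
      refine tent_eq_zero hr ?_
      have : ‖x - z‖ ≤ ‖x + y - z‖ + ‖y‖ := by
        calc ‖x - z‖ = ‖(x + y - z) - y‖ := by congr 1; abel
          _ ≤ _ := norm_sub_le _ _
      linarith
    simp [h1, h2]

/-- Averaging is symmetric, since the tent function is even. -/
theorem integral_mul_average {r : ℝ} (hr : 0 < r) {f h : Space N → ℝ} (hf : Measurable f) {M : ℝ}
    (hM : ∀ x, |f x| ≤ M) (hh : Integrable h) :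
    ∫ x, f x * average r h x = ∫ x, average r f x * h x := by
  have h1 : Integrable fun z : Space N × Space N => f z.1 * (h z.2 * tent r (z.1 - z.2)) := by
    refine ((hh.convolution_integrand (ContinuousLinearMap.mul ℝ ℝ) (integrable_tent hr)).bdd_mul
      (c := M) (f := fun z : Space N × Space N => f z.1) ?_ (Eventually.of_forall fun z => hM z.1))
    exact (hf.comp measurable_fst).aestronglyMeasurable
  calc ∫ x, f x * average r h x = ∫ x, ∫ z, f x * (h z * tent r (x - z)) := by
        refine integral_congr_ae (Eventually.of_forall fun x => ?_)
        simp only [average_eq, ← integral_const_mul]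
        simp only [mul_comm]
    _ = ∫ z, ∫ x, f x * (h z * tent r (x - z)) := integral_integral_swap h1
    _ = ∫ x, average r f x * h x := by
        refine integral_congr_ae (Eventually.of_forall fun z => ?_)
        simp only [average_eq, ← integral_mul_const]
        refine integral_congr_ae (Eventually.of_forall fun x => ?_)
        simp only [← tent_neg r (x - z), neg_sub]
        ring

/-! ### Cutoffs at a given distance from the exterior -/

/-- The points of distance at least `a` to the exterior of `Ω`. -/
def innerSet (Ω : Set (Space N)) (a : ℝ) : Set (Space N) := {x | a ≤ Metric.infDist x Ωᶜ}

/-- The indicator of `innerSet Ω (5 r)`, averaged once at scale `r`. -/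
def preCutoff (Ω : Set (Space N)) (r : ℝ) : Space N → ℝ :=
  average r ((innerSet Ω (5 * r)).indicator 1)

/-- The indicator of `innerSet Ω (5 r)`, averaged twice at scale `r`. By the symmetry of the
average, one of the two can be moved to the other factor of a translation invariant pairing. -/
def cutoff (Ω : Set (Space N)) (r : ℝ) : Space N → ℝ := average r (preCutoff Ω r)

theorem isClosed_innerSet (Ω : Set (Space N)) (a : ℝ) : IsClosed (innerSet Ω a) :=
  isClosed_le continuous_const (Metric.continuous_infDist_pt _)

theorem innerSet_subset {Ω : Set (Space N)} {a : ℝ} (ha : 0 < a) : innerSet Ω a ⊆ Ω := by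
  intro x hx
  by_contra h
  have : Metric.infDist x Ωᶜ = 0 := Metric.infDist_zero_of_mem h
  rw [innerSet, mem_ofPred_eq, this] at hx
  linarith

theorem isCompact_innerSet {Ω : Set (Space N)} (hΩb : Bornology.IsBounded Ω) {a : ℝ}
    (ha : 0 < a) : IsCompact (innerSet Ω a) :=
  Metric.isCompact_of_isClosed_isBounded (isClosed_innerSet Ω a) (hΩb.subset (innerSet_subset ha))

theorem infDist_le_infDist_add_norm (s : Set (Space N)) (x z : Space N) :
    Metric.infDist x s ≤ Metric.infDist z s + ‖x - z‖ := by
  rw [← dist_eq_norm]; exact Metric.infDist_le_infDist_add_dist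

section Cutoff

variable (Ω : Set (Space N)) {r : ℝ}

theorem measurable_indicator_innerSet (a : ℝ) :
    Measurable ((innerSet Ω a).indicator (1 : Space N → ℝ)) :=
  measurable_one.indicator (isClosed_innerSet Ω a).measurableSet

theorem indicator_innerSet_mem_Icc (a : ℝ) (x : Space N) :
    (innerSet Ω a).indicator (1 : Space N → ℝ) x ∈ Icc (0 : ℝ) 1 := by
  by_cases h : x ∈ innerSet Ω a <;> simp [h]

theorem measurable_preCutoff (r : ℝ) : Measurable (preCutoff Ω r) :=
  measurable_average r (measurable_indicator_innerSet Ω _)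

theorem preCutoff_mem_Icc (hr : 0 < r) (x : Space N) : preCutoff Ω r x ∈ Icc (0 : ℝ) 1 :=
  average_mem_Icc hr (measurable_indicator_innerSet Ω _) (indicator_innerSet_mem_Icc Ω _) x

theorem preCutoff_eq_one (hr : 0 < r) {x : Space N} (hx : 6 * r ≤ Metric.infDist x Ωᶜ) :
    preCutoff Ω r x = 1 := by
  refine average_eq_of_forall_ball hr fun z hz => ?_
  have := infDist_le_infDist_add_norm Ωᶜ x z
  rw [indicator_of_mem (show z ∈ innerSet Ω (5 * r) by rw [innerSet, mem_ofPred_eq]; linarith)]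
  rfl

theorem preCutoff_eq_zero (hr : 0 < r) {x : Space N} (hx : Metric.infDist x Ωᶜ < 4 * r) :
    preCutoff Ω r x = 0 := by
  refine average_eq_of_forall_ball hr fun z hz => ?_
  have := infDist_le_infDist_add_norm Ωᶜ z x
  rw [norm_sub_rev] at this
  exact indicator_of_notMem (by rw [innerSet, mem_ofPred_eq]; linarith) _

theorem measurable_cutoff (r : ℝ) : Measurable (cutoff Ω r) :=
  measurable_average r (measurable_preCutoff Ω _)

theorem cutoff_mem_Icc (hr : 0 < r) (x : Space N) : cutoff Ω r x ∈ Icc (0 : ℝ) 1 :=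
  average_mem_Icc hr (measurable_preCutoff Ω _) (preCutoff_mem_Icc Ω hr) x

theorem cutoff_eq_one (hr : 0 < r) {x : Space N} (hx : 7 * r ≤ Metric.infDist x Ωᶜ) :
    cutoff Ω r x = 1 := by
  refine average_eq_of_forall_ball hr fun z hz => preCutoff_eq_one Ω hr ?_
  have := infDist_le_infDist_add_norm Ωᶜ x z
  linarith

theorem cutoff_eq_zero (hr : 0 < r) {x : Space N} (hx : x ∉ innerSet Ω (3 * r)) :
    cutoff Ω r x = 0 := by
  rw [innerSet, mem_ofPred_eq, not_le] at hx
  refine average_eq_of_forall_ball hr fun z hz => preCutoff_eq_zero Ω hr ?_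
  have := infDist_le_infDist_add_norm Ωᶜ z x
  rw [norm_sub_rev] at this
  linarith

end Cutoff

/-! ### The pairing of differences -/

/-- The pairing of the differences of `v` and `η` under the translation by `y`. -/
def pairing (v η : Space N → ℝ) (y : Space N) : ℝ :=
  ∫ x, (v x - v (x + y)) * (η x - η (x + y))

theorem integrable_of_mem_Icc_of_support {η : Space N → ℝ} (hη : Measurable η)
    (h01 : ∀ x, η x ∈ Icc (0 : ℝ) 1) {T : Set (Space N)} (hT : IsCompact T)
    (h0 : ∀ x, x ∉ T → η x = 0) : Integrable η := by
  have h1 : Integrable (T.indicator (1 : Space N → ℝ)) :=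
    (integrable_indicator_iff hT.isClosed.measurableSet).2
      (integrableOn_const hT.measure_lt_top.ne)
  refine h1.mono' hη.aestronglyMeasurable (Eventually.of_forall fun x => ?_)
  by_cases hx : x ∈ T
  · simp [hx, abs_of_nonneg (h01 x).1, (h01 x).2]
  · simp [hx, h0 x hx]

theorem integrable_preCutoff {Ω : Set (Space N)} (hΩb : Bornology.IsBounded Ω) {r : ℝ}
    (hr : 0 < r) : Integrable (preCutoff Ω r) := by
  refine integrable_of_mem_Icc_of_support (measurable_preCutoff Ω r) (preCutoff_mem_Icc Ω hr)
    (isCompact_innerSet hΩb (a := 4 * r) (by positivity)) fun x hx => preCutoff_eq_zero Ω hr ?_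
  rwa [innerSet, mem_ofPred_eq, not_le] at hx

theorem pairing_cutoff {Ω : Set (Space N)} (hΩb : Bornology.IsBounded Ω) {v : Space N → ℝ}
    (hv : Measurable v) {M : ℝ} (hM : ∀ x, |v x| ≤ M) {r : ℝ} (hr : 0 < r) (y : Space N) :
    pairing v (cutoff Ω r) y =
      ∫ x, (average r v x - average r v (x + y)) * (preCutoff Ω r x - preCutoff Ω r (x + y)) := by
  have hi := integrable_preCutoff hΩb hr
  rw [pairing]
  have h1 := integral_mul_average hr (f := fun x => v x - v (x + y)) (M := M + M)
    (hv.sub (hv.comp (measurable_add_const y)))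
    (fun x => (abs_sub _ _).trans (add_le_add (hM _) (hM _)))
    (hi.sub (hi.comp_add_right y))
  have h2 : ∀ x, average r (preCutoff Ω r - fun x => preCutoff Ω r (x + y)) x =
      cutoff Ω r x - cutoff Ω r (x + y) := fun x =>
    average_sub_translate hr (measurable_preCutoff Ω r) (M := 1)
      (fun z => abs_le.2 ⟨by linarith [(preCutoff_mem_Icc Ω hr z).1],
        (preCutoff_mem_Icc Ω hr z).2⟩) y x
  simp only [h2, average_sub_translate hr hv hM] at h1
  exact h1

/-! ### The boundary layer -/

/-- The interaction of `v` across the boundary of `Ω`, between points of distance at most `a`. -/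
def shortInteraction (Ω : Set (Space N)) (p : ℝ) (v : Space N → ℝ) (a : ℝ) : ENNReal :=
  ∫⁻ z in Ω, ∫⁻ w in Ωᶜ, {q : Space N × Space N | ‖q.1 - q.2‖ ≤ a}.indicator
    (fun q => interaction p v q.1 q.2) (z, w)

/-- In a boundary layer of width `r`, the averages of `v` vary by at most the mean difference
between values of `v` inside and values of `v` outside `Ω`. -/
theorem lintegral_layer_le {Ω : Set (Space N)} (hΩo : IsOpen Ω) {p : ℝ} (hp : 0 < p)
    {v : Space N → ℝ} (hv : Measurable v) {r : ℝ} (hr : 0 < r) :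
    ∫⁻ x in innerSet Ω (3 * r), ∫⁻ w in Metric.ball x (8 * r) ∩ Ωᶜ,
      ∫⁻ z in Metric.ball x (2 * r), ‖v z - v w‖ₑ ≤
    volume (Metric.ball (0 : Space N) (2 * r)) * (ENNReal.ofReal ((10 * r) ^ p) *
      shortInteraction Ω p v (10 * r)) := by
  obtain ⟨Ψ, hΨ⟩ : ∃ Ψ : Space N → Space N → Space N → ENNReal, Ψ = fun x w z =>
    {q : Space N × Space N × Space N | ‖q.2.2 - q.1‖ < 2 * r ∧ ‖q.2.2 - q.2.1‖ ≤ 10 * r}.indicator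
      (fun q => ‖v q.2.2 - v q.2.1‖ₑ) (x, w, z) := ⟨_, rfl⟩
  have hΨm : Measurable fun q : Space N × Space N × Space N => Ψ q.1 q.2.1 q.2.2 := by
    rw [hΨ]
    have h1 : MeasurableSet {q : Space N × Space N × Space N | ‖q.2.2 - q.1‖ < 2 * r} :=
      measurableSet_lt (by fun_prop) (by fun_prop)
    have h2 : MeasurableSet {q : Space N × Space N × Space N | ‖q.2.2 - q.2.1‖ ≤ 10 * r} :=
      measurableSet_le (by fun_prop) (by fun_prop)
    exact Measurable.indicator (by fun_prop) (h1.inter h2)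
  have hm : MeasurableSet (innerSet Ω (3 * r)) := (isClosed_innerSet Ω _).measurableSet
  have hΩm : MeasurableSet Ω := hΩo.measurableSet
  calc _ ≤ ∫⁻ x in innerSet Ω (3 * r), ∫⁻ w in Ωᶜ, ∫⁻ z in Ω, Ψ x w z := by
        refine setLIntegral_mono' hm fun x hx => ?_
        refine le_trans (setLIntegral_mono' (measurableSet_ball.inter hΩm.compl) fun w hw => ?_)
          (lintegral_mono_set inter_subset_right)
        have hsub : Metric.ball x (2 * r) ⊆ Ω := by
          intro z hz
          by_contra h
          have h1 := infDist_le_infDist_add_norm Ωᶜ x z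
          rw [Metric.infDist_zero_of_mem (show z ∈ Ωᶜ from h), ← dist_eq_norm] at h1
          rw [Metric.mem_ball'] at hz
          rw [innerSet, mem_ofPred_eq] at hx
          linarith
        refine le_trans (setLIntegral_mono' measurableSet_ball fun z hz => ?_)
          (lintegral_mono_set hsub)
        rw [Metric.mem_ball, dist_eq_norm] at hz
        have hw1 : ‖x - w‖ < 8 * r := by rw [← dist_eq_norm]; exact Metric.mem_ball'.1 hw.1
        have hzw : ‖z - w‖ ≤ 10 * r := by
          have := norm_sub_le_norm_sub_add_norm_sub z x w
          linarith
        rw [hΨ]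
        simp only
        rw [indicator_of_mem (by exact ⟨hz, hzw⟩)]
    _ ≤ ∫⁻ x, ∫⁻ w in Ωᶜ, ∫⁻ z in Ω, Ψ x w z := setLIntegral_le_lintegral _ _
    _ = ∫⁻ w in Ωᶜ, ∫⁻ x, ∫⁻ z in Ω, Ψ x w z := by
        refine lintegral_lintegral_swap (f := fun x w => ∫⁻ z in Ω, Ψ x w z) ?_
        have : Measurable fun q : (Space N × Space N) × Space N => Ψ q.1.1 q.1.2 q.2 :=
          hΨm.comp (by fun_prop : Measurable fun q : (Space N × Space N) × Space N =>
            (q.1.1, q.1.2, q.2))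
        exact this.lintegral_prod_right'.aemeasurable
    _ = ∫⁻ w in Ωᶜ, ∫⁻ z in Ω, ∫⁻ x, Ψ x w z := by
        refine lintegral_congr fun w => lintegral_lintegral_swap (f := fun x z => Ψ x w z) ?_
        exact (hΨm.comp (by fun_prop : Measurable fun q : Space N × Space N =>
            (q.1, w, q.2))).aemeasurable
    _ = ∫⁻ z in Ω, ∫⁻ w in Ωᶜ, ∫⁻ x, Ψ x w z := by
        refine lintegral_lintegral_swap (f := fun w z => ∫⁻ x, Ψ x w z) ?_
        have : Measurable fun q : (Space N × Space N) × Space N => Ψ q.2 q.1.1 q.1.2 :=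
          hΨm.comp (by fun_prop : Measurable fun q : (Space N × Space N) × Space N =>
            (q.2, q.1.1, q.1.2))
        exact this.lintegral_prod_right'.aemeasurable
    _ ≤ _ := by
        rw [shortInteraction, ← lintegral_const_mul' _ _ ENNReal.ofReal_ne_top,
          ← lintegral_const_mul' _ _ measure_ball_lt_top.ne]
        refine setLIntegral_mono' hΩm fun z hz => ?_
        rw [← lintegral_const_mul' _ _ ENNReal.ofReal_ne_top,
          ← lintegral_const_mul' _ _ measure_ball_lt_top.ne]
        refine setLIntegral_mono' hΩm.compl fun w hw => ?_
        have hzw0 : 0 < ‖z - w‖ := norm_pos_iff.2 (sub_ne_zero.2 fun h => hw (h ▸ hz))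
        rw [hΨ]
        by_cases hzw : ‖z - w‖ ≤ 10 * r
        · have e : ∀ x, {q : Space N × Space N × Space N | ‖q.2.2 - q.1‖ < 2 * r ∧
              ‖q.2.2 - q.2.1‖ ≤ 10 * r}.indicator (fun q => ‖v q.2.2 - v q.2.1‖ₑ) (x, w, z) =
              (Metric.ball z (2 * r)).indicator (fun _ => ‖v z - v w‖ₑ) x := by
            intro x
            simp only [indicator, mem_ofPred_eq, hzw, and_true, Metric.mem_ball', dist_eq_norm]
          simp only [e]
          rw [lintegral_indicator measurableSet_ball, lintegral_const, Measure.restrict_apply_univ,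
            Measure.addHaar_ball_center, mul_comm, indicator_of_mem (by exact hzw)]
          gcongr
          rw [interaction, mul_left_comm, ← ENNReal.ofReal_mul (by positivity)]
          refine le_mul_of_one_le_right' (ENNReal.one_le_ofReal.2 ?_)
          rw [Real.rpow_neg hzw0.le, ← div_eq_mul_inv, one_le_div (by positivity)]
          exact Real.rpow_le_rpow hzw0.le hzw hp.le
        · have e : ∀ x, {q : Space N × Space N × Space N | ‖q.2.2 - q.1‖ < 2 * r ∧
              ‖q.2.2 - q.2.1‖ ≤ 10 * r}.indicator (fun q => ‖v q.2.2 - v q.2.1‖ₑ) (x, w, z) = 0 := by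
            intro x
            exact indicator_of_notMem (fun h => hzw h.2) _
          simp only [e, lintegral_zero, zero_le]

/-- For translations by at most `r`, the pairing of `v` with the cutoff at scale `r` is of second
order in the translation and is controlled by the interaction of `v` across the boundary. -/
theorem exists_enorm_pairing_cutoff_le {Ω : Set (Space N)} (hΩo : IsOpen Ω)
    (hΩb : Bornology.IsBounded Ω) (hΩL : HasLipschitzBoundary Ω) (hΩc : Ωᶜ.Nonempty)
    {p : ℝ} (hp : 0 < p) {v : Space N → ℝ} (hv : Measurable v) {M : ℝ} (hM : ∀ x, |v x| ≤ M) :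
    ∃ C : ENNReal, C ≠ ⊤ ∧ ∀ r > 0, r ≤ 1 → ∀ y, ‖y‖ ≤ r →
      ‖pairing v (cutoff Ω r) y‖ₑ ≤ C * shortInteraction Ω p v (10 * r) *
        (ENNReal.ofReal (r ^ (p - N - 2)) * ENNReal.ofReal (‖y‖ ^ 2)) := by
  obtain ⟨κ, hκ, H⟩ := exists_volume_exterior_ge hΩo hΩb hΩL hΩc one_pos
  set V := volume.real (Metric.ball (0 : Space N) 1) with hV
  have hV0 : 0 ≤ V := measureReal_nonneg
  have hm0 := tentMass_pos (N := N)
  refine ⟨ENNReal.ofReal (κ⁻¹ * ((tentMass N)⁻¹ * ((tentMass N)⁻¹ *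
    (2 ^ (N : ℝ) * V))) * (2 ^ (N : ℝ) * V) * 10 ^ p), ENNReal.ofReal_ne_top, ?_⟩
  intro r hr hr1 y hy
  have hvol : volume (Metric.ball (0 : Space N) (2 * r)) =
      ENNReal.ofReal (2 ^ (N : ℝ) * V * r ^ (N : ℝ)) := by
    rw [Measure.addHaar_ball_of_pos _ _ (by positivity), finrank_euclideanSpace_fin, hV,
      Measure.real, mul_right_comm, ENNReal.ofReal_mul (by positivity),
      ENNReal.ofReal_toReal measure_ball_lt_top.ne, Real.rpow_natCast, Real.rpow_natCast, mul_pow]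
  set Lr := (tentMass N)⁻¹ * r ^ (-(N + 1 : ℝ)) * ‖y‖ with hLr
  have hLr0 : 0 ≤ Lr := by positivity
  have hB : MeasurableSet (innerSet Ω (3 * r)) := (isClosed_innerSet Ω _).measurableSet
  have hpt : ∀ x, ‖(average r v x - average r v (x + y)) *
      (preCutoff Ω r x - preCutoff Ω r (x + y))‖ₑ ≤ (innerSet Ω (3 * r)).indicator (fun x =>
        ENNReal.ofReal (κ * r ^ (N : ℝ))⁻¹ * (ENNReal.ofReal Lr *
          (ENNReal.ofReal Lr * volume (Metric.ball (0 : Space N) (2 * r)))) *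
        ∫⁻ w in Metric.ball x (8 * r) ∩ Ωᶜ, ∫⁻ z in Metric.ball x (2 * r), ‖v z - v w‖ₑ) x := by
    intro x
    have hd1 := infDist_le_infDist_add_norm Ωᶜ x (x + y)
    have hd2 := infDist_le_infDist_add_norm Ωᶜ (x + y) x
    rw [show x - (x + y) = -y by abel, norm_neg] at hd1
    rw [show x + y - x = y by abel] at hd2
    by_cases hx : x ∈ innerSet Ω (3 * r)
    swap
    · rw [indicator_of_notMem hx]
      rw [innerSet, mem_ofPred_eq, not_le] at hx
      rw [preCutoff_eq_zero Ω hr (by linarith), preCutoff_eq_zero Ω hr (by linarith)]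
      simp
    rw [indicator_of_mem hx]
    rcases lt_or_ge (7 * r) (Metric.infDist x Ωᶜ) with hx7 | hx7
    · rw [preCutoff_eq_one Ω hr (by linarith), preCutoff_eq_one Ω hr (by linarith)]
      simp
    have hvolW := H x (innerSet_subset (by positivity) hx) r hr hr1 hx7
    have h1 : ‖preCutoff Ω r x - preCutoff Ω r (x + y)‖ₑ ≤
        ENNReal.ofReal Lr * volume (Metric.ball (0 : Space N) (2 * r)) := by
      refine (enorm_average_sub_le hr (measurable_indicator_innerSet Ω (5 * r)) (M := 1)
        (fun z => abs_le.2 ⟨by linarith [(indicator_innerSet_mem_Icc Ω (5 * r) z).1],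
          (indicator_innerSet_mem_Icc Ω (5 * r) z).2⟩) 0 x hy).trans ?_
      gcongr
      rw [← Measure.addHaar_ball_center volume x, ← setLIntegral_one]
      refine lintegral_mono fun z => ?_
      have h := indicator_innerSet_mem_Icc Ω (5 * r) z
      rw [sub_zero, Real.enorm_eq_ofReal h.1]
      exact ENNReal.ofReal_le_one.2 h.2
    have h2 : ENNReal.ofReal (κ * r ^ (N : ℝ)) * ‖average r v x - average r v (x + y)‖ₑ ≤
        ENNReal.ofReal Lr * ∫⁻ w in Metric.ball x (8 * r) ∩ Ωᶜ, ∫⁻ z in Metric.ball x (2 * r),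
          ‖v z - v w‖ₑ := by
      calc _ ≤ volume (Metric.ball x (8 * r) ∩ Ωᶜ) * ‖average r v x - average r v (x + y)‖ₑ := by
            gcongr
        _ = ∫⁻ _ in Metric.ball x (8 * r) ∩ Ωᶜ, ‖average r v x - average r v (x + y)‖ₑ := by
            rw [lintegral_const, Measure.restrict_apply_univ, mul_comm]
        _ ≤ _ := by
            rw [← lintegral_const_mul' _ _ ENNReal.ofReal_ne_top]
            exact lintegral_mono fun w => enorm_average_sub_le hr hv hM (v w) x hy
    have h3 : ‖average r v x - average r v (x + y)‖ₑ ≤ ENNReal.ofReal (κ * r ^ (N : ℝ))⁻¹ *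
        (ENNReal.ofReal Lr * ∫⁻ w in Metric.ball x (8 * r) ∩ Ωᶜ, ∫⁻ z in Metric.ball x (2 * r),
          ‖v z - v w‖ₑ) := by
      have hpos : 0 < κ * r ^ (N : ℝ) := by positivity
      calc _ = ENNReal.ofReal (κ * r ^ (N : ℝ))⁻¹ * (ENNReal.ofReal (κ * r ^ (N : ℝ)) *
            ‖average r v x - average r v (x + y)‖ₑ) := by
            rw [← mul_assoc, ← ENNReal.ofReal_mul (by positivity), inv_mul_cancel₀ hpos.ne',
              ENNReal.ofReal_one, one_mul]
        _ ≤ _ := by gcongr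
    rw [enorm_mul]
    refine (mul_le_mul' h3 h1).trans (le_of_eq ?_)
    ring
  rw [pairing_cutoff hΩb hv hM hr]
  refine (enorm_integral_le_lintegral_enorm _).trans ((lintegral_mono hpt).trans ?_)
  rw [lintegral_indicator hB, lintegral_const_mul']
  swap
  · exact ENNReal.mul_ne_top ENNReal.ofReal_ne_top (ENNReal.mul_ne_top ENNReal.ofReal_ne_top
      (ENNReal.mul_ne_top ENNReal.ofReal_ne_top measure_ball_lt_top.ne))
  refine (mul_le_mul_right (lintegral_layer_le hΩo hp hv hr) _).trans (le_of_eq ?_)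
  rw [hvol]
  set Y := shortInteraction Ω p v (10 * r)
  rw [show ∀ a b c d e f : ENNReal, a * (b * (c * d)) * (e * (f * Y)) =
    (a * (b * (c * d)) * e * f) * Y by intros; ring,
    show ∀ a b c : ENNReal, a * Y * (b * c) = a * b * c * Y by intros; ring]
  congr 1
  iterate 7 rw [← ENNReal.ofReal_mul (by positivity)]
  congr 1
  rw [hLr, Real.mul_rpow (by norm_num) hr.le, mul_inv, ← Real.rpow_neg hr.le,
    show p - N - 2 = -(N : ℝ) + (-(N + 1 : ℝ)) + (-(N + 1 : ℝ)) + N + N + p by ring,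
    Real.rpow_add hr, Real.rpow_add hr, Real.rpow_add hr, Real.rpow_add hr, Real.rpow_add hr]
  ring

/-! ### Testing the second difference integral against a cutoff -/

theorem exists_abs_secondDiff_le {Ω : Set (Space N)} (hΩo : IsOpen Ω) {v : Space N → ℝ}
    (hC2 : ContDiffOn ℝ 2 v Ω) {T : Set (Space N)} (hT : IsCompact T) (hTΩ : T ⊆ Ω) :
    ∃ δ > (0 : ℝ), ∃ C ≥ (0 : ℝ), ∀ x ∈ T, ∀ y, ‖y‖ ≤ δ →
      |2 * v x - v (x + y) - v (x - y)| ≤ C * ‖y‖ ^ 2 := by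
  obtain ⟨δ, hδ, hK⟩ := hT.exists_cthickening_subset_open hΩo hTΩ
  have hKc : IsCompact (Metric.cthickening δ T) := hT.cthickening
  have hD1 : ContDiffOn ℝ 1 (fderiv ℝ v) Ω := hC2.fderiv_of_isOpen hΩo (by norm_num)
  have hD2 : ContinuousOn (fderiv ℝ (fderiv ℝ v)) Ω := hD1.continuousOn_fderiv_of_isOpen hΩo le_rfl
  obtain ⟨C, hC⟩ := hKc.exists_bound_of_continuousOn (f := fderiv ℝ (fderiv ℝ v)) (hD2.mono hK)
  refine ⟨δ, hδ, 2 * max C 0, by positivity, fun x hx y hy => ?_⟩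
  have hball : Metric.closedBall x δ ⊆ Metric.cthickening δ T :=
    Metric.closedBall_subset_cthickening hx δ
  have hLip : ∀ a ∈ Metric.closedBall x δ, ∀ b ∈ Metric.closedBall x δ,
      ‖fderiv ℝ v b - fderiv ℝ v a‖ ≤ max C 0 * ‖b - a‖ := by
    intro a ha b hb
    refine (convex_closedBall x δ).norm_image_sub_le_of_norm_fderiv_le (fun z hz => ?_)
      (fun z hz => (hC z (hball hz)).trans (le_max_left _ _)) ha hb
    exact (hD1.differentiableOn one_ne_zero).differentiableAt
      (hΩo.mem_nhds (hK (hball hz)))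
  have hmem : ∀ z ∈ Metric.closedBall (0 : Space N) ‖y‖,
      x + z ∈ Metric.closedBall x δ ∧ x - z ∈ Metric.closedBall x δ := by
    intro z hz
    rw [mem_closedBall_zero_iff] at hz
    constructor <;> simp [dist_eq_norm] <;> linarith
  have hdiff : ∀ z ∈ Metric.closedBall x δ, HasFDerivAt v (fderiv ℝ v z) z := fun z hz =>
    ((hC2.differentiableOn two_ne_zero).differentiableAt
      (hΩo.mem_nhds (hK (hball hz)))).hasFDerivAt
  have hφ : ∀ z ∈ Metric.closedBall (0 : Space N) ‖y‖,
      HasFDerivWithinAt (fun z => v (x + z) + v (x - z)) (fderiv ℝ v (x + z) - fderiv ℝ v (x - z))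
        (Metric.closedBall 0 ‖y‖) z := by
    intro z hz
    have h1 : HasFDerivAt (fun z => v (x + z)) (fderiv ℝ v (x + z)) z := by
      have := (hdiff _ (hmem z hz).1).comp z ((hasFDerivAt_id z).const_add x)
      simpa [Function.comp_def] using this
    have h2 : HasFDerivAt (fun z => v (x - z)) (-(fderiv ℝ v (x - z))) z := by
      have := (hdiff _ (hmem z hz).2).comp z ((hasFDerivAt_id z).const_sub x)
      simpa [Function.comp_def] using this
    rw [sub_eq_add_neg]
    exact (h1.add h2).hasFDerivWithinAt
  have hbd : ∀ z ∈ Metric.closedBall (0 : Space N) ‖y‖,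
      ‖fderiv ℝ v (x + z) - fderiv ℝ v (x - z)‖ ≤ max C 0 * (2 * ‖y‖) := by
    intro z hz
    refine (hLip _ (hmem z hz).2 _ (hmem z hz).1).trans ?_
    rw [mem_closedBall_zero_iff] at hz
    gcongr
    rw [show x + z - (x - z) = z + z by abel]
    exact (norm_add_le _ _).trans (by linarith)
  have h := (convex_closedBall (0 : Space N) ‖y‖).norm_image_sub_le_of_norm_hasFDerivWithin_le hφ hbd
    (Metric.mem_closedBall_self (norm_nonneg _)) (show y ∈ Metric.closedBall (0 : Space N) ‖y‖ by simp)
  simp only [add_zero, sub_zero] at h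
  calc |2 * v x - v (x + y) - v (x - y)| = ‖v (x + y) + v (x - y) - (v x + v x)‖ := by
        rw [← norm_neg, Real.norm_eq_abs]; congr 1; ring
    _ ≤ _ := h
    _ = _ := by ring

theorem integrable_mul_of_bounded {η w : Space N → ℝ} (hη : Integrable η) (hw : Measurable w)
    {M : ℝ} (hM : ∀ x, |w x| ≤ M) : Integrable fun x => η x * w x :=
  hη.mul_bdd (c := M) hw.aestronglyMeasurable (Eventually.of_forall hM)

/-- Discrete summation by parts: by translation invariance, the symmetric second difference of `v`
tested against `η` is the pairing of first differences. -/
theorem integral_mul_secondDiff {η v : Space N → ℝ} (hη : Integrable η) (hv : Measurable v)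
    {M : ℝ} (hM : ∀ x, |v x| ≤ M) (y : Space N) :
    ∫ x, η x * (2 * v x - v (x + y) - v (x - y)) = pairing v η y := by
  have i0 : Integrable fun x => η x * v x := integrable_mul_of_bounded hη hv hM
  have i1 : Integrable fun x => η x * v (x + y) :=
    integrable_mul_of_bounded (w := fun x => v (x + y)) hη (hv.comp (measurable_add_const y))
      (fun x => hM _)
  have i2 : Integrable fun x => η x * v (x - y) :=
    integrable_mul_of_bounded (w := fun x => v (x - y)) hη (hv.comp (measurable_sub_const y))
      (fun x => hM _)
  have i3 : Integrable fun x => η (x + y) * v x := by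
    simpa using i2.comp_add_right y
  have i4 : Integrable fun x => η (x + y) * v (x + y) := i0.comp_add_right y
  have e3 : ∫ x, η (x + y) * v x = ∫ x, η x * v (x - y) := by
    rw [← integral_add_right_eq_self (fun x => η x * v (x - y)) y]; simp
  have e4 : ∫ x, η (x + y) * v (x + y) = ∫ x, η x * v x :=
    integral_add_right_eq_self (fun x => η x * v x) y
  have i5 : Integrable fun x => 2 * (η x * v x) - η x * v (x + y) := (i0.const_mul 2).sub i1
  have i6 : Integrable fun x => η x * v x - η (x + y) * v x := i0.sub i3
  have i7 : Integrable fun x => η x * v x - η (x + y) * v x - η x * v (x + y) := i6.sub i1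
  have l : ∫ x, η x * (2 * v x - v (x + y) - v (x - y)) =
      2 * (∫ x, η x * v x) - (∫ x, η x * v (x + y)) - ∫ x, η x * v (x - y) := by
    rw [← integral_const_mul, ← integral_sub (i0.const_mul 2) i1,
      ← integral_sub i5 i2]
    congr 1; ext x; ring
  have r : pairing v η y = (∫ x, η x * v x) - (∫ x, η (x + y) * v x) - (∫ x, η x * v (x + y)) +
      ∫ x, η (x + y) * v (x + y) := by
    rw [← integral_sub i0 i3, ← integral_sub i6 i1, ← integral_add i7 i4,
      pairing]
    congr 1; ext x; ring
  rw [l, r, e3, e4]; ring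

/-- The second difference integral tested against a function with compact support in `Ω`. Near that
support `v` is of class `C²`, so that the double integral converges absolutely. -/
theorem integral_cutoff_mul_secondDiff (hN : 1 ≤ N) {Ω : Set (Space N)} (hΩo : IsOpen Ω)
    {p : ℝ} (hp : N < p) (hp2 : p < N + 2) {v : Space N → ℝ} (hv : Measurable v) {M : ℝ}
    (hM : ∀ x, |v x| ≤ M) (hC2 : ContDiffOn ℝ 2 v Ω) {η : Space N → ℝ} (hη : Measurable η)
    (h01 : ∀ x, η x ∈ Icc (0 : ℝ) 1) {T : Set (Space N)} (hT : IsCompact T) (hTΩ : T ⊆ Ω)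
    (h0 : ∀ x, x ∉ T → η x = 0) :
    Integrable (fun y => pairing v η y * ‖y‖ ^ (-p)) ∧
      ∫ x, η x * ∫ y, (2 * v x - v (x + y) - v (x - y)) / ‖y‖ ^ p =
        ∫ y, pairing v η y * ‖y‖ ^ (-p) := by
  obtain ⟨δ, hδ, C, hC, H⟩ := exists_abs_secondDiff_le hΩo hC2 hT hTΩ
  have hM0 : 0 ≤ M := (abs_nonneg _).trans (hM 0)
  have hp0 : 0 < p := lt_of_le_of_lt N.cast_nonneg hp
  set g : Space N → ℝ := fun y => (Metric.ball 0 δ).indicator (fun y => C * ‖y‖ ^ (2 - p)) y +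
    {y | δ ≤ ‖y‖}.indicator (fun y => 4 * M * ‖y‖ ^ (-p)) y with hg
  have hgi : Integrable g := by
    refine Integrable.add ?_ ?_
    · exact (integrable_indicator_iff measurableSet_ball).2
        ((integrableOn_norm_rpow_ball hN (by linarith) δ).const_mul C)
    · exact (integrable_indicator_iff (measurableSet_le measurable_const measurable_norm)).2
        ((integrableOn_norm_rpow_neg hN hp hδ).const_mul (4 * M))
  have hTi : Integrable (T.indicator (1 : Space N → ℝ)) :=
    (integrable_indicator_iff hT.isClosed.measurableSet).2
      (integrableOn_const hT.measure_lt_top.ne)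
  have hηi := integrable_of_mem_Icc_of_support hη h01 hT h0
  have hF : Integrable fun q : Space N × Space N =>
      η q.1 * ((2 * v q.1 - v (q.1 + q.2) - v (q.1 - q.2)) * ‖q.2‖ ^ (-p)) := by
    refine (hTi.mul_prod hgi).mono' ?_ (Eventually.of_forall fun q => ?_)
    · refine Measurable.aestronglyMeasurable ?_
      fun_prop
    · obtain ⟨x, y⟩ := q
      simp only
      by_cases hx : x ∈ T
      swap
      · simp [hx, h0 x hx]
      rw [indicator_of_mem hx, Pi.one_apply, one_mul, norm_mul, Real.norm_of_nonneg (h01 x).1]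
      refine (mul_le_of_le_one_left (norm_nonneg _) (h01 x).2).trans ?_
      rw [norm_mul, Real.norm_of_nonneg (Real.rpow_nonneg (norm_nonneg y) _), Real.norm_eq_abs]
      rcases lt_or_ge ‖y‖ δ with hy | hy
      · have e : g y = C * ‖y‖ ^ (2 - p) := by
          simp only [hg]
          rw [indicator_of_mem (by simpa using hy), indicator_of_notMem (by simpa using hy), add_zero]
        rw [e]
        rcases eq_or_ne y 0 with rfl | hy0
        · rw [norm_zero, Real.zero_rpow (neg_ne_zero.2 hp0.ne'), mul_zero]
          positivity
        · have : ‖y‖ ^ (2 - p) = ‖y‖ ^ 2 * ‖y‖ ^ (-p) := by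
            rw [sub_eq_add_neg, Real.rpow_add (norm_pos_iff.2 hy0), Real.rpow_two]
          rw [this, ← mul_assoc]
          gcongr
          exact H x hx y hy.le
      · have e : g y = 4 * M * ‖y‖ ^ (-p) := by
          simp only [hg]
          rw [indicator_of_notMem (by simpa using hy), indicator_of_mem (by exact hy), zero_add]
        rw [e]
        gcongr
        have h1 := hM x; have h2 := hM (x + y); have h3 := hM (x - y)
        rw [abs_le] at *
        constructor <;> linarith
  have e1 : ∀ y, ∫ x, η x * ((2 * v x - v (x + y) - v (x - y)) * ‖y‖ ^ (-p)) =
      pairing v η y * ‖y‖ ^ (-p) := by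
    intro y
    rw [← integral_mul_secondDiff hηi hv hM y, ← integral_mul_const]
    simp only [mul_assoc]
  have hint := hF.integral_prod_right
  simp only [e1] at hint
  refine ⟨hint, ?_⟩
  calc _ = ∫ x, ∫ y, η x * ((2 * v x - v (x + y) - v (x - y)) * ‖y‖ ^ (-p)) := by
        refine integral_congr_ae (Eventually.of_forall fun x => ?_)
        simp only [integral_const_mul, Real.rpow_neg (norm_nonneg _), div_eq_mul_inv]
    _ = ∫ y, ∫ x, η x * ((2 * v x - v (x + y) - v (x - y)) * ‖y‖ ^ (-p)) :=
        integral_integral_swap hF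
    _ = _ := by simp only [e1]

/-! ### The contribution of short translations -/

theorem tendsto_shortInteraction {Ω : Set (Space N)} (hΩo : IsOpen Ω) {p : ℝ}
    {v : Space N → ℝ} (hv : Measurable v)
    (hX : ∫⁻ x in Ω, ∫⁻ y in Ωᶜ, interaction p v x y ≠ ⊤) {a : ℕ → ℝ}
    (ha : Tendsto a atTop (𝓝 0)) :
    Tendsto (fun n => shortInteraction Ω p v (a n)) atTop (𝓝 0) := by
  have hI := measurable_interaction p hv
  have hm : ∀ b : ℝ, Measurable ({q : Space N × Space N | ‖q.1 - q.2‖ ≤ b}.indicator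
      (fun q => interaction p v q.1 q.2)) := fun b =>
    hI.indicator (measurableSet_le (by fun_prop) (by fun_prop))
  have e : ∀ b, shortInteraction Ω p v b = ∫⁻ q, {q : Space N × Space N | ‖q.1 - q.2‖ ≤ b}.indicator
      (fun q => interaction p v q.1 q.2) q ∂((volume.restrict Ω).prod (volume.restrict Ωᶜ)) :=
    fun b => by rw [lintegral_prod _ (hm b).aemeasurable, shortInteraction]
  simp only [e]
  rw [← lintegral_prod (fun q : Space N × Space N => interaction p v q.1 q.2) hI.aemeasurable] at hX
  rw [← lintegral_zero (μ := (volume.restrict Ω).prod (volume.restrict Ωᶜ))]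
  refine tendsto_lintegral_of_dominated_convergence _ (fun n => hm _)
    (fun n => Eventually.of_forall fun q => indicator_le_self _ _ q) hX ?_
  rw [Measure.prod_restrict]
  filter_upwards [ae_restrict_mem (hΩo.measurableSet.prod hΩo.measurableSet.compl)] with q hq
  have hq0 : 0 < ‖q.1 - q.2‖ :=
    norm_pos_iff.2 (sub_ne_zero.2 fun h => hq.2 (h ▸ hq.1))
  refine tendsto_const_nhds.congr' ?_
  filter_upwards [ha.eventually (gt_mem_nhds hq0)] with n hn
  rw [indicator_of_notMem (by simpa using hn)]

theorem tendsto_integral_pairing_ball (hN : 1 ≤ N) {Ω : Set (Space N)} (hΩo : IsOpen Ω)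
    (hΩb : Bornology.IsBounded Ω) (hΩL : HasLipschitzBoundary Ω) (hΩc : Ωᶜ.Nonempty)
    {p : ℝ} (hp : N < p) (hp2 : p < N + 2) {v : Space N → ℝ} (hv : Measurable v) {M : ℝ}
    (hM : ∀ x, |v x| ≤ M) (hX : ∫⁻ x in Ω, ∫⁻ y in Ωᶜ, interaction p v x y ≠ ⊤)
    {r : ℕ → ℝ} (hr0 : ∀ n, 0 < r n) (hr1 : ∀ n, r n ≤ 1) (hr : Tendsto r atTop (𝓝 0)) :
    Tendsto (fun n => ∫ y in Metric.ball 0 (r n), pairing v (cutoff Ω (r n)) y * ‖y‖ ^ (-p))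
      atTop (𝓝 0) := by
  have hp0 : 0 < p := lt_of_le_of_lt N.cast_nonneg hp
  obtain ⟨C, hC, H⟩ := exists_enorm_pairing_cutoff_le hΩo hΩb hΩL hΩc hp0 hv hM
  obtain ⟨C', hC', H'⟩ := exists_lintegral_norm_rpow_ball_eq hN
    (show -(N : ℝ) < 2 - p by linarith)
  have hY := tendsto_shortInteraction hΩo hv hX (a := fun n => 10 * r n)
    (by simpa using hr.const_mul 10)
  have hlim : Tendsto (fun n => C * shortInteraction Ω p v (10 * r n) * C') atTop (𝓝 0) := by
    have := ENNReal.Tendsto.mul_const (ENNReal.Tendsto.const_mul hY (Or.inr hC)) (b := C')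
      (Or.inr hC')
    simpa using this
  rw [tendsto_zero_iff_enorm_tendsto_zero]
  refine tendsto_of_tendsto_of_tendsto_of_le_of_le tendsto_const_nhds hlim
    (fun n => zero_le) fun n => ?_
  refine (enorm_integral_le_lintegral_enorm _).trans ?_
  calc ∫⁻ y in Metric.ball 0 (r n), ‖pairing v (cutoff Ω (r n)) y * ‖y‖ ^ (-p)‖ₑ
      ≤ ∫⁻ y : Space N in Metric.ball 0 (r n), C * shortInteraction Ω p v (10 * r n) *
          ENNReal.ofReal (r n ^ (p - N - 2)) * ENNReal.ofReal (‖y‖ ^ (2 - p)) := by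
        refine setLIntegral_mono' measurableSet_ball fun y hy => ?_
        rw [mem_ball_zero_iff] at hy
        rw [enorm_mul, Real.enorm_eq_ofReal (Real.rpow_nonneg (norm_nonneg y) _)]
        refine (mul_le_mul_left (H (r n) (hr0 n) (hr1 n) y hy.le) _).trans ?_
        rw [← mul_assoc, mul_assoc _ (ENNReal.ofReal (‖y‖ ^ 2)), ← ENNReal.ofReal_mul (by positivity)]
        gcongr
        rcases eq_or_ne y 0 with rfl | hy0
        · rw [norm_zero, Real.zero_rpow (neg_ne_zero.2 hp0.ne'), mul_zero]
          positivity
        · rw [sub_eq_add_neg, Real.rpow_add (norm_pos_iff.2 hy0), Real.rpow_two]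
    _ = C * shortInteraction Ω p v (10 * r n) * C' := by
        rw [lintegral_const_mul _ (by fun_prop), H' _ (hr0 n), ← mul_assoc,
          mul_assoc _ (ENNReal.ofReal _) (ENNReal.ofReal _), ← ENNReal.ofReal_mul (by
            have := hr0 n; positivity), ← Real.rpow_add (hr0 n),
          show p - N - 2 + (N + (2 - p)) = 0 by ring, Real.rpow_zero, ENNReal.ofReal_one, mul_one]

/-! ### The contribution of long translations -/

/-- The set of pairs of points that a cutoff at some scale not exceeding their distance can
separate: one point on each side of the boundary, or both points inside and one of them not much
farther from the exterior than from the other point. -/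
def separatedPairs (Ω : Set (Space N)) : Set (Space N × Space N) :=
  (Ω ×ˢ Ωᶜ ∪ Ωᶜ ×ˢ Ω) ∪
    (Ω ×ˢ Ω ∩ {q | Metric.infDist q.1 Ωᶜ ≤ 7 * ‖q.1 - q.2‖} ∪
      Ω ×ˢ Ω ∩ {q | Metric.infDist q.2 Ωᶜ ≤ 7 * ‖q.2 - q.1‖})

theorem measurableSet_infDist_le (Ω : Set (Space N)) :
    MeasurableSet {q : Space N × Space N | Metric.infDist q.1 Ωᶜ ≤ 7 * ‖q.1 - q.2‖} :=
  measurableSet_le ((Metric.continuous_infDist_pt _).measurable.comp measurable_fst)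
    (by fun_prop)

theorem measurableSet_separatedPairs {Ω : Set (Space N)} (hΩo : IsOpen Ω) :
    MeasurableSet (separatedPairs Ω) := by
  have hm := hΩo.measurableSet
  refine ((hm.prod hm.compl).union (hm.compl.prod hm)).union
    (((hm.prod hm).inter (measurableSet_infDist_le Ω)).union ((hm.prod hm).inter ?_))
  exact measurable_swap (measurableSet_infDist_le Ω)

theorem lintegral_interaction_separatedPairs_ne_top (hN : 1 ≤ N) {Ω : Set (Space N)}
    (hΩo : IsOpen Ω) (hΩb : Bornology.IsBounded Ω) (hΩL : HasLipschitzBoundary Ω)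
    (hΩc : Ωᶜ.Nonempty) {p : ℝ} (hp : N < p) {v : Space N → ℝ} (hv : Measurable v)
    (hX : ∫⁻ x in Ω, ∫⁻ y in Ωᶜ, interaction p v x y ≠ ⊤) :
    ∫⁻ q in separatedPairs Ω, interaction p v q.1 q.2 ≠ ⊤ := by
  have hm := hΩo.measurableSet
  have hI := measurable_interaction p hv
  have hswap : ∀ S : Set (Space N × Space N),
      ∫⁻ q in Prod.swap ⁻¹' S, interaction p v q.1 q.2 = ∫⁻ q in S, interaction p v q.1 q.2 := by
    intro S
    have h := (Measure.measurePreserving_swap (μ := (volume : Measure (Space N)))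
      (ν := (volume : Measure (Space N)))).setLIntegral_comp_preimage_emb
      MeasurableEquiv.prodComm.measurableEmbedding (fun q => interaction p v q.1 q.2) S
    rw [← Measure.volume_eq_prod] at h
    rw [← h]
    refine lintegral_congr fun q => ?_
    rw [Prod.fst_swap, Prod.snd_swap, interaction_comm]
  have h1 : ∫⁻ q in Ω ×ˢ Ωᶜ, interaction p v q.1 q.2 ≠ ⊤ := by
    rwa [Measure.volume_eq_prod, ← Measure.prod_restrict, lintegral_prod _ hI.aemeasurable]
  have h2 : ∫⁻ q in Ω ×ˢ Ω ∩ {q | Metric.infDist q.1 Ωᶜ ≤ 7 * ‖q.1 - q.2‖},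
      interaction p v q.1 q.2 ≠ ⊤ := by
    have h := lintegral_interaction_far_ne_top hN hΩo hΩb hΩL hΩc hp hv hX
    rw [inter_comm, ← Measure.restrict_restrict (measurableSet_infDist_le Ω),
      Measure.volume_eq_prod, ← Measure.prod_restrict,
      ← lintegral_indicator (measurableSet_infDist_le Ω),
      lintegral_prod _ (hI.indicator (measurableSet_infDist_le Ω)).aemeasurable]
    exact h
  have h3 : ∫⁻ q in Ωᶜ ×ˢ Ω, interaction p v q.1 q.2 ≠ ⊤ := by
    rwa [← hswap, preimage_swap_prod]
  have h4 : ∫⁻ q in Ω ×ˢ Ω ∩ {q | Metric.infDist q.2 Ωᶜ ≤ 7 * ‖q.2 - q.1‖},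
      interaction p v q.1 q.2 ≠ ⊤ := by
    rw [← hswap, preimage_inter, preimage_swap_prod]
    exact h2
  refine ne_top_of_le_ne_top ?_ (lintegral_union_le _ _ _)
  refine ENNReal.add_ne_top.2 ⟨ne_top_of_le_ne_top ?_ (lintegral_union_le _ _ _),
    ne_top_of_le_ne_top ?_ (lintegral_union_le _ _ _)⟩
  · exact ENNReal.add_ne_top.2 ⟨h1, h3⟩
  · exact ENNReal.add_ne_top.2 ⟨h2, h4⟩

/-- The integrand of the pairing of `v` with the cutoff at scale `r`, restricted to pairs of points
of distance at least `r`. -/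
def farPairing (Ω : Set (Space N)) (p : ℝ) (v : Space N → ℝ) (r : ℝ) :
    Space N × Space N → ℝ :=
  {q | r ≤ ‖q.1 - q.2‖}.indicator fun q =>
    (v q.1 - v q.2) * (cutoff Ω r q.1 - cutoff Ω r q.2) * ‖q.1 - q.2‖ ^ (-p)

theorem measurable_farPairing (Ω : Set (Space N)) (p : ℝ) {v : Space N → ℝ} (hv : Measurable v)
    (r : ℝ) : Measurable (farPairing Ω p v r) := by
  have h := measurable_cutoff Ω r
  refine Measurable.indicator ?_ (measurableSet_le measurable_const (by fun_prop))
  fun_prop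

theorem norm_farPairing_le {Ω : Set (Space N)} (p : ℝ) (v : Space N → ℝ) {r : ℝ} (hr : 0 < r)
    (q : Space N × Space N) : ‖farPairing Ω p v r q‖ ≤
      (separatedPairs Ω).indicator (fun q => |v q.1 - v q.2| * ‖q.1 - q.2‖ ^ (-p)) q := by
  by_cases hq : r ≤ ‖q.1 - q.2‖
  swap
  · rw [farPairing, indicator_of_notMem (by exact hq), norm_zero]
    exact indicator_nonneg (fun q _ => by positivity) q
  rw [farPairing, indicator_of_mem (by exact hq)]
  by_cases hc : cutoff Ω r q.1 = cutoff Ω r q.2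
  · rw [hc, sub_self, mul_zero, zero_mul, norm_zero]
    exact indicator_nonneg (fun q _ => by positivity) q
  have hmem : q ∈ separatedPairs Ω := by
    have h0 : ∀ x, x ∉ Ω → cutoff Ω r x = 0 := fun x hx =>
      cutoff_eq_zero Ω hr fun h => hx (innerSet_subset (by positivity) h)
    by_cases h1 : q.1 ∈ Ω <;> by_cases h2 : q.2 ∈ Ω
    · right
      rcases lt_or_ge (Metric.infDist q.1 Ωᶜ) (7 * r) with h3 | h3
      · exact Or.inl ⟨⟨h1, h2⟩, by simp only [mem_ofPred_eq]; linarith⟩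
      rcases lt_or_ge (Metric.infDist q.2 Ωᶜ) (7 * r) with h4 | h4
      · exact Or.inr ⟨⟨h1, h2⟩, by simp only [mem_ofPred_eq]; rw [norm_sub_rev]; linarith⟩
      exact absurd (by rw [cutoff_eq_one Ω hr h3, cutoff_eq_one Ω hr h4]) hc
    · exact Or.inl (Or.inl ⟨h1, h2⟩)
    · exact Or.inl (Or.inr ⟨h1, h2⟩)
    · exact absurd (by rw [h0 _ h1, h0 _ h2]) hc
  rw [indicator_of_mem hmem, norm_mul, norm_mul, Real.norm_eq_abs,
    Real.norm_of_nonneg (Real.rpow_nonneg (norm_nonneg (q.1 - q.2)) _)]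
  gcongr
  refine mul_le_of_le_one_right (abs_nonneg _) ?_
  have h1 := cutoff_mem_Icc Ω hr q.1
  have h2 := cutoff_mem_Icc Ω hr q.2
  rw [Real.norm_eq_abs, abs_le]
  constructor <;> linarith [h1.1, h1.2, h2.1, h2.2]

/-- Pairs with one point on each side of the boundary survive in the limit; as the integrand is
symmetric, they are recorded as a function on `Ω × Ωᶜ` plus its reflection. -/
theorem tendsto_farPairing {Ω : Set (Space N)} (hΩo : IsOpen Ω) (hΩc : Ωᶜ.Nonempty) (p : ℝ)
    (v : Space N → ℝ) {r : ℕ → ℝ} (hr0 : ∀ n, 0 < r n) (hr : Tendsto r atTop (𝓝 0))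
    (q : Space N × Space N) : Tendsto (fun n => farPairing Ω p v (r n) q) atTop
      (𝓝 ((Ω ×ˢ Ωᶜ).indicator (fun q => (v q.1 - v q.2) * ‖q.1 - q.2‖ ^ (-p)) q +
        (Ω ×ˢ Ωᶜ).indicator (fun q => (v q.1 - v q.2) * ‖q.1 - q.2‖ ^ (-p)) q.swap)) := by
  have h0 : ∀ x, x ∉ Ω → ∀ n, cutoff Ω (r n) x = 0 := fun x hx n =>
    cutoff_eq_zero Ω (hr0 n) fun h => hx (innerSet_subset (by have := hr0 n; positivity) h)
  have h1 : ∀ x ∈ Ω, ∀ᶠ n in atTop, cutoff Ω (r n) x = 1 := by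
    intro x hx
    have hd : 0 < Metric.infDist x Ωᶜ :=
      (hΩo.isClosed_compl.notMem_iff_infDist_pos hΩc).1 (by simpa using hx)
    have h7 : Tendsto (fun n => 7 * r n) atTop (𝓝 0) := by simpa using hr.const_mul 7
    filter_upwards [h7.eventually (gt_mem_nhds hd)] with n hn
    exact cutoff_eq_one Ω (hr0 n) hn.le
  have h2 : q.1 ≠ q.2 → ∀ᶠ n in atTop, r n ≤ ‖q.1 - q.2‖ := fun h => by
    filter_upwards [hr.eventually (gt_mem_nhds (norm_pos_iff.2 (sub_ne_zero.2 h)))] with n hn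
    exact hn.le
  refine tendsto_const_nhds.congr' ?_
  obtain ⟨x, y⟩ := q
  simp only at h2
  by_cases hx : x ∈ Ω <;> by_cases hy : y ∈ Ω
  · filter_upwards [h1 x hx, h1 y hy] with n e1 e2
    simp [farPairing, indicator, hx, hy, e1, e2]
  · filter_upwards [h1 x hx, h2 (fun h => hy (h ▸ hx))] with n e1 e2
    simp [farPairing, indicator, hx, hy, e1, h0 y hy n, e2]
  · filter_upwards [h1 y hy, h2 (fun h => hx (h ▸ hy))] with n e1 e2
    simp [farPairing, indicator, hx, hy, e1, h0 x hx n, e2, norm_sub_rev y x]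
  · filter_upwards with n
    simp [farPairing, indicator, hx, hy, h0 x hx n, h0 y hy n]

theorem integral_pairing_compl_ball (Ω : Set (Space N)) (p : ℝ) {v : Space N → ℝ}
    (hv : Measurable v) {r : ℝ} (hi : Integrable (farPairing Ω p v r)) :
    ∫ y in (Metric.ball 0 r)ᶜ, pairing v (cutoff Ω r) y * ‖y‖ ^ (-p) =
      ∫ q, farPairing Ω p v r q := by
  have hmp : MeasurePreserving (fun z : Space N × Space N => (z.2, z.2 + z.1)) := by
    have := measurePreserving_prod_add_swap (volume : Measure (Space N)) (volume : Measure (Space N))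
    rwa [← Measure.volume_eq_prod] at this
  have hm := measurable_farPairing Ω p hv r
  have hi2 : Integrable fun z : Space N × Space N => farPairing Ω p v r (z.2, z.2 + z.1) :=
    hmp.integrable_comp_of_integrable hi
  rw [← hmp.map_eq, integral_map hmp.measurable.aemeasurable hm.aestronglyMeasurable,
    Measure.volume_eq_prod, integral_prod _ hi2, ← integral_indicator measurableSet_ball.compl]
  refine integral_congr_ae (Eventually.of_forall fun y => ?_)
  simp only [farPairing, indicator, mem_compl_iff, mem_ball_zero_iff, not_lt, mem_ofPred_eq,
    sub_add_cancel_left, norm_neg]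
  by_cases hy : r ≤ ‖y‖
  · simp only [hy, if_true]
    rw [integral_mul_const, pairing]
  · simp only [hy, if_false, integral_zero]

/-! ### The nonlocal integration by parts formula -/

/-- The total of the second difference integral over `Ω` is the flux across the boundary. -/
theorem integral_secondDiff_eq_of_measurable (hN : 1 ≤ N) {Ω : Set (Space N)} (hΩo : IsOpen Ω)
    (hΩb : Bornology.IsBounded Ω) (hΩL : HasLipschitzBoundary Ω)
    {p : ℝ} (hp : N < p) (hp2 : p < N + 2) {v : Space N → ℝ} (hv : Measurable v) {M : ℝ}
    (hM : ∀ x, |v x| ≤ M) (hC2 : ContDiffOn ℝ 2 v Ω)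
    (hL : IntegrableOn (fun x => ∫ y, (2 * v x - v (x + y) - v (x - y)) / ‖y‖ ^ p) Ω)
    (hX : Integrable (fun q : Space N × Space N => (v q.1 - v q.2) / ‖q.1 - q.2‖ ^ p)
      ((volume.restrict Ω).prod (volume.restrict Ωᶜ))) :
    ∫ x in Ω, ∫ y, (2 * v x - v (x + y) - v (x - y)) / ‖y‖ ^ p =
      2 * ∫ q, (v q.1 - v q.2) / ‖q.1 - q.2‖ ^ p
        ∂((volume.restrict Ω).prod (volume.restrict Ωᶜ)) := by
  have hm := hΩo.measurableSet
  have hne : Nonempty (Fin N) := ⟨⟨0, hN⟩⟩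
  have hΩc : Ωᶜ.Nonempty := by
    rw [nonempty_compl]
    rintro rfl
    exact NormedSpace.unbounded_univ ℝ (Space N) hΩb
  have hI := measurable_interaction p hv
  set k : Space N × Space N → ℝ := fun q => (v q.1 - v q.2) * ‖q.1 - q.2‖ ^ (-p) with hk
  have ek : (fun q : Space N × Space N => (v q.1 - v q.2) / ‖q.1 - q.2‖ ^ p) = k := by
    ext q; rw [hk]; simp only [Real.rpow_neg (norm_nonneg _), div_eq_mul_inv]
  have hkI : ∀ q, ‖k q‖ₑ = interaction p v q.1 q.2 := fun q => by
    rw [hk, enorm_mul, interaction, Real.enorm_eq_ofReal (Real.rpow_nonneg (norm_nonneg (q.1 - q.2)) _)]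
  rw [ek] at hX ⊢
  have hXf : ∫⁻ x in Ω, ∫⁻ y in Ωᶜ, interaction p v x y ≠ ⊤ := by
    rw [← lintegral_prod (fun q : Space N × Space N => interaction p v q.1 q.2) hI.aemeasurable]
    simp only [← hkI]
    exact hX.2.ne
  have hdom : Integrable ((separatedPairs Ω).indicator
      (fun q => |v q.1 - v q.2| * ‖q.1 - q.2‖ ^ (-p))) := by
    rw [integrable_indicator_iff (measurableSet_separatedPairs hΩo)]
    refine ⟨Measurable.aestronglyMeasurable (by fun_prop), ?_⟩
    have := lintegral_interaction_separatedPairs_ne_top hN hΩo hΩb hΩL hΩc hp hv hXf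
    refine lt_of_le_of_lt (le_of_eq (lintegral_congr fun q => ?_)) this.lt_top
    rw [← hkI, hk, enorm_mul, enorm_mul, ← Real.norm_eq_abs, enorm_norm]
  set r : ℕ → ℝ := fun n => 1 / ((n : ℝ) + 1) with hr
  have hr0 : ∀ n, 0 < r n := fun n => by rw [hr]; positivity
  have hr1 : ∀ n, r n ≤ 1 := fun n => by
    rw [hr]; simp only; rw [div_le_one (by positivity)]
    have : (0 : ℝ) ≤ n := n.cast_nonneg
    linarith
  have hrt : Tendsto r atTop (𝓝 0) := tendsto_one_div_add_atTop_nhds_zero_nat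
  have hfi : ∀ n, Integrable (farPairing Ω p v (r n)) := fun n =>
    hdom.mono' (measurable_farPairing Ω p hv _).aestronglyMeasurable
      (Eventually.of_forall fun q => norm_farPairing_le p v (hr0 n) q)
  -- Long translations give the flux, counted once from each side.
  have hfar : Tendsto (fun n => ∫ q, farPairing Ω p v (r n) q) atTop
      (𝓝 (2 * ∫ q, k q ∂((volume.restrict Ω).prod (volume.restrict Ωᶜ)))) := by
    have h := tendsto_integral_of_dominated_convergence _
      (fun n => (measurable_farPairing Ω p hv (r n)).aestronglyMeasurable) hdom
      (fun n => Eventually.of_forall fun q => norm_farPairing_le p v (hr0 n) q)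
      (Eventually.of_forall fun q => tendsto_farPairing hΩo hΩc p v hr0 hrt q)
    have i1 : Integrable ((Ω ×ˢ Ωᶜ).indicator k) := by
      rw [integrable_indicator_iff (hm.prod hm.compl), IntegrableOn, Measure.volume_eq_prod,
        ← Measure.prod_restrict]
      exact hX
    have i2 : Integrable (fun q : Space N × Space N => (Ω ×ˢ Ωᶜ).indicator k q.swap) := by
      rw [Measure.volume_eq_prod] at i1 ⊢
      exact i1.swap
    have e2 : ∫ q : Space N × Space N, (Ω ×ˢ Ωᶜ).indicator k q.swap = ∫ q, (Ω ×ˢ Ωᶜ).indicator k q := by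
      rw [Measure.volume_eq_prod]
      exact integral_prod_swap _
    have e1 : ∫ q, (Ω ×ˢ Ωᶜ).indicator k q =
        ∫ q, k q ∂((volume.restrict Ω).prod (volume.restrict Ωᶜ)) := by
      rw [integral_indicator (hm.prod hm.compl), Measure.volume_eq_prod, Measure.prod_restrict]
    rw [integral_add i1 i2, e2, e1, ← two_mul] at h
    exact h
  have hnear := tendsto_integral_pairing_ball hN hΩo hΩb hΩL hΩc hp hp2 hv hM hXf hr0 hr1 hrt
  set Lv : Space N → ℝ := fun x => ∫ y, (2 * v x - v (x + y) - v (x - y)) / ‖y‖ ^ p with hLv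
  have hsum : ∀ n, ∫ x, cutoff Ω (r n) x * Lv x =
      (∫ y in Metric.ball 0 (r n), pairing v (cutoff Ω (r n)) y * ‖y‖ ^ (-p)) +
        ∫ q, farPairing Ω p v (r n) q := by
    intro n
    have h3 : 0 < 3 * r n := by have := hr0 n; positivity
    obtain ⟨h1, h2⟩ := integral_cutoff_mul_secondDiff hN hΩo hp hp2 hv hM hC2
      (measurable_cutoff Ω (r n)) (cutoff_mem_Icc Ω (hr0 n)) (isCompact_innerSet hΩb h3)
      (innerSet_subset h3) (fun x hx => cutoff_eq_zero Ω (hr0 n) hx)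
    rw [hLv, h2, ← integral_pairing_compl_ball Ω p hv (hfi n),
      integral_add_compl measurableSet_ball h1]
  have hlim : Tendsto (fun n => ∫ x, cutoff Ω (r n) x * Lv x) atTop (𝓝 (∫ x in Ω, Lv x)) := by
    have e : ∀ n, ∫ x, cutoff Ω (r n) x * Lv x = ∫ x in Ω, cutoff Ω (r n) x * Lv x := by
      intro n
      refine (setIntegral_eq_integral_of_forall_compl_eq_zero fun x hx => ?_).symm
      have h3 : 0 < 3 * r n := by have := hr0 n; positivity
      rw [cutoff_eq_zero Ω (hr0 n) fun h => hx (innerSet_subset h3 h), zero_mul]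
    simp only [e]
    refine tendsto_integral_of_dominated_convergence (fun x => |Lv x|)
      (fun n => (measurable_cutoff Ω (r n)).aestronglyMeasurable.mul hL.aestronglyMeasurable)
      hL.abs (fun n => Eventually.of_forall fun x => ?_) ?_
    · rw [norm_mul, Real.norm_of_nonneg (cutoff_mem_Icc Ω (hr0 n) x).1, Real.norm_eq_abs]
      exact mul_le_of_le_one_left (abs_nonneg _) (cutoff_mem_Icc Ω (hr0 n) x).2
    · filter_upwards [ae_restrict_mem hm] with x hx
      have hd : 0 < Metric.infDist x Ωᶜ :=
        (hΩo.isClosed_compl.notMem_iff_infDist_pos hΩc).1 (by simpa using hx)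
      have h7 : Tendsto (fun n => 7 * r n) atTop (𝓝 0) := by simpa using hrt.const_mul 7
      refine tendsto_const_nhds.congr' ?_
      filter_upwards [h7.eventually (gt_mem_nhds hd)] with n hn
      rw [cutoff_eq_one Ω (hr0 n) hn.le, one_mul]
  simp only [hsum] at hlim
  have := tendsto_nhds_unique hlim (hnear.add hfar)
  rw [this, zero_add]

/-! ### The normalizing constant -/

theorem continuous_inv_Gamma : Continuous fun x : ℝ => (Real.Gamma x)⁻¹ := by
  have h : Continuous fun x : ℝ => ((Complex.Gamma (x : ℂ))⁻¹).re :=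
    Complex.continuous_re.comp
      (Complex.differentiable_one_div_Gamma.continuous.comp Complex.continuous_ofReal)
  refine h.congr fun x => ?_
  rw [Complex.Gamma_ofReal, ← Complex.ofReal_inv, Complex.ofReal_re]

theorem continuousOn_fracConst (hN : 1 ≤ N) : ContinuousOn (fracConst N) (Icc 0 1) := by
  have h1 : ContinuousOn (fun s : ℝ => Real.Gamma (((N : ℝ) + 2 * s) / 2)) (Icc 0 1) := by
    intro s hs
    have hN' : (1 : ℝ) ≤ N := by exact_mod_cast hN
    have hpos : 0 < ((N : ℝ) + 2 * s) / 2 := by have := hs.1; positivity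
    have h := (Real.differentiableAt_Gamma (s := ((N : ℝ) + 2 * s) / 2) fun m => by
      have : (0 : ℝ) ≤ m := m.cast_nonneg
      linarith).continuousAt
    exact (ContinuousAt.comp (f := fun s : ℝ => ((N : ℝ) + 2 * s) / 2) h
      (by fun_prop)).continuousWithinAt
  have h2 : Continuous fun s : ℝ => (2 : ℝ) ^ (2 * s - 1) :=
    Continuous.rpow continuous_const (by fun_prop) fun _ => Or.inl two_ne_zero
  have h3 : Continuous fun s : ℝ => (Real.Gamma (-s))⁻¹ := continuous_inv_Gamma.comp continuous_neg
  refine (((h2.continuousOn.mul h1).neg.mul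
    (continuousOn_const (c := (Real.pi ^ ((N : ℝ) / 2))⁻¹))).mul h3.continuousOn).congr fun s _ => ?_
  rw [fracConst, div_eq_mul_inv, mul_inv, ← mul_assoc]
  rfl

theorem measurable_fracConst (hN : 1 ≤ N) : Measurable fun s : Exponent => fracConst N s := by
  have h : Continuous fun s : Exponent => fracConst N s :=
    (continuousOn_fracConst hN).comp_continuous continuous_subtype_val
      fun s => Ioo_subset_Icc_self s.2
  exact h.measurable

theorem exists_abs_fracConst_le (hN : 1 ≤ N) : ∃ C, ∀ s : Exponent, |fracConst N s| ≤ C := by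
  obtain ⟨C, hC⟩ := isCompact_Icc.exists_bound_of_continuousOn (continuousOn_fracConst hN)
  exact ⟨C, fun s => hC s (Ioo_subset_Icc_self s.2)⟩

/-! ### Conservation of mass for the nonlocal part -/

/-- A function which is bounded and continuous up to the boundary of `Ω` agrees in `Ω`, and almost
everywhere, with a bounded measurable function. -/
theorem exists_measurable_bounded_rep {Ω : Set (Space N)} (hΩo : IsOpen Ω)
    (hΩb : Bornology.IsBounded Ω) {v : Space N → ℝ} (hv : MemLp v ⊤ volume)
    (hc : ContinuousOn v (closure Ω)) :
    ∃ w : Space N → ℝ, Measurable w ∧ (∃ M, ∀ x, |w x| ≤ M) ∧ (∀ x ∈ Ω, w x = v x) ∧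
      w =ᵐ[volume] v := by
  classical
  obtain ⟨M₁, hM₁⟩ := hΩb.isCompact_closure.exists_bound_of_continuousOn hc
  obtain ⟨M₂, hM₂⟩ : ∃ M, ∀ᵐ x, |v x| ≤ M := by
    have h := ae_le_eLpNormEssSup (f := v) (μ := volume)
    have hfin : eLpNormEssSup v volume ≠ ⊤ := by
      rw [← eLpNorm_exponent_top]; exact hv.2.ne
    refine ⟨(eLpNormEssSup v volume).toReal, h.mono fun x hx => ?_⟩
    rw [← Real.norm_eq_abs, ← toReal_enorm]
    exact ENNReal.toReal_mono hfin hx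
  set M := max 0 (max M₁ M₂) with hM
  have hM0 : 0 ≤ M := le_max_left _ _
  obtain ⟨f, hf, hvf⟩ := hv.1.aemeasurable
  refine ⟨Ω.piecewise v fun x => max (-M) (min M (f x)), ?_, ⟨M, fun x => ?_⟩,
    fun x hx => piecewise_eq_of_mem _ _ _ hx, ?_⟩
  · refine measurable_of_restrict_of_restrict_compl hΩo.measurableSet ?_ ?_
    · rw [domRestrict_piecewise]
      exact (continuousOn_iff_continuous_domRestrict.1 (hc.mono subset_closure)).measurable
    · rw [domRestrict_piecewise_compl]
      have : Measurable fun x => max (-M) (min M (f x)) := by fun_prop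
      exact this.comp measurable_subtype_coe
  · by_cases hx : x ∈ Ω
    · rw [piecewise_eq_of_mem _ _ _ hx]
      exact (hM₁ x (subset_closure hx)).trans ((le_max_left _ _).trans (le_max_right _ _))
    · rw [piecewise_eq_of_notMem _ _ _ hx, abs_le]
      exact ⟨le_max_left _ _, max_le (by linarith) (min_le_left _ _)⟩
  · filter_upwards [hM₂, hvf] with x hx hxf
    by_cases hxΩ : x ∈ Ω
    · rw [piecewise_eq_of_mem _ _ _ hxΩ]
    · have h : |v x| ≤ M := hx.trans ((le_max_right _ _).trans (le_max_right _ _))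
      rw [abs_le] at h
      rw [piecewise_eq_of_notMem _ _ _ hxΩ, ← hxf, min_eq_right h.2, max_eq_right h.1]

theorem integral_secondDiff_eq (hN : 1 ≤ N) {Ω : Set (Space N)} (hΩo : IsOpen Ω)
    (hΩb : Bornology.IsBounded Ω) (hΩL : HasLipschitzBoundary Ω)
    {p : ℝ} (hp : N < p) (hp2 : p < N + 2) {v : Space N → ℝ} (hv : MemLp v ⊤ volume)
    (hc : ContinuousOn v (closure Ω)) (hC2 : ContDiffOn ℝ 2 v Ω)
    (hL : IntegrableOn (fun x => ∫ y, (2 * v x - v (x + y) - v (x - y)) / ‖y‖ ^ p) Ω)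
    (hX : Integrable (fun q : Space N × Space N => (v q.1 - v q.2) / ‖q.1 - q.2‖ ^ p)
      ((volume.restrict Ω).prod (volume.restrict Ωᶜ))) :
    ∫ x in Ω, ∫ y, (2 * v x - v (x + y) - v (x - y)) / ‖y‖ ^ p =
      2 * ∫ q, (v q.1 - v q.2) / ‖q.1 - q.2‖ ^ p
        ∂((volume.restrict Ω).prod (volume.restrict Ωᶜ)) := by
  obtain ⟨w, hw, ⟨M, hM⟩, hwΩ, hwv⟩ := exists_measurable_bounded_rep hΩo hΩb hv hc
  have e1 : ∀ x ∈ Ω, ∫ y, (2 * v x - v (x + y) - v (x - y)) / ‖y‖ ^ p =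
      ∫ y, (2 * w x - w (x + y) - w (x - y)) / ‖y‖ ^ p := by
    intro x hx
    have h1 : ∀ᵐ y, w (x + y) = v (x + y) :=
      (measurePreserving_add_left volume x).quasiMeasurePreserving.ae hwv
    have h2 : ∀ᵐ y, w (x - y) = v (x - y) :=
      (Measure.measurePreserving_sub_left volume x).quasiMeasurePreserving.ae hwv
    refine integral_congr_ae ?_
    filter_upwards [h1, h2] with y h1 h2
    rw [h1, h2, hwΩ x hx]
  have e2 : (fun q : Space N × Space N => (v q.1 - v q.2) / ‖q.1 - q.2‖ ^ p)
      =ᵐ[(volume.restrict Ω).prod (volume.restrict Ωᶜ)]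
      fun q : Space N × Space N => (w q.1 - w q.2) / ‖q.1 - q.2‖ ^ p := by
    have h1 : ∀ᵐ q ∂((volume.restrict Ω).prod (volume.restrict Ωᶜ)), w q.1 = v q.1 :=
      Measure.quasiMeasurePreserving_fst.ae (ae_restrict_of_ae hwv)
    have h2 : ∀ᵐ q ∂((volume.restrict Ω).prod (volume.restrict Ωᶜ)), w q.2 = v q.2 :=
      Measure.quasiMeasurePreserving_snd.ae (ae_restrict_of_ae hwv)
    filter_upwards [h1, h2] with q h1 h2
    rw [h1, h2]
  rw [integral_congr_ae e2, setIntegral_congr_fun hΩo.measurableSet e1]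
  exact integral_secondDiff_eq_of_measurable hN hΩo hΩb hΩL hp hp2 hw hM
    (hC2.congr hwΩ) (hL.congr_fun e1 hΩo.measurableSet) (hX.congr e2)

/-- The total of the fractional Laplacian over `Ω` is a multiple of the flux across the boundary. -/
theorem integral_fracLaplacian_eq (hN : 1 ≤ N) {Ω : Set (Space N)} (hΩo : IsOpen Ω)
    (hΩb : Bornology.IsBounded Ω) (hΩL : HasLipschitzBoundary Ω) {s : ℝ} (hs : s ∈ Ioo (0 : ℝ) 1)
    {v : Space N → ℝ} (hv : MemLp v ⊤ volume) (hc : ContinuousOn v (closure Ω))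
    (hC2 : ContDiffOn ℝ 2 v Ω) (hL : IntegrableOn (fracLaplacian s v) Ω)
    (hX : Integrable (fun q : Space N × Space N =>
      (v q.1 - v q.2) / ‖q.1 - q.2‖ ^ ((N : ℝ) + 2 * s))
      ((volume.restrict Ω).prod (volume.restrict Ωᶜ))) :
    ∫ x in Ω, fracLaplacian s v x = 2 * ∫ q,
      fracConst N s * ((v q.1 - v q.2) / ‖q.1 - q.2‖ ^ ((N : ℝ) + 2 * s))
        ∂((volume.restrict Ω).prod (volume.restrict Ωᶜ)) := by
  rcases eq_or_ne (fracConst N s) 0 with h0 | h0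
  · simp [fracLaplacian, h0]
  · have hL' : IntegrableOn (fun x => ∫ y, (2 * v x - v (x + y) - v (x - y)) /
        ‖y‖ ^ ((N : ℝ) + 2 * s)) Ω := by
      refine (hL.const_mul (fracConst N s)⁻¹).congr (Eventually.of_forall fun x => ?_)
      simp only [fracLaplacian]
      rw [inv_mul_cancel_left₀ h0]
    have h := integral_secondDiff_eq hN hΩo hΩb hΩL (p := (N : ℝ) + 2 * s) (by linarith [hs.1])
      (by linarith [hs.2]) hv hc hC2 hL' hX
    simp only [fracLaplacian]
    rw [integral_const_mul, integral_const_mul, h]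
    ring

theorem integral_integral_fracLaplacian_eq_zero (hN : 1 ≤ N) {Ω : Set (Space N)} (hΩo : IsOpen Ω)
    (hΩb : Bornology.IsBounded Ω) (hΩL : HasLipschitzBoundary Ω)
    (μ : Measure Exponent) [IsFiniteMeasure μ]
    {v : Space N → ℝ} (hv : MemLp v ⊤ volume) (hc : ContinuousOn v (closure Ω))
    (hC2 : ContDiffOn ℝ 2 v Ω)
    (hL : Integrable (fun p : Space N × Exponent => fracLaplacian (p.2 : ℝ) v p.1)
      ((volume.restrict Ω).prod μ))
    (hX : Integrable (fun p : Space N × Space N × Exponent =>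
        (v p.1 - v p.2.1) / ‖p.1 - p.2.1‖ ^ ((N : ℝ) + 2 * (p.2.2 : ℝ)))
      ((volume.restrict Ω).prod ((volume.restrict Ωᶜ).prod μ)))
    (hν : ∀ x ∈ (closure Ω)ᶜ, ∫ s : Exponent, nonlocalNormalDeriv Ω (s : ℝ) v x ∂μ = 0) :
    ∫ x in Ω, ∫ s : Exponent, fracLaplacian (s : ℝ) v x ∂μ = 0 := by
  obtain ⟨C, hC⟩ := exists_abs_fracConst_le hN
  set ν := (volume : Measure (Space N)).restrict Ω
  set ν' := (volume : Measure (Space N)).restrict Ωᶜ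
  -- The flux density, with the variables grouped in the three ways that are needed.
  have hX1 : Integrable (fun p : (Space N × Space N) × Exponent =>
      (v p.1.1 - v p.1.2) / ‖p.1.1 - p.1.2‖ ^ ((N : ℝ) + 2 * (p.2 : ℝ))) ((ν.prod ν').prod μ) :=
    (measurePreserving_prodAssoc ν ν' μ).integrable_comp_of_integrable hX
  have hF1 : Integrable (fun p : (Space N × Space N) × Exponent => fracConst N p.2 *
      ((v p.1.1 - v p.1.2) / ‖p.1.1 - p.1.2‖ ^ ((N : ℝ) + 2 * (p.2 : ℝ)))) ((ν.prod ν').prod μ) :=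
    hX1.bdd_mul (c := C) ((measurable_fracConst hN).comp measurable_snd).aestronglyMeasurable
      (Eventually.of_forall fun p => hC p.2)
  have hF2 : Integrable (fun p : Space N × Space N × Exponent => fracConst N p.2.2 *
      ((v p.2.1 - v p.1) / ‖p.2.1 - p.1‖ ^ ((N : ℝ) + 2 * (p.2.2 : ℝ)))) (ν'.prod (ν.prod μ)) := by
    have h1 := ((Measure.measurePreserving_swap (μ := ν') (ν := ν)).prod
      (MeasurePreserving.id μ)).integrable_comp_of_integrable hF1
    exact ((measurePreserving_prodAssoc ν' ν μ).symm _).integrable_comp_of_integrable h1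
  calc ∫ x in Ω, ∫ s : Exponent, fracLaplacian (s : ℝ) v x ∂μ
      = ∫ s : Exponent, ∫ x in Ω, fracLaplacian (s : ℝ) v x ∂volume ∂μ :=
        integral_integral_swap hL
    _ = ∫ s : Exponent, 2 * ∫ q, fracConst N s *
          ((v q.1 - v q.2) / ‖q.1 - q.2‖ ^ ((N : ℝ) + 2 * (s : ℝ))) ∂(ν.prod ν') ∂μ := by
        refine integral_congr_ae ?_
        filter_upwards [hL.prod_left_ae, hX1.prod_left_ae] with s h1 h2
        exact integral_fracLaplacian_eq hN hΩo hΩb hΩL s.2 hv hc hC2 h1 h2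
    _ = 2 * ∫ q, ∫ s : Exponent, fracConst N s *
          ((v q.1 - v q.2) / ‖q.1 - q.2‖ ^ ((N : ℝ) + 2 * (s : ℝ))) ∂μ ∂(ν.prod ν') := by
        rw [integral_const_mul]
        congr 1
        exact (integral_integral_swap hF1).symm
    _ = 2 * ∫ y, ∫ x, ∫ s : Exponent, fracConst N s *
          ((v x - v y) / ‖x - y‖ ^ ((N : ℝ) + 2 * (s : ℝ))) ∂μ ∂ν ∂ν' := by
        congr 1
        exact integral_prod_symm _ hF1.integral_prod_left
    _ = 2 * ∫ y, (0 : ℝ) ∂ν' := by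
        congr 1
        refine integral_congr_ae ?_
        have hfr : ∀ᵐ y ∂ν', y ∉ frontier Ω :=
          ae_restrict_of_ae (measure_eq_zero_iff_ae_notMem.1 (volume_frontier_eq_zero hΩo hΩb hΩL))
        filter_upwards [hF2.prod_right_ae, hfr, ae_restrict_mem hΩo.measurableSet.compl]
          with y h1 h2 h3
        have hy : y ∈ (closure Ω)ᶜ := by
          rw [hΩo.frontier_eq] at h2
          exact fun h => h2 ⟨h, h3⟩
        rw [integral_integral_swap h1, ← neg_eq_zero, ← integral_neg]
        refine Eq.trans ?_ (hν y hy)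
        refine integral_congr_ae (Eventually.of_forall fun s => ?_)
        simp only [nonlocalNormalDeriv]
        rw [integral_const_mul, ← mul_neg, ← integral_neg]
        congr 2
        ext x
        rw [norm_sub_rev x y, ← neg_div, neg_sub]
    _ = 0 := by simp

/-! ### Integration by parts against functions with compact support in the domain -/

theorem laplacian_eq_sum_fderiv {Ω : Set (Space N)} (hΩo : IsOpen Ω) {v : Space N → ℝ}
    (hC2 : ContDiffOn ℝ 2 v Ω) {x : Space N} (hx : x ∈ Ω) :
    Laplacian.laplacian v x = ∑ i, fderiv ℝ (fun z => fderiv ℝ v z (stdOrthonormalBasis ℝ (Space N) i))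
      x (stdOrthonormalBasis ℝ (Space N) i) := by
  have hD1 : ContDiffOn ℝ 1 (fderiv ℝ v) Ω := hC2.fderiv_of_isOpen hΩo (by norm_num)
  have hd : DifferentiableAt ℝ (fderiv ℝ v) x :=
    (hD1.differentiableOn one_ne_zero).differentiableAt (hΩo.mem_nhds hx)
  have h := congrFun (InnerProductSpace.laplacian_eq_iteratedFDeriv_stdOrthonormalBasis v) x
  refine h.trans (Finset.sum_congr rfl fun i _ => ?_)
  rw [iteratedFDeriv_two_apply]
  have h2 := (hd.hasFDerivAt.clm_apply
    (hasFDerivAt_const (stdOrthonormalBasis ℝ (Space N) i) x)).fderiv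
  rw [h2]
  simp

theorem exists_smooth_cutoff {Ω K : Set (Space N)} (hΩo : IsOpen Ω) (hK : IsCompact K)
    (hKΩ : K ⊆ Ω) : ∃ ψ : Space N → ℝ, ContDiff ℝ 1 ψ ∧ HasCompactSupport ψ ∧ tsupport ψ ⊆ Ω ∧
      ∀ x ∈ K, ψ =ᶠ[𝓝 x] 1 := by
  obtain ⟨K', hK', hKK', hK'Ω⟩ := exists_compact_between hK hΩo hKΩ
  obtain ⟨f, hf1, hf0, -⟩ := exists_contMDiffMap_one_nhds_of_subset_interior
    (n := 1) (modelWithCornersSelf ℝ (Space N)) hK.isClosed hKK'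
  have hsub : tsupport f ⊆ K' := closure_minimal
    (fun x hx => by by_contra h; exact hx (hf0 x h)) hK'.isClosed
  refine ⟨f, f.contMDiff.contDiff, hK'.of_isClosed_subset (isClosed_tsupport _) hsub,
    hsub.trans hK'Ω, fun x hx => ?_⟩
  have := hf1.filter_mono (nhds_le_nhdsSet hx)
  exact this

theorem integrableOn_fderiv_apply {Ω : Set (Space N)} (hΩo : IsOpen Ω)
    (hΩb : Bornology.IsBounded Ω) {φ : Space N → ℝ} {C : NNReal} (hφ : LipschitzWith C φ)
    {G : Space N → Space N} (hG : ContinuousOn G (closure Ω)) :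
    IntegrableOn (fun x => fderiv ℝ φ x (G x)) Ω := by
  obtain ⟨M, hM⟩ := hΩb.isCompact_closure.exists_bound_of_continuousOn hG
  have hmeas : AEStronglyMeasurable (fun x => fderiv ℝ φ x (G x)) (volume.restrict Ω) :=
    (ContinuousLinearMap.id ℝ (Space N →L[ℝ] ℝ)).aestronglyMeasurable_comp₂
      (measurable_fderiv ℝ φ).aestronglyMeasurable ((hG.mono subset_closure).aestronglyMeasurable hΩo.measurableSet)
  have : IsFiniteMeasure (volume.restrict Ω) := ⟨by simpa using hΩb.measure_lt_top⟩
  refine Integrable.of_bound hmeas (C * M) ?_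
  filter_upwards [ae_restrict_mem hΩo.measurableSet] with x hx
  refine ((fderiv ℝ φ x).le_opNorm _).trans ?_
  gcongr
  · exact norm_fderiv_le_of_lipschitz ℝ hφ
  · exact hM x (subset_closure hx)

/-- Integration by parts against a Lipschitz function with compact support in `Ω`. -/
theorem integral_mul_laplacian_of_tsupport_subset {Ω : Set (Space N)} (hΩo : IsOpen Ω)
    {v : Space N → ℝ} (hC2 : ContDiffOn ℝ 2 v Ω)
    {G : Space N → Space N} (hG : ∀ x ∈ Ω, HasGradientAt v (G x) x)
    {φ : Space N → ℝ} {C : NNReal} (hφ : LipschitzWith C φ) (hφc : HasCompactSupport φ)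
    (hφΩ : tsupport φ ⊆ Ω) :
    ∫ x in Ω, φ x * Laplacian.laplacian v x = -∫ x in Ω, fderiv ℝ φ x (G x) := by
  obtain ⟨ψ, hψ, hψc, hψΩ, hψ1⟩ := exists_smooth_cutoff hΩo hφc hφΩ
  set b := stdOrthonormalBasis ℝ (Space N)
  have hD1 : ContDiffOn ℝ 1 (fderiv ℝ v) Ω := hC2.fderiv_of_isOpen hΩo (by norm_num)
  set f : Fin (Module.finrank ℝ (Space N)) → Space N → ℝ := fun i x => ψ x * fderiv ℝ v x (b i)
  have hf1 : ∀ i, ContDiff ℝ 1 (f i) := by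
    intro i
    rw [contDiff_iff_contDiffAt]
    intro x
    by_cases hx : x ∈ tsupport ψ
    · exact hψ.contDiffAt.mul ((hD1.contDiffAt (hΩo.mem_nhds (hψΩ hx))).clm_apply contDiffAt_const)
    · refine (contDiffAt_const (c := (0 : ℝ))).congr_of_eventuallyEq ?_
      filter_upwards [(isClosed_tsupport ψ).isOpen_compl.mem_nhds hx] with y hy
      simp only [f]
      rw [image_eq_zero_of_notMem_tsupport hy, zero_mul]
  have hfc : ∀ i, HasCompactSupport (f i) := fun i => hψc.mul_right
  have hleft : ∀ x, φ x * Laplacian.laplacian v x =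
      ∑ i, lineDeriv ℝ (f i) x (b i) * φ x := by
    intro x
    by_cases hx : x ∈ tsupport φ
    · rw [laplacian_eq_sum_fderiv hΩo hC2 (hφΩ hx), Finset.mul_sum]
      refine Finset.sum_congr rfl fun i _ => ?_
      rw [((hf1 i).differentiable one_ne_zero x).lineDeriv_eq_fderiv, mul_comm]
      congr 2
      refine Filter.EventuallyEq.fderiv_eq ?_
      filter_upwards [hψ1 x hx] with y hy
      simp only [f, hy, Pi.one_apply, one_mul]
      rfl
    · simp [image_eq_zero_of_notMem_tsupport hx]
  have hright : ∀ᵐ x, ∑ i, lineDeriv ℝ φ x (-b i) * f i x = -Ω.indicator (fun x => fderiv ℝ φ x (G x)) x := by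
    filter_upwards [hφ.ae_differentiableAt] with x hx
    by_cases hxφ : x ∈ tsupport φ
    · have hxΩ := hφΩ hxφ
      rw [indicator_of_mem hxΩ]
      have hg : ∀ w, fderiv ℝ v x w = inner ℝ (G x) w := fun w => by
        rw [(hG x hxΩ).hasFDerivAt.fderiv]; simp
      have hsum : G x = ∑ i, (inner ℝ (G x) (b i) : ℝ) • b i := by
        conv_lhs => rw [← b.sum_repr (G x)]
        refine Finset.sum_congr rfl fun i _ => ?_
        rw [b.repr_apply_apply, real_inner_comm]
      conv_rhs => rw [hsum, map_sum]
      rw [← Finset.sum_neg_distrib]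
      refine Finset.sum_congr rfl fun i _ => ?_
      have h1 : ψ x = 1 := (hψ1 x hxφ).eq_of_nhds
      simp only [f]
      rw [hx.lineDeriv_eq_fderiv, h1, one_mul, hg, map_neg, map_smul, smul_eq_mul]
      ring
    · have h0 : fderiv ℝ φ x = 0 := by
        have : φ =ᶠ[𝓝 x] fun _ => 0 := notMem_tsupport_iff_eventuallyEq.1 hxφ
        rw [this.fderiv_eq]; simp
      have h1 : ∀ w, lineDeriv ℝ φ x w = 0 := fun w => by
        rw [hx.lineDeriv_eq_fderiv, h0]; simp
      simp [h1, h0, indicator]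
  have i1 : ∀ i, Integrable fun x => lineDeriv ℝ (f i) x (b i) * φ x := by
    intro i
    have hc : Continuous fun x => fderiv ℝ (f i) x (b i) :=
      ((hf1 i).continuous_fderiv one_ne_zero).clm_apply continuous_const
    refine ((hc.mul hφ.continuous).integrable_of_hasCompactSupport hφc.mul_left).congr
      (Eventually.of_forall fun x => ?_)
    simp only
    rw [((hf1 i).differentiable one_ne_zero x).lineDeriv_eq_fderiv]
    rfl
  have i2 : ∀ i, Integrable fun x => lineDeriv ℝ φ x (-b i) * f i x := fun i =>
    ((hf1 i).continuous.integrable_of_hasCompactSupport (hfc i)).bdd_mul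
      (c := C * ‖-b i‖) (aestronglyMeasurable_lineDeriv hφ.continuous _)
      (Eventually.of_forall fun x => norm_lineDeriv_le_of_lipschitz ℝ hφ)
  calc ∫ x in Ω, φ x * Laplacian.laplacian v x = ∫ x, φ x * Laplacian.laplacian v x := by
        refine setIntegral_eq_integral_of_forall_compl_eq_zero fun x hx => ?_
        rw [image_eq_zero_of_notMem_tsupport fun h => hx (hφΩ h), zero_mul]
    _ = ∑ i, ∫ x, lineDeriv ℝ (f i) x (b i) * φ x := by
        simp only [hleft]
        exact integral_finsetSum _ fun i _ => i1 i
    _ = ∑ i, ∫ x, lineDeriv ℝ φ x (-b i) * f i x := by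
        refine Finset.sum_congr rfl fun i _ => ?_
        obtain ⟨D, hD⟩ := (hf1 i).lipschitzWith_of_hasCompactSupport (hfc i) one_ne_zero
        exact hD.integral_lineDeriv_mul_eq hφ hφc (b i)
    _ = ∫ x, -Ω.indicator (fun x => fderiv ℝ φ x (G x)) x := by
        rw [← integral_finsetSum _ fun i _ => i2 i]
        exact integral_congr_ae hright
    _ = _ := by rw [integral_neg, integral_indicator hΩo.measurableSet]

/-! ### The conormal derivative at the boundary -/

namespace GraphChart

variable {Ω : Set (Space N)} {x₀ : Space N} (c : GraphChart Ω x₀)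

theorem fderiv_height_dir {b : Space N} (hb : DifferentiableAt ℝ c.height b) :
    fderiv ℝ c.height b c.dir = 1 := by
  rw [← hb.lineDeriv_eq_fderiv, lineDeriv]
  simp only [c.height_add]
  simp

/-- A point over which the graph is differentiable has an outer unit normal, opposite to the
gradient of the height. -/
theorem isOuterUnitNormal {b g : Space N} (hbr : b ∈ Metric.ball x₀ c.radius)
    (hb0 : c.height b = 0) (hg : HasGradientAt c.height g b) (hg0 : g ≠ 0) :
    IsOuterUnitNormal Ω b (-(‖g‖⁻¹ • g)) := by
  have hgn : 0 < ‖g‖ := norm_pos_iff.2 hg0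
  refine ⟨by rw [norm_neg, norm_smul, norm_inv, norm_norm, inv_mul_cancel₀ hgn.ne'], ?_⟩
  intro ε hε
  have h1 : ∀ᶠ y in 𝓝 b, ‖c.height y - c.height b - inner ℝ g (y - b)‖ ≤ ε * ‖g‖ * ‖y - b‖ := by
    have := (hasGradientAt_iff_isLittleO.1 hg).def (show 0 < ε * ‖g‖ by positivity)
    simpa using this
  obtain ⟨r, hr, H⟩ := Metric.eventually_nhds_iff_ball.1
    (h1.and (Metric.isOpen_ball.mem_nhds hbr))
  refine ⟨r, hr, fun y hy => ?_⟩
  obtain ⟨h2, h3⟩ := H y hy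
  rw [hb0, sub_zero, Real.norm_eq_abs, abs_le] at h2
  have h4 : inner ℝ (y - b) (-(‖g‖⁻¹ • g)) = -(‖g‖⁻¹ * inner ℝ g (y - b)) := by
    rw [inner_neg_right, inner_smul_right, real_inner_comm]
  have h5 : ‖g‖ * (‖g‖⁻¹ * inner ℝ g (y - b)) = inner ℝ g (y - b) :=
    mul_inv_cancel_left₀ hgn.ne' _
  rw [h4]
  constructor
  · intro h
    rw [c.mem_iff h3]
    have : ‖g‖ * (ε * ‖y - b‖) < ‖g‖ * (‖g‖⁻¹ * inner ℝ g (y - b)) :=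
      mul_lt_mul_of_pos_left (by linarith) hgn
    rw [h5] at this
    nlinarith
  · intro h
    rw [c.mem_iff h3, not_lt]
    have : ‖g‖ * (ε * ‖y - b‖) < ‖g‖ * -(‖g‖⁻¹ * inner ℝ g (y - b)) :=
      mul_lt_mul_of_pos_left h hgn
    rw [mul_neg, h5] at this
    nlinarith

end GraphChart

/-- For a function that is continuously differentiable up to the boundary, the one-sided normal
derivative is the normal component of the extended gradient. -/
theorem hasNormalDeriv_inner {Ω : Set (Space N)} {v : Space N → ℝ}
    (hv : ContinuousOn v (closure Ω)) {G : Space N → Space N} (hGc : ContinuousOn G (closure Ω))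
    (hG : ∀ x ∈ Ω, HasGradientAt v (G x) x) {b ν : Space N} (hb : b ∈ closure Ω)
    (hν : IsOuterUnitNormal Ω b ν) : HasNormalDeriv v b ν (inner ℝ (G b) ν) := by
  obtain ⟨hν1, H⟩ := hν
  obtain ⟨r, hr, hH⟩ := H (1 / 2) (by norm_num)
  have hin : ∀ h ∈ Ioo (-r) 0, b + h • ν ∈ Ω := by
    intro h hh
    have hn : ‖b + h • ν - b‖ = -h := by
      rw [add_sub_cancel_left, norm_smul, hν1, mul_one, Real.norm_eq_abs, abs_of_neg hh.2]
    refine (hH (b + h • ν) ?_).1 ?_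
    · rw [Metric.mem_ball, dist_eq_norm, hn]; linarith [hh.1]
    · rw [hn, add_sub_cancel_left, real_inner_smul_left, real_inner_self_eq_norm_sq, hν1]
      linarith [hh.2]
  have hcont : ContinuousWithinAt (fun h : ℝ => b + h • ν) (Ioo (-r) 0) 0 :=
    Continuous.continuousWithinAt (by fun_prop)
  have hmaps : MapsTo (fun h : ℝ => b + h • ν) (Ioo (-r) 0) (closure Ω) := fun h hh =>
    subset_closure (hin h hh)
  have hb' : b + (0 : ℝ) • ν = b := by simp
  have hderiv : ∀ h ∈ Ioo (-r) 0, HasDerivAt (fun h : ℝ => v (b + h • ν))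
      (inner ℝ (G (b + h • ν)) ν) h := by
    intro h hh
    have h1 : HasDerivAt (fun h : ℝ => b + h • ν) ν h := by
      simpa using ((hasDerivAt_id h).smul_const ν).const_add b
    have h2 := (hG _ (hin h hh)).hasFDerivAt.comp_hasDerivAt h h1
    simpa [Function.comp_def] using h2
  have hnhds : Ioo (-r) 0 ∈ 𝓝[<] (0 : ℝ) := Ioo_mem_nhdsLT (by linarith)
  refine hasDerivWithinAt_Iic_of_tendsto_deriv (s := Ioo (-r) 0)
    (fun h hh => (hderiv h hh).differentiableAt.differentiableWithinAt) ?_ hnhds ?_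
  · have h1 : ContinuousWithinAt v (closure Ω) (b + (0 : ℝ) • ν) := by rw [hb']; exact hv b hb
    exact ContinuousWithinAt.comp (f := fun h : ℝ => b + h • ν) h1 hcont hmaps
  · have h1 : ContinuousWithinAt G (closure Ω) (b + (0 : ℝ) • ν) := by rw [hb']; exact hGc b hb
    have h2 : Tendsto (fun h : ℝ => inner ℝ (G (b + h • ν)) ν) (𝓝[Ioo (-r) 0] 0)
        (𝓝 (inner ℝ (G b) ν)) := by
      have h3 := (ContinuousWithinAt.comp (f := fun h : ℝ => b + h • ν) h1 hcont hmaps).tendsto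
      simp only [Function.comp_apply, hb'] at h3
      exact h3.inner tendsto_const_nhds
    rw [nhdsWithin_Ioo_eq_nhdsLT (by linarith)] at h2
    refine h2.congr' ?_
    filter_upwards [hnhds] with h hh
    exact (hderiv h hh).deriv.symm

/-- At a boundary point over which the graph is differentiable, the homogeneous Neumann condition
makes the gradient tangential. -/
theorem GraphChart.fderiv_height_apply_eq_zero {Ω : Set (Space N)} {x₀ : Space N}
    (c : GraphChart Ω x₀) {v : Space N → ℝ}
    (hv : ContinuousOn v (closure Ω)) {G : Space N → Space N} (hGc : ContinuousOn G (closure Ω))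
    (hG : ∀ x ∈ Ω, HasGradientAt v (G x) x)
    (hN : ∀ x ∈ frontier Ω, ∀ ν, IsOuterUnitNormal Ω x ν → HasNormalDeriv v x ν 0)
    {b : Space N} (hb : b ∈ frontier Ω) (hbr : b ∈ Metric.ball x₀ c.radius)
    (hb0 : c.height b = 0) (hd : DifferentiableAt ℝ c.height b) :
    fderiv ℝ c.height b (G b) = 0 := by
  set g := gradient c.height b with hgdef
  have hg : HasGradientAt c.height g b := hd.hasGradientAt
  have hgw : ∀ w, fderiv ℝ c.height b w = inner ℝ g w := fun w => by
    rw [hg.hasFDerivAt.fderiv]; simp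
  have hg0 : g ≠ 0 := by
    intro h
    have := c.fderiv_height_dir hd
    rw [hgw, h, inner_zero_left] at this
    exact zero_ne_one this
  have hν := c.isOuterUnitNormal hbr hb0 hg hg0
  have h1 := hasNormalDeriv_inner hv hGc hG (frontier_subset_closure hb) hν
  have h2 := hN b hb _ hν
  have h3 : inner ℝ (G b) (-(‖g‖⁻¹ • g)) = 0 :=
    (uniqueDiffWithinAt_Iic (0 : ℝ)).eq_deriv _ h1 h2
  rw [inner_neg_right, inner_smul_right, neg_eq_zero, mul_eq_zero] at h3
  rw [hgw, real_inner_comm]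
  exact h3.resolve_left (inv_ne_zero (norm_ne_zero_iff.2 hg0))

/-! ### Green's formula near a boundary point -/

namespace GraphChart

variable {Ω : Set (Space N)} {x₀ : Space N} (c : GraphChart Ω x₀)

/-- The cutoff that vanishes below height `ε` and equals one above height `2 ε`. -/
def ramp (ε : ℝ) (x : Space N) : ℝ := min 1 (max 0 (c.height x / ε - 1))

theorem ramp_mem_Icc (ε : ℝ) (x : Space N) : c.ramp ε x ∈ Icc (0 : ℝ) 1 :=
  ⟨le_min zero_le_one (le_max_left _ _), min_le_left _ _⟩

theorem abs_ramp_sub_le {ε : ℝ} (hε : 0 < ε) (x y : Space N) :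
    |c.ramp ε x - c.ramp ε y| ≤ ε⁻¹ * |c.height x - c.height y| := by
  calc |c.ramp ε x - c.ramp ε y|
      ≤ max |1 - 1| |max 0 (c.height x / ε - 1) - max 0 (c.height y / ε - 1)| :=
        abs_min_sub_min_le_max _ _ _ _
    _ = |max 0 (c.height x / ε - 1) - max 0 (c.height y / ε - 1)| := by simp
    _ ≤ max |0 - 0| |(c.height x / ε - 1) - (c.height y / ε - 1)| := abs_max_sub_max_le_max _ _ _ _
    _ = |ε⁻¹ * (c.height x - c.height y)| := by
        rw [sub_zero, abs_zero, max_eq_right (abs_nonneg _)]; congr 1; ring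
    _ = _ := by rw [abs_mul, abs_of_pos (inv_pos.2 hε)]

theorem lipschitz_ramp {ε : ℝ} (hε : 0 < ε) :
    LipschitzWith (ε⁻¹.toNNReal * (1 + c.lip)) (c.ramp ε) := by
  refine LipschitzWith.of_dist_le_mul fun x y => ?_
  rw [NNReal.coe_mul, Real.coe_toNNReal _ (inv_pos.2 hε).le, mul_assoc, Real.dist_eq]
  refine (c.abs_ramp_sub_le hε x y).trans ?_
  gcongr
  have := c.lipschitz_height.dist_le_mul x y
  rwa [Real.dist_eq] at this

theorem ramp_eq_one {ε : ℝ} (hε : 0 < ε) {x : Space N} (hx : 2 * ε ≤ c.height x) :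
    c.ramp ε x = 1 := by
  have : 2 ≤ c.height x / ε := (le_div_iff₀ hε).2 hx
  rw [ramp, min_eq_left (le_max_of_le_right (by linarith))]

theorem ramp_eq_zero {ε : ℝ} (hε : 0 < ε) {x : Space N} (hx : c.height x ≤ ε) :
    c.ramp ε x = 0 := by
  have : c.height x / ε ≤ 1 := (div_le_one hε).2 hx
  rw [ramp, max_eq_left (by linarith), min_eq_right zero_le_one]

/-- This holds also where the ramp fails to be a differentiable function of the height, as only
difference quotients are compared. -/
theorem abs_fderiv_ramp_le {ε : ℝ} (hε : 0 < ε) {x : Space N}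
    (h1 : DifferentiableAt ℝ (c.ramp ε) x) (h2 : DifferentiableAt ℝ c.height x) (w : Space N) :
    |fderiv ℝ (c.ramp ε) x w| ≤ ε⁻¹ * |fderiv ℝ c.height x w| := by
  have t1 := (h1.hasFDerivAt.hasLineDerivAt w).tendsto_slope_zero
  have t2 := (h2.hasFDerivAt.hasLineDerivAt w).tendsto_slope_zero
  refine le_of_tendsto_of_tendsto t1.abs (t2.abs.const_mul ε⁻¹) (Eventually.of_forall fun t => ?_)
  simp only [smul_eq_mul, abs_mul]
  rw [mul_left_comm]
  gcongr
  exact c.abs_ramp_sub_le hε _ _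

theorem fderiv_ramp_eq_zero {ε : ℝ} (hε : 0 < ε) {x : Space N} (hx : 2 * ε < c.height x) :
    fderiv ℝ (c.ramp ε) x = 0 := by
  have : c.ramp ε =ᶠ[𝓝 x] fun _ => 1 := by
    filter_upwards [c.continuous_height.continuousAt.eventually (lt_mem_nhds hx)] with y hy
    exact c.ramp_eq_one hε hy.le
  rw [this.fderiv_eq]
  simp

theorem fderiv_height_translate (x : Space N) (a : ℝ) :
    fderiv ℝ c.height (x + a • c.dir) = fderiv ℝ c.height x := by
  rw [← fderiv_comp_add_right]
  simp only [c.height_add]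
  exact fderiv_add_const _

end GraphChart

theorem lipschitzWith_mul_of_bounded {f g : Space N → ℝ} {C D : NNReal} (hf : LipschitzWith C f)
    (hg : LipschitzWith D g) {A B : NNReal} (hA : ∀ x, |f x| ≤ A) (hB : ∀ x, |g x| ≤ B) :
    LipschitzWith (A * D + B * C) fun x => f x * g x := by
  refine LipschitzWith.of_dist_le_mul fun x y => ?_
  have h1 := hf.dist_le_mul x y
  have h2 := hg.dist_le_mul x y
  rw [Real.dist_eq] at *
  calc |f x * g x - f y * g y| = |f x * (g x - g y) + g y * (f x - f y)| := by congr 1; ring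
    _ ≤ |f x| * |g x - g y| + |g y| * |f x - f y| := by
        rw [← abs_mul, ← abs_mul]; exact abs_add_le _ _
    _ ≤ A * (D * dist x y) + B * (C * dist x y) := by
        gcongr
        exacts [hA x, hB y]
    _ = _ := by push_cast; ring

/-- Green's formula for a test function supported near a boundary point. The ramps approximate the
domain from inside. Their derivatives are dominated by multiples of the derivative of the height,
with bounded integral, and the latter almost annihilates the gradient of `v` close to the boundary,
where that gradient is almost tangential. -/
theorem GraphChart.integral_mul_laplacian {Ω : Set (Space N)} (hΩo : IsOpen Ω)
    (hΩb : Bornology.IsBounded Ω) {x₀ : Space N} (c : GraphChart Ω x₀) {v : Space N → ℝ}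
    (hC2 : ContDiffOn ℝ 2 v Ω) (hv : ContinuousOn v (closure Ω))
    {G : Space N → Space N} (hGc : ContinuousOn G (closure Ω))
    (hG : ∀ x ∈ Ω, HasGradientAt v (G x) x)
    (hN : ∀ x ∈ frontier Ω, ∀ ν, IsOuterUnitNormal Ω x ν → HasNormalDeriv v x ν 0)
    (hΔ : IntegrableOn (Laplacian.laplacian v) Ω)
    {χ : Space N → ℝ} (hχ : ContDiff ℝ 1 χ) (hχc : HasCompactSupport χ)
    (hχs : tsupport χ ⊆ Metric.ball x₀ (c.radius / 2)) :
    ∫ x in Ω, χ x * Laplacian.laplacian v x = -∫ x in Ω, fderiv ℝ χ x (G x) := by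
  obtain ⟨C, hC⟩ := hχ.lipschitzWith_of_hasCompactSupport hχc one_ne_zero
  obtain ⟨A, hA⟩ : ∃ A : NNReal, ∀ x, |χ x| ≤ A := by
    obtain ⟨A, hA⟩ := hχc.exists_bound_of_continuous hχ.continuous
    exact ⟨A.toNNReal, fun x => (hA x).trans (Real.le_coe_toNNReal A)⟩
  have hΩm := hΩo.measurableSet
  have hR := c.radius_pos
  have hsub : tsupport χ ⊆ Metric.ball x₀ c.radius :=
    hχs.trans (Metric.ball_subset_ball (by linarith))
  have hiG := integrableOn_fderiv_apply hΩo hΩb hC hGc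
  set ε : ℕ → ℝ := fun n => 1 / ((n : ℝ) + 1) with hεdef
  have hε0 : ∀ n, 0 < ε n := fun n => by rw [hεdef]; positivity
  have hεt : Tendsto ε atTop (𝓝 0) := tendsto_one_div_add_atTop_nhds_zero_nat
  have hB : ∀ n x, |c.ramp (ε n) x| ≤ (1 : NNReal) := fun n x => by
    have := c.ramp_mem_Icc (ε n) x
    rw [abs_of_nonneg this.1]; exact this.2
  -- Green's formula against the test function multiplied by a ramp.
  have key : ∀ n, (∫ x in Ω, c.ramp (ε n) x *
      (χ x * Laplacian.laplacian v x + fderiv ℝ χ x (G x))) =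
      -∫ x in Ω, χ x * fderiv ℝ (c.ramp (ε n)) x (G x) := by
    intro n
    have hl := lipschitzWith_mul_of_bounded hC (c.lipschitz_ramp (hε0 n)) hA (hB n)
    set φ : Space N → ℝ := fun x => χ x * c.ramp (ε n) x with hφ
    have hZ : tsupport φ ⊆ tsupport χ ∩ {x | ε n ≤ c.height x} := by
      refine closure_minimal (fun x hx => ?_)
        ((isClosed_tsupport χ).inter (isClosed_le continuous_const c.continuous_height))
      refine ⟨subset_closure fun h => hx (by simp [hφ, h]), ?_⟩
      by_contra h
      rw [mem_ofPred_eq, not_le] at h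
      exact hx (by simp [hφ, c.ramp_eq_zero (hε0 n) h.le])
    have hφΩ : tsupport φ ⊆ Ω := fun x hx =>
      (c.mem_iff (hsub (hZ hx).1)).2 ((hε0 n).trans_le (hZ hx).2)
    have h1 := integral_mul_laplacian_of_tsupport_subset hΩo hC2 hG hl hχc.mul_right hφΩ
    have h2 : ∀ᵐ x, fderiv ℝ φ x (G x) =
        c.ramp (ε n) x * fderiv ℝ χ x (G x) + χ x * fderiv ℝ (c.ramp (ε n)) x (G x) := by
      filter_upwards [(c.lipschitz_ramp (hε0 n)).ae_differentiableAt] with x hx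
      have : fderiv ℝ φ x = χ x • fderiv ℝ (c.ramp (ε n)) x + c.ramp (ε n) x • fderiv ℝ χ x :=
        ((hχ.differentiable one_ne_zero x).hasFDerivAt.mul hx.hasFDerivAt).fderiv
      rw [this]
      simp
      ring
    have hr := (c.lipschitz_ramp (hε0 n)).continuous.measurable.aestronglyMeasurable
      (μ := volume.restrict Ω)
    have i1 : IntegrableOn (fun x => c.ramp (ε n) x * (χ x * Laplacian.laplacian v x)) Ω :=
      (hΔ.bdd_mul (c := A) hχ.continuous.aestronglyMeasurable
        (Eventually.of_forall hA)).bdd_mul (c := 1) hr (Eventually.of_forall (hB n))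
    have i2 : IntegrableOn (fun x => c.ramp (ε n) x * fderiv ℝ χ x (G x)) Ω :=
      hiG.bdd_mul (c := 1) hr (Eventually.of_forall (hB n))
    have i3 : IntegrableOn (fun x => χ x * fderiv ℝ (c.ramp (ε n)) x (G x)) Ω :=
      (integrableOn_fderiv_apply hΩo hΩb (c.lipschitz_ramp (hε0 n)) hGc).bdd_mul (c := A)
        hχ.continuous.aestronglyMeasurable (Eventually.of_forall hA)
    rw [integral_congr_ae (ae_restrict_of_ae h2), integral_add i2 i3] at h1
    simp only [mul_add]
    rw [integral_add i1 i2]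
    have e : ∫ x in Ω, c.ramp (ε n) x * (χ x * Laplacian.laplacian v x) =
        ∫ x in Ω, φ x * Laplacian.laplacian v x := by
      congr 1; ext x; rw [hφ]; ring
    rw [e, h1]; ring
  have hleft : Tendsto (fun n => ∫ x in Ω, c.ramp (ε n) x *
      (χ x * Laplacian.laplacian v x + fderiv ℝ χ x (G x))) atTop
      (𝓝 (∫ x in Ω, (χ x * Laplacian.laplacian v x + fderiv ℝ χ x (G x)))) := by
    have hi : IntegrableOn (fun x => χ x * Laplacian.laplacian v x + fderiv ℝ χ x (G x)) Ω :=
      (hΔ.bdd_mul (c := A) hχ.continuous.aestronglyMeasurable (Eventually.of_forall hA)).add hiG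
    refine tendsto_integral_of_dominated_convergence _
      (fun n => (c.lipschitz_ramp (hε0 n)).continuous.aestronglyMeasurable.mul
        hi.aestronglyMeasurable) hi.norm (fun n => Eventually.of_forall fun x => ?_) ?_
    · rw [norm_mul]
      exact mul_le_of_le_one_left (norm_nonneg _) (hB n x)
    · filter_upwards [ae_restrict_mem hΩm] with x hx
      by_cases hxs : x ∈ tsupport χ
      · have hh := (c.mem_iff (hsub hxs)).1 hx
        have h2 : Tendsto (fun n => 2 * ε n) atTop (𝓝 0) := by simpa using hεt.const_mul 2
        refine tendsto_const_nhds.congr' ?_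
        filter_upwards [h2.eventually (gt_mem_nhds hh)] with n hn
        rw [c.ramp_eq_one (hε0 n) hn.le, one_mul]
      · have h0 : fderiv ℝ χ x = 0 := by
          have : χ =ᶠ[𝓝 x] fun _ => 0 := notMem_tsupport_iff_eventuallyEq.1 hxs
          rw [this.fderiv_eq]; simp
        simp [h0, image_eq_zero_of_notMem_tsupport hxs]
  set V := volume.real (Metric.ball x₀ (c.radius + 1)) with hV
  have hright : Tendsto (fun n => ∫ x in Ω, χ x * fderiv ℝ (c.ramp (ε n)) x (G x)) atTop
      (𝓝 0) := by
    have hunif := hΩb.isCompact_closure.uniformContinuousOn_of_continuous hGc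
    rw [Metric.uniformContinuousOn_iff] at hunif
    -- The bound by the oscillation `ω` of the gradient over distances of order `ε n`.
    have hbound : ∀ ω > 0, ∀ᶠ n in atTop,
        ‖∫ x in Ω, χ x * fderiv ℝ (c.ramp (ε n)) x (G x)‖ ≤ (A * (1 + c.lip) * (6 * V)) * ω := by
      intro ω hω
      obtain ⟨δ, hδ, hGδ⟩ := hunif ω hω
      have hsmall : 0 < min (min δ (c.radius / 2)) 1 := by positivity
      have h3 : Tendsto (fun n => 3 * ε n) atTop (𝓝 0) := by simpa using hεt.const_mul 3
      filter_upwards [h3.eventually (gt_mem_nhds hsmall)] with n hn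
      rw [lt_min_iff, lt_min_iff] at hn
      obtain ⟨⟨hn1, hn2⟩, hn3⟩ := hn
      have hεn := hε0 n
      set S := {x ∈ Metric.ball x₀ c.radius | 0 ≤ c.height x ∧ c.height x < 3 * ε n} with hS
      have hSm : MeasurableSet S := by
        apply Metric.isOpen_ball.measurableSet.inter
        exact (measurableSet_le measurable_const c.continuous_height.measurable).inter
          (measurableSet_lt c.continuous_height.measurable measurable_const)
      have hpt : ∀ᵐ x ∂(volume.restrict Ω), ‖χ x * fderiv ℝ (c.ramp (ε n)) x (G x)‖ₑ ≤
          S.indicator (fun _ => ENNReal.ofReal (A * ((ε n)⁻¹ * ((1 + c.lip) * ω)))) x := by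
        filter_upwards [ae_restrict_mem hΩm,
          ae_restrict_of_ae (c.lipschitz_ramp hεn).ae_differentiableAt,
          ae_restrict_of_ae c.lipschitz_height.ae_differentiableAt] with x hx hd1 hd2
        by_cases hxs : x ∈ tsupport χ
        swap
        · simp [image_eq_zero_of_notMem_tsupport hxs]
        have hxb := hsub hxs
        have hh := (c.mem_iff hxb).1 hx
        rcases lt_or_ge (2 * ε n) (c.height x) with h2 | h2
        · simp [c.fderiv_ramp_eq_zero hεn h2]
        rw [indicator_of_mem (show x ∈ S from ⟨hxb, hh.le, by linarith⟩),
          Real.enorm_eq_ofReal_abs, abs_mul]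
        refine ENNReal.ofReal_le_ofReal ?_
        -- The boundary point below `x`.
        set b := x + (-c.height x) • c.dir with hb
        have hxbd : dist x b = c.height x := by
          rw [hb, dist_self_add_right, norm_smul, c.norm_dir, mul_one, norm_neg,
            Real.norm_of_nonneg hh.le]
        have hbr : b ∈ Metric.ball x₀ c.radius := by
          have h4 := hχs hxs
          rw [Metric.mem_ball] at h4 ⊢
          linarith [dist_triangle b x x₀, dist_comm x b]
        have hb0 : c.height b = 0 := by rw [hb, c.height_add]; ring
        have hbf : b ∈ frontier Ω := by
          rw [hΩo.frontier_eq]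
          refine ⟨?_, fun h => ((c.mem_iff hbr).1 h).ne' hb0⟩
          have ht : Tendsto (fun t : ℝ => b + t • c.dir) (𝓝[>] 0) (𝓝 b) := by
            have : Continuous fun t : ℝ => b + t • c.dir := by fun_prop
            have h5 := this.tendsto 0
            simp only [zero_smul, add_zero] at h5
            exact h5.mono_left nhdsWithin_le_nhds
          refine mem_closure_of_tendsto ht ?_
          filter_upwards [ht.eventually (Metric.isOpen_ball.mem_nhds hbr),
            self_mem_nhdsWithin] with t h5 h6
          rw [c.mem_iff h5, c.height_add, hb0, zero_add]
          exact h6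
        have hdb : DifferentiableAt ℝ c.height b := by
          have h5 : DifferentiableAt ℝ (fun y => c.height (y + c.height x • c.dir)) b := by
            have h6 : DifferentiableAt ℝ (fun y : Space N => y + c.height x • c.dir) b := by
              fun_prop
            refine DifferentiableAt.comp b (g := c.height) (f := fun y => y + c.height x • c.dir) ?_ h6
            have : b + c.height x • c.dir = x := by rw [hb]; simp
            rw [this]; exact hd2
          simp only [c.height_add] at h5
          simpa using h5.sub_const (c.height x)
        have htan := c.fderiv_height_apply_eq_zero hv hGc hG hN hbf hbr hb0 hdb
        rw [hb, c.fderiv_height_translate, ← hb] at htan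
        have hosc : ‖G x - G b‖ ≤ ω := by
          rw [← dist_eq_norm]
          refine (hGδ x (subset_closure hx) b (frontier_subset_closure hbf) ?_).le
          rw [hxbd]; linarith
        gcongr
        · exact hA x
        · refine (c.abs_fderiv_ramp_le hεn hd1 hd2 _).trans ?_
          gcongr
          rw [← sub_zero (fderiv ℝ c.height x (G x)), ← htan, ← map_sub]
          refine ((fderiv ℝ c.height x).le_opNorm _).trans ?_
          gcongr
          exact_mod_cast norm_fderiv_le_of_lipschitz ℝ c.lipschitz_height
      have hen : ‖∫ x in Ω, χ x * fderiv ℝ (c.ramp (ε n)) x (G x)‖ₑ ≤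
          ENNReal.ofReal ((A * (1 + c.lip) * (6 * V)) * ω) := by
        refine (enorm_integral_le_lintegral_enorm _).trans ((lintegral_mono_ae hpt).trans ?_)
        refine (setLIntegral_le_lintegral _ _).trans ?_
        rw [lintegral_indicator_const hSm]
        refine (mul_le_mul_right (c.volume_layer_le (by positivity) hn3.le) _).trans (le_of_eq ?_)
        rw [← ENNReal.ofReal_toReal (measure_ball_lt_top (x := x₀) (r := c.radius + 1)
          (μ := volume)).ne, ← Measure.real, ← hV, ← ENNReal.ofReal_mul (by positivity),
          ← ENNReal.ofReal_mul (by positivity)]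
        congr 1
        field_simp
        ring
      rw [← toReal_enorm]
      exact ENNReal.toReal_le_of_le_ofReal (by positivity) hen
    rw [tendsto_zero_iff_norm_tendsto_zero, Metric.tendsto_nhds]
    intro η hη
    set B : ℝ := A * (1 + c.lip) * (6 * V) with hBdef
    have hB0 : 0 ≤ B := by positivity
    filter_upwards [hbound (η / (2 * (B + 1))) (by positivity)] with n hn
    rw [Real.dist_eq, sub_zero, abs_norm]
    refine hn.trans_lt ?_
    rw [mul_div_assoc', div_lt_iff₀ (by positivity)]
    nlinarith
  have h := tendsto_nhds_unique hleft ((hright.neg).congr fun n => (key n).symm)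
  rw [integral_add (hΔ.bdd_mul (c := A) hχ.continuous.aestronglyMeasurable
    (Eventually.of_forall hA)) hiG] at h
  linarith

/-! ### The total of the Laplacian -/

/-- The divergence theorem for the gradient of `v`, in the case of homogeneous Neumann conditions.
The second derivatives of `v` need not be bounded up to the boundary. -/
theorem integral_laplacian_eq_zero {Ω : Set (Space N)} (hΩo : IsOpen Ω)
    (hΩb : Bornology.IsBounded Ω) (hΩL : HasLipschitzBoundary Ω) {v : Space N → ℝ}
    (hC2 : ContDiffOn ℝ 2 v Ω) (hC1 : IsC1UpToBoundary Ω v)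
    (hN : ∀ x ∈ frontier Ω, ∀ ν, IsOuterUnitNormal Ω x ν → HasNormalDeriv v x ν 0)
    (hΔ : IntegrableOn (Laplacian.laplacian v) Ω) :
    ∫ x in Ω, Laplacian.laplacian v x = 0 := by
  obtain ⟨hv, G, hGc, hG⟩ := hC1
  have hΩm := hΩo.measurableSet
  have hK : IsCompact (frontier Ω) :=
    hΩb.isCompact_closure.of_isClosed_subset isClosed_frontier frontier_subset_closure
  set ch : ∀ x : frontier Ω, GraphChart Ω (x : Space N) := fun x =>
    (hΩL.nonempty_chart x.2).some
  obtain ⟨t, ht⟩ := hK.elim_finite_subcover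
    (fun x : frontier Ω => Metric.ball (x : Space N) ((ch x).radius / 2))
    (fun x => Metric.isOpen_ball) fun x hx => mem_iUnion.2 ⟨⟨x, hx⟩,
      Metric.mem_ball_self (half_pos (ch ⟨x, hx⟩).radius_pos)⟩
  set U : Option t → Set (Space N) := fun i => i.elim Ω
    fun x => Metric.ball ((x : frontier Ω) : Space N) ((ch x).radius / 2) with hU
  have hUo : ∀ i, IsOpen (U i) := by
    rintro (_ | x)
    · exact hΩo
    · exact Metric.isOpen_ball
  have hUb : ∀ i, Bornology.IsBounded (U i) := by
    rintro (_ | x)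
    · exact hΩb
    · exact Metric.isBounded_ball
  have hcov : closure Ω ⊆ ⋃ i, U i := by
    intro x hx
    by_cases hxΩ : x ∈ Ω
    · exact mem_iUnion.2 ⟨none, hxΩ⟩
    · have hxf : x ∈ frontier Ω := by rw [hΩo.frontier_eq]; exact ⟨hx, hxΩ⟩
      obtain ⟨y, hy, hxy⟩ := mem_iUnion₂.1 (ht hxf)
      exact mem_iUnion.2 ⟨some ⟨y, hy⟩, hxy⟩
  obtain ⟨f, hf⟩ := SmoothPartitionOfUnity.exists_isSubordinate
    (modelWithCornersSelf ℝ (Space N)) isClosed_closure U hUo hcov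
  have hsm : ∀ i, ContDiff ℝ 1 (f i) := fun i => (f i).contMDiff.contDiff.of_le (by simp)
  have hcs : ∀ i, HasCompactSupport (f i) := fun i =>
    Metric.isCompact_of_isClosed_isBounded (isClosed_tsupport _) ((hUb i).subset (hf i))
  have hgreen : ∀ i, ∫ x in Ω, f i x * Laplacian.laplacian v x = -∫ x in Ω, fderiv ℝ (f i) x (G x) := by
    rintro (_ | x)
    · obtain ⟨C, hC⟩ := (hsm none).lipschitzWith_of_hasCompactSupport (hcs none) one_ne_zero
      exact integral_mul_laplacian_of_tsupport_subset hΩo hC2 hG hC (hcs none) (hf none)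
    · exact (ch x).integral_mul_laplacian hΩo hΩb hC2 hv hGc hG hN hΔ (hsm (some x)) (hcs (some x))
        (hf (some x))
  have hsum : ∀ x ∈ Ω, ∑ i, f i x = 1 := fun x hx => by
    rw [← finsum_eq_sum_of_fintype]; exact f.sum_eq_one (subset_closure hx)
  have hsum' : ∀ x ∈ Ω, ∑ i, fderiv ℝ (f i) x (G x) = 0 := by
    intro x hx
    have h1 : (fun y => ∑ i, f i y) =ᶠ[𝓝 x] fun _ => 1 := by
      filter_upwards [hΩo.mem_nhds hx] with y hy
      exact hsum y hy
    have h2 : fderiv ℝ (fun y => ∑ i, f i y) x = ∑ i, fderiv ℝ (f i) x :=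
      fderiv_fun_sum fun i _ => (hsm i).differentiable one_ne_zero x
    rw [h1.fderiv_eq] at h2
    have h3 := congrArg (fun L : Space N →L[ℝ] ℝ => L (G x)) h2
    simpa using h3.symm
  have i1 : ∀ i, IntegrableOn (fun x => f i x * Laplacian.laplacian v x) Ω := fun i => by
    obtain ⟨A, hA⟩ := (hcs i).exists_bound_of_continuous (hsm i).continuous
    exact hΔ.bdd_mul (c := A) (hsm i).continuous.aestronglyMeasurable (Eventually.of_forall hA)
  have i2 : ∀ i, IntegrableOn (fun x => fderiv ℝ (f i) x (G x)) Ω := fun i => by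
    obtain ⟨C, hC⟩ := (hsm i).lipschitzWith_of_hasCompactSupport (hcs i) one_ne_zero
    exact integrableOn_fderiv_apply hΩo hΩb hC hGc
  calc ∫ x in Ω, Laplacian.laplacian v x
      = ∫ x in Ω, ∑ i, f i x * Laplacian.laplacian v x := by
        refine setIntegral_congr_fun hΩm fun x hx => ?_
        rw [← Finset.sum_mul, hsum x hx, one_mul]
    _ = ∑ i, ∫ x in Ω, f i x * Laplacian.laplacian v x := integral_finsetSum _ fun i _ => i1 i
    _ = -∑ i, ∫ x in Ω, fderiv ℝ (f i) x (G x) := by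
        rw [← Finset.sum_neg_distrib]; exact Finset.sum_congr rfl fun i _ => hgreen i
    _ = -∫ x in Ω, ∑ i, fderiv ℝ (f i) x (G x) := by rw [integral_finsetSum _ fun i _ => i2 i]
    _ = 0 := by
        rw [setIntegral_congr_fun hΩm hsum']; simp

/-! ### Conservation in time -/

/-- A function that is continuous in `x` for each `t` and continuously differentiable in `t` for
each `x` has a jointly measurable time derivative. -/
theorem aestronglyMeasurable_deriv_time {Ω : Set (Space N)} (hΩo : IsOpen Ω)
    {u : Space N → ℝ → ℝ} (hx : ∀ t > 0, ContinuousOn (fun x => u x t) Ω)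
    (ht : ∀ x ∈ Ω, ContDiffOn ℝ 1 (u x) (Ioi 0)) {a b : ℝ} (ha : 0 < a) :
    AEStronglyMeasurable (fun q : Space N × ℝ => deriv (u q.1) q.2)
      ((volume.restrict Ω).prod (volume.restrict (Ioc a b))) := by
  have hΩm := hΩo.measurableSet
  -- Freezing the time before `a` and the space outside `Ω` makes the function globally defined.
  set U : ℝ → Space N → ℝ := fun t => Ω.indicator fun x => u x (max a t) with hU
  have hpos : ∀ t, 0 < max a t := fun t => ha.trans_le (le_max_left _ _)
  have hUm : StronglyMeasurable (Function.uncurry fun x t => U t x) := by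
    have h1 : ∀ x, Continuous fun t => U t x := by
      intro x
      by_cases hxΩ : x ∈ Ω
      · simp only [hU, indicator_of_mem hxΩ]
        exact (ht x hxΩ).continuousOn.comp_continuous (by fun_prop) fun t => hpos t
      · simp only [hU, indicator_of_notMem hxΩ]
        exact continuous_const
    have h2 : ∀ t, StronglyMeasurable (U t) := by
      intro t
      refine Measurable.stronglyMeasurable ?_
      refine measurable_of_restrict_of_restrict_compl hΩm ?_ ?_
      · have h3 := (continuousOn_iff_continuous_domRestrict.1 (hx _ (hpos t))).measurable
        convert h3 using 1
        ext x
        simp [hU]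
      · convert (measurable_const : Measurable fun _ : (Ωᶜ : Set (Space N)) => (0 : ℝ)) using 1
        ext x
        simpa [hU] using fun h => absurd h x.2
    have h3 := stronglyMeasurable_uncurry_of_continuous_of_stronglyMeasurable
      (u := U) h1 h2
    exact h3.comp_measurable measurable_swap
  set W : ℕ → Space N × ℝ → ℝ := fun n q =>
    ((n : ℝ) + 1) * (U (q.2 + 1 / ((n : ℝ) + 1)) q.1 - U q.2 q.1) with hW
  have hWm : ∀ n, StronglyMeasurable (W n) := by
    intro n
    refine StronglyMeasurable.const_mul (StronglyMeasurable.sub ?_ hUm) _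
    exact hUm.comp_measurable (g := fun q : Space N × ℝ => (q.1, q.2 + 1 / ((n : ℝ) + 1)))
      (by fun_prop)
  refine aestronglyMeasurable_of_tendsto_ae atTop (fun n => (hWm n).aestronglyMeasurable) ?_
  rw [Measure.prod_restrict]
  filter_upwards [ae_restrict_mem (hΩm.prod measurableSet_Ioc)] with q hq
  obtain ⟨x, t⟩ := q
  obtain ⟨hxΩ, hat, -⟩ := hq
  simp only at hxΩ hat
  have ht0 : 0 < t := ha.trans hat
  have hd : HasDerivAt (u x) (deriv (u x) t) t :=
    (((ht x hxΩ).differentiableOn one_ne_zero).differentiableAt (Ioi_mem_nhds ht0)).hasDerivAt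
  have hseq : Tendsto (fun n : ℕ => 1 / ((n : ℝ) + 1)) atTop (𝓝[≠] 0) := by
    refine tendsto_nhdsWithin_iff.2 ⟨tendsto_one_div_add_atTop_nhds_zero_nat, ?_⟩
    exact Eventually.of_forall fun n => by
      have : (0 : ℝ) < 1 / ((n : ℝ) + 1) := by positivity
      exact this.ne'
  refine ((hasDerivAt_iff_tendsto_slope_zero.1 hd).comp hseq).congr fun n => ?_
  have h1 : max a (t + 1 / ((n : ℝ) + 1)) = t + 1 / ((n : ℝ) + 1) :=
    max_eq_right (hat.le.trans (by have : (0 : ℝ) < 1 / ((n : ℝ) + 1) := by positivity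
                                   linarith))
  simp only [hW, hU, indicator_of_mem hxΩ, h1, max_eq_right hat.le, Function.comp_apply,
    smul_eq_mul]
  rw [one_div, inv_inv]

/-- If the time derivative has zero integral over `Ω` at each time, the integral is the same at any
two positive times. -/
theorem integral_eq_of_integral_deriv_eq_zero {Ω : Set (Space N)} (hΩo : IsOpen Ω)
    {u : Space N → ℝ → ℝ} (hx : ∀ t > 0, ContinuousOn (fun x => u x t) Ω)
    (hi : ∀ t > 0, IntegrableOn (fun x => u x t) Ω)
    (ht : ∀ x ∈ Ω, ContDiffOn ℝ 1 (u x) (Ioi 0))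
    (hdt : IsLocBoundedL1 Ω fun x t => deriv (u x) t)
    (h0 : ∀ t > 0, ∫ x in Ω, deriv (u x) t = 0) {a b : ℝ} (ha : 0 < a) (hab : a ≤ b) :
    ∫ x in Ω, u x b = ∫ x in Ω, u x a := by
  have hb : 0 < b := ha.trans_le hab
  have hsub : Icc a b ⊆ Ioi 0 := fun t h => ha.trans_le h.1
  obtain ⟨C, hC⟩ := hdt (Icc a b) isCompact_Icc hsub
  have hC' : ∀ᵐ t ∂(volume.restrict (Ioc a b)), IntegrableOn (fun x => deriv (u x) t) Ω ∧
      ∫ x in Ω, |deriv (u x) t| ≤ C :=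
    ae_restrict_of_ae_restrict_of_subset Ioc_subset_Icc_self hC
  have hm := aestronglyMeasurable_deriv_time hΩo hx ht (b := b) ha
  have hint : Integrable (fun q : Space N × ℝ => deriv (u q.1) q.2)
      ((volume.restrict Ω).prod (volume.restrict (Ioc a b))) := by
    rw [integrable_prod_iff' hm]
    refine ⟨hC'.mono fun t h => h.1, ?_⟩
    refine Integrable.of_bound ?_ C (hC'.mono fun t h => ?_)
    · exact hm.norm.prod_swap.integral_prod_right'
    · rw [Real.norm_of_nonneg (integral_nonneg fun x => norm_nonneg _)]
      exact h.2
  have hftc : ∀ x ∈ Ω, ∫ t in Ioc a b, deriv (u x) t = u x b - u x a := by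
    intro x hxΩ
    rw [← intervalIntegral.integral_of_le hab]
    have h1 := ht x hxΩ
    refine intervalIntegral.integral_eq_sub_of_hasDerivAt (fun t htab => ?_) ?_
    · rw [uIcc_of_le hab] at htab
      exact ((h1.differentiableOn one_ne_zero).differentiableAt
        (Ioi_mem_nhds (hsub htab))).hasDerivAt
    · refine ContinuousOn.intervalIntegrable ?_
      rw [uIcc_of_le hab]
      exact (h1.continuousOn_deriv_of_isOpen isOpen_Ioi le_rfl).mono hsub
  have h1 : ∫ x in Ω, (u x b - u x a) = 0 := by
    calc ∫ x in Ω, (u x b - u x a) = ∫ x in Ω, ∫ t in Ioc a b, deriv (u x) t :=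
          setIntegral_congr_fun hΩo.measurableSet fun x hxΩ => (hftc x hxΩ).symm
      _ = ∫ t in Ioc a b, ∫ x in Ω, deriv (u x) t := integral_integral_swap hint
      _ = ∫ t in Ioc a b, (0 : ℝ) :=
          setIntegral_congr_fun measurableSet_Ioc fun t h => h0 t (ha.trans h.1)
      _ = 0 := by simp
  rw [integral_sub (hi b hb) (hi a ha)] at h1
  linarith

/-- The integral over `Ω` of the operator vanishes under homogeneous Neumann conditions. -/
theorem integral_mixedOperator_eq_zero (hN : 1 ≤ N) {α : ℝ} {μ : Measure Exponent}
    [IsFiniteMeasure μ] {Ω : Set (Space N)} (hΩo : IsOpen Ω)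
    (hΩb : Bornology.IsBounded Ω) (hΩL : HasLipschitzBoundary Ω) {v : Space N → ℝ}
    (hv : MemLp v ⊤ volume) (hc : ContinuousOn v (closure Ω)) (hC2 : ContDiffOn ℝ 2 v Ω)
    (hν : HomogeneousNeumannConditions α μ Ω v)
    (hlap : IntegrableOn (fun x => α * Laplacian.laplacian v x) Ω)
    (hfrac : Integrable (fun p : Space N × Exponent => fracLaplacian (p.2 : ℝ) v p.1)
      ((volume.restrict Ω).prod μ))
    (hC1 : α ≠ 0 → IsC1UpToBoundary Ω v)
    (hcross : μ ≠ 0 → Integrable (fun p : Space N × Space N × Exponent =>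
        (v p.1 - v p.2.1) / ‖p.1 - p.2.1‖ ^ ((N : ℝ) + 2 * (p.2.2 : ℝ)))
      ((volume.restrict Ω).prod ((volume.restrict Ωᶜ).prod μ))) :
    ∫ x in Ω, mixedOperator α μ v x = 0 := by
  have h1 : ∫ x in Ω, α * Laplacian.laplacian v x = 0 := by
    rcases eq_or_ne α 0 with rfl | hα
    · simp
    · have hΔ : IntegrableOn (Laplacian.laplacian v) Ω := by
        refine (hlap.const_mul α⁻¹).congr (Eventually.of_forall fun x => ?_)
        simp only
        rw [inv_mul_cancel_left₀ hα]
      rw [integral_const_mul, integral_laplacian_eq_zero hΩo hΩb hΩL hC2 (hC1 hα)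
        (hν.1 hα) hΔ, mul_zero]
  have h2 : ∫ x in Ω, ∫ s : Exponent, fracLaplacian (s : ℝ) v x ∂μ = 0 := by
    rcases eq_or_ne μ 0 with rfl | hμ
    · simp
    · exact integral_integral_fracLaplacian_eq_zero hN hΩo hΩb hΩL μ hv hc hC2 hfrac (hcross hμ)
        (hν.2 hμ)
  simp only [mixedOperator]
  have i1 : IntegrableOn (fun x => -(α * Laplacian.laplacian v x)) Ω := hlap.neg
  have i2 : IntegrableOn (fun x => ∫ s : Exponent, fracLaplacian (s : ℝ) v x ∂μ) Ω :=
    hfrac.integral_prod_left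
  rw [integral_add i1 i2, integral_neg, h1, h2, neg_zero, add_zero]

end FracNeumann

end

theorem proposition5p1 (N : ℕ) (hN : 1 ≤ N)
    (α : ℝ) (hα : 0 ≤ α)
    (μ : Measure FracNeumann.Exponent) [IsFiniteMeasure μ]
    (Ω : Set (FracNeumann.Space N)) (hΩo : IsOpen Ω) (hΩb : Bornology.IsBounded Ω)
    (hΩL : FracNeumann.HasLipschitzBoundary Ω)
    (u₀ : FracNeumann.Space N → ℝ) (u : FracNeumann.Space N → ℝ → ℝ)
    (hu : FracNeumann.IsClassicalSolution α μ Ω u₀ u)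
    (hdt : FracNeumann.IsLocBoundedL1 Ω (fun x t => deriv (u x) t))
    (hlap : ∀ t > 0, IntegrableOn (fun x => α * Laplacian.laplacian (fun z => u z t) x) Ω)
    (hfrac : ∀ t > 0, Integrable
      (fun p : FracNeumann.Space N × FracNeumann.Exponent =>
        FracNeumann.fracLaplacian (p.2 : ℝ) (fun z => u z t) p.1)
      ((volume.restrict Ω).prod μ))
    (hC1 : α ≠ 0 → ∀ t > 0, FracNeumann.IsC1UpToBoundary Ω (fun x => u x t))
    (hcross : μ ≠ 0 → ∀ t > 0, Integrable
      (fun p : FracNeumann.Space N × FracNeumann.Space N × FracNeumann.Exponent =>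
        (u p.1 t - u p.2.1 t) / ‖p.1 - p.2.1‖ ^ ((N : ℝ) + 2 * (p.2.2 : ℝ)))
      ((volume.restrict Ω).prod ((volume.restrict Ωᶜ).prod μ)))
    (hdom : ∃ G : FracNeumann.Space N → ℝ, IntegrableOn G Ω ∧ ∃ δ > 0, ∀ t ∈ Ioo 0 δ,
      ∀ᵐ x ∂(volume.restrict Ω), |u x t| ≤ G x) :
    ∀ t > 0, ∫ x in Ω, u x t = ∫ x in Ω, u₀ x := by
  have hΩm := hΩo.measurableSet
  have hcont : ∀ t > 0, ContinuousOn (fun x => u x t) Ω := fun t ht =>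
    (hu.continuousOn_closure t ht.le).mono subset_closure
  have hint : ∀ t > 0, IntegrableOn (fun x => u x t) Ω := fun t ht =>
    ((hu.continuousOn_closure t ht.le).integrableOn_compact hΩb.isCompact_closure).mono_set
      subset_closure
  have hzero : ∀ t > 0, ∫ x in Ω, deriv (u x) t = 0 := by
    intro t ht
    have h := FracNeumann.integral_mixedOperator_eq_zero hN hΩo hΩb hΩL (hu.memLp_top t ht.le)
      (hu.continuousOn_closure t ht.le) (hu.contDiffOn_space t ht.le) (hu.neumann t ht) (hlap t ht)
      (hfrac t ht) (fun hα => hC1 hα t ht) (fun hμ => hcross hμ t ht)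
    rw [← neg_eq_zero, ← integral_neg] at h
    rw [← h]
    refine setIntegral_congr_fun hΩm fun x hx => ?_
    exact eq_neg_of_add_eq_zero_left (hu.equation x hx t ht)
  intro t ht
  obtain ⟨G, hG, δ, hδ, hGb⟩ := hdom
  have hlim : Tendsto (fun a => ∫ x in Ω, u x a) (𝓝[>] 0) (𝓝 (∫ x in Ω, u x 0)) := by
    refine tendsto_integral_filter_of_dominated_convergence G ?_ ?_ hG ?_
    · filter_upwards [self_mem_nhdsWithin] with a ha
      exact (hint a ha).aestronglyMeasurable
    · filter_upwards [Ioo_mem_nhdsGT hδ] with a ha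
      exact hGb a ha
    · filter_upwards [ae_restrict_mem hΩm] with x hx
      exact (hu.continuousOn_time x hx 0 self_mem_Ici).mono_left
        (nhdsWithin_mono _ Ioi_subset_Ici_self)
  have hconst : ∀ᶠ a in 𝓝[>] (0 : ℝ), ∫ x in Ω, u x a = ∫ x in Ω, u x t := by
    filter_upwards [Ioo_mem_nhdsGT ht] with a ha
    exact (FracNeumann.integral_eq_of_integral_deriv_eq_zero hΩo hcont hint hu.contDiffOn_time hdt
      hzero ha.1 ha.2.le).symm
  rw [← tendsto_nhds_unique hlim (tendsto_const_nhds.congr' (hconst.mono fun a h => h.symm))]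
  exact setIntegral_congr_fun hΩm fun x hx => hu.initial x hx
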